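/- Let $d\ge 2$, let $\mathbb S^{d-1}$ be the unit sphere of $\mathbb R^d$, $\mathcal H^{k}$ the $k$-dimensional Hausdorff measure (normalized so that $\mathcal H^k$ is surface measure on $k$-dimensional spheres) and $\kappa_{k}=\mathcal H^{k}(\mathbb S^{k})$. **Kernels.** For each $\varepsilon>0$ let $j_\varepsilon\ge 0$ be a function on $\mathbb R^d$ which on $\mathbb R^d\setminus\{0\}$ is radial, radially non-increasing and not identically zero, with $\int_{\mathbb R^d}(1\wedge|x|)j_\varepsilon(x)\,dx<\infty$. Let $g_\varepsilon:\mathbb S^{d-1}\to[0,\infty)$ be continuous with $g_\varepsilon(-\theta)=g_\varepsilon(\theta)$, converging uniformly on $\mathbb S^{d-1}$, as $\varepsilon\downarrow0$, to a function $g$ with $C_g:=\int_{\mathbb S^{d-1}}g\,d\mathcal H^{d-1}\neq 0$. Put $\phi_\varepsilon(x)=g_\varepsilon(x/|x|)\,j_\varepsilon(x)$, and for a kernel $\phi$ put $C_{\phi}=\int_{\mathbb R^d}(1\wedge|x|)\phi(x)\,dx$ and $\lambda_\phi(dx)=C_\phi^{-1}(1\wedge|x|)\phi(x)\,dx$. Assume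 that $\lim_{\varepsilon\downarrow0}\lambda_{\phi_\varepsilon}(B_R^c)=0$ for every $R>0$, where $B_R$ is the ball of radius $R$ centred at the origin. **Sets.** Let $\mathfrak C$ be the class of closures of open subsets of $\mathbb R^d$ with compact boundary of class $C^2$. Write $E_n\to E$ in $\mathfrak C$ if there are $C^2$-diffeomorphisms $\Phi_n$ of $\mathbb R^d$ with $E_n=\Phi_n(E)$ such that $\Phi_n-\mathrm{Id}$ and its derivatives of order one and two tend to $0$ uniformly on compact sets. For $E\in\mathfrak C$, $x\in\partial E$, let $\nu$ be the outer unit normal to $\partial E$ at $x$. Near $x$ the set $E$ has the form $\{x+y'+h\nu:\ y'\in\nu^\perp,\ h\le f(y')\}$ with $f$ of class $C^2$, $f(0)=0$, $\nabla f(0)=0$; the classical directional curvature is $K_e(x,E)=-D^2f(0)e\cdot e$ for unit $e\in\nu^\perp$. **Nonlocal curvatures.** Let $\widetilde\chi_E=\chi_{E^c}-\chi_E$. Put $$H_\phi(x,E)=\frac1{\kappa_{d-2}}\lim_{r\downarrow0}\int_{B_r(x)^c}\widetilde\chi_E(y)\,\phi(x-y)\,dy ,$$ and, for orthonormal $e,\nu$,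 $$K^{\nu}_{\phi,e}(x,E)=\frac12\lim_{r\downarrow0}\iint_{\{\rho\ne0,\ \rho^2+h^2\ge r^2\}}\widetilde\chi_E(x+\rho e+h\nu)\,|\rho|^{d-2}\,\phi(-\rho e-h\nu)\,d\rho\,dh .$$ **Theorem.** Let $\varepsilon_n>0$, $\varepsilon_n\to0$, let $E,E_n\in\mathfrak C$ with $E_n\to E$ in $\mathfrak C$, let $x\in\partial E\cap\bigcap_n\partial E_n$, and let $\nu$ be the outer unit normal to $\partial E$ at $x$. 1. For every unit vector $e\in\nu^\perp$, the limit defining $K^{\nu}_{\phi_{\varepsilon_n},e}(x,E_n)$ exists and is finite for all large $n$, and $$\lim_{n\to\infty}C_{\phi_{\varepsilon_n}}^{-1}K^{\nu}_{\phi_{\varepsilon_n},e}(x,E_n)=C_g^{-1}\,g(e)\,K_e(x,E).$$ 2. The same holds with each set's own normal: if $\nu_n$ is the outer unit normal to $\partial E_n$ at $x$, $e_n\in\nu_n^\perp$ are unit vectors and $e_n\to e$ for a unit vector $e\in\nu^\perp$, then the limits defining $K^{\nu_n}_{\phi_{\varepsilon_n},e_n}(x,E_n)$ exist and are finite for all $n$,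 and $$\lim_{n\to\infty}C_{\phi_{\varepsilon_n}}^{-1}K^{\nu_n}_{\phi_{\varepsilon_n},e_n}(x,E_n)=C_g^{-1}\,g(e)\,K_e(x,E).$$ 3. The limits defining $H_{\phi_{\varepsilon_n}}(x,E_n)$ exist and are finite for all $n$, and $$\lim_{n\to\infty}C_{\phi_{\varepsilon_n}}^{-1}H_{\phi_{\varepsilon_n}}(x,E_n)=\frac1{C_g\,\kappa_{d-2}}\int_{\{e\in\nu^\perp:\ |e|=1\}}g(e)\,K_e(x,E)\,\mathcal H^{d-2}(de).$$ -/

import Mathlib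

open MeasureTheory Filter Topology Metric Set

noncomputable section

namespace NonlocalCurvature

/-- The surface measure on the unit sphere of a finite-dimensional Euclidean space `W`, i.e. the
`(dim W - 1)`-dimensional Hausdorff measure in the normalization in which Hausdorff measure of top
dimension is Lebesgue measure. -/
def surfaceMeasure (W : Type*) [NormedAddCommGroup W] [InnerProductSpace ℝ W]
    [FiniteDimensional ℝ W] [MeasurableSpace W] [BorelSpace W] : Measure (sphere (0 : W) 1) :=
  (volume : Measure W).toSphere

/-- `κ_k`, the surface area of the unit sphere `𝕊^k` of `ℝ^(k+1)` (so `κ_0 = 2`). -/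
def sphereArea (k : ℕ) : ℝ :=
  (surfaceMeasure (EuclideanSpace ℝ (Fin (k + 1)))).real univ

variable {d : ℕ}

/-! ### Sets with `C²` boundary -/

/-- Near `x`, the set `S` is the subgraph, in the direction of the unit vector `ν`, of a `C²`
function `f` on the hyperplane `ν^⊥` which has a critical zero at the origin: in the coordinates
`y = x + y' + h ν` with `y' ∈ ν^⊥`, points near `x` with `h < f y'` lie in `S` and points near `x`
with `h > f y'` do not. -/
def IsLocalSubgraph (S : Set (EuclideanSpace ℝ (Fin d))) (x ν : EuclideanSpace ℝ (Fin d))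
    (f : (ℝ ∙ ν)ᗮ → ℝ) : Prop :=
  ‖ν‖ = 1 ∧ ContDiffAt ℝ 2 f 0 ∧ f 0 = 0 ∧ fderiv ℝ f 0 = 0 ∧
    ∀ᶠ p : (ℝ ∙ ν)ᗮ × ℝ in 𝓝 0,
      (p.2 < f p.1 → x + (p.1 : EuclideanSpace ℝ (Fin d)) + p.2 • ν ∈ S) ∧
      (f p.1 < p.2 → x + (p.1 : EuclideanSpace ℝ (Fin d)) + p.2 • ν ∉ S)

/-- `ν` is the outer unit normal vector to the boundary of `S` at `x`. -/
def IsOuterUnitNormal (S : Set (EuclideanSpace ℝ (Fin d)))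
    (x ν : EuclideanSpace ℝ (Fin d)) : Prop :=
  ∃ f : (ℝ ∙ ν)ᗮ → ℝ, IsLocalSubgraph S x ν f

/-- The boundary of `S` is of class `C²`. -/
def HasC2Boundary (S : Set (EuclideanSpace ℝ (Fin d))) : Prop :=
  ∀ x ∈ frontier S, ∃ ν, IsOuterUnitNormal S x ν

/-- The class of closures of open sets with compact `C²` boundary. -/
def IsC2Set (E : Set (EuclideanSpace ℝ (Fin d))) : Prop :=
  ∃ U, IsOpen U ∧ IsCompact (frontier U) ∧ HasC2Boundary U ∧ E = closure U

/-- `E_n → E`: there are `C²`-diffeomorphisms `Φ_n` of `ℝ^d` with `E_n = Φ_n(E)` and `Φ_n → Id`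
in `C²`, i.e. `Φ_n - Id` and its derivatives of order one and two tend to zero, uniformly on
compact sets. -/
def ConvergesC2 (En : ℕ → Set (EuclideanSpace ℝ (Fin d)))
    (E : Set (EuclideanSpace ℝ (Fin d))) : Prop :=
  ∃ Φ : ℕ → EuclideanSpace ℝ (Fin d) ≃ EuclideanSpace ℝ (Fin d),
    (∀ n, ContDiff ℝ 2 (Φ n)) ∧ (∀ n, ContDiff ℝ 2 (Φ n).symm) ∧
    (∀ k : ℕ, k ≤ 2 → TendstoLocallyUniformly
      (fun n z => iteratedFDeriv ℝ k (fun y => Φ n y - y) z) (fun _ => 0) atTop) ∧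
    ∀ n, En n = Φ n '' E

open Classical in
/-- The classical directional curvature `K_e(x,E) = - D²f(0) e ⬝ e`, where `f` is the function on
the hyperplane `ν^⊥` whose subgraph is `E` near `x`. The value does not depend on the choice of
`f`, see `directionalCurvature_eq`. -/
def directionalCurvature (E : Set (EuclideanSpace ℝ (Fin d))) (x ν : EuclideanSpace ℝ (Fin d))
    (e : (ℝ ∙ ν)ᗮ) : ℝ :=
  if h : IsOuterUnitNormal E x ν then - iteratedFDeriv ℝ 2 h.choose 0 ![e, e] else 0

theorem IsLocalSubgraph.eventuallyEq {S : Set (EuclideanSpace ℝ (Fin d))}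
    {x ν : EuclideanSpace ℝ (Fin d)} {f f' : (ℝ ∙ ν)ᗮ → ℝ}
    (h : IsLocalSubgraph S x ν f) (h' : IsLocalSubgraph S x ν f') : f =ᶠ[𝓝 0] f' := by
  obtain ⟨-, hc, h0, -, hs⟩ := h
  obtain ⟨-, hc', h0', -, hs'⟩ := h'
  have hm : Tendsto (fun y : (ℝ ∙ ν)ᗮ => (y, (f y + f' y) / 2)) (𝓝 0) (𝓝 0) := by
    have h1 : ContinuousAt (fun y : (ℝ ∙ ν)ᗮ => (y, (f y + f' y) / 2)) 0 :=
      continuousAt_id.prodMk ((hc.continuousAt.add hc'.continuousAt).div_const 2)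
    have h2 := h1.tendsto
    simp only [h0, h0', add_zero, zero_div] at h2
    exact h2
  filter_upwards [hm.eventually hs, hm.eventually hs'] with y hy hy'
  rcases lt_trichotomy (f y) (f' y) with hlt | heq | hgt
  · exact absurd (hy'.1 (show (f y + f' y) / 2 < f' y by linarith))
      (hy.2 (show f y < (f y + f' y) / 2 by linarith))
  · exact heq
  · exact absurd (hy.1 (show (f y + f' y) / 2 < f y by linarith))
      (hy'.2 (show f' y < (f y + f' y) / 2 by linarith))

theorem directionalCurvature_eq {E : Set (EuclideanSpace ℝ (Fin d))}
    {x ν : EuclideanSpace ℝ (Fin d)} {f : (ℝ ∙ ν)ᗮ → ℝ} (h : IsLocalSubgraph E x ν f)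
    (e : (ℝ ∙ ν)ᗮ) :
    directionalCurvature E x ν e = - iteratedFDeriv ℝ 2 f 0 ![e, e] := by
  have hex : IsOuterUnitNormal E x ν := ⟨f, h⟩
  rw [directionalCurvature, dif_pos hex,
    ((hex.choose_spec.eventuallyEq h).iteratedFDeriv ℝ 2).eq_of_nhds]

/-! ### Nonlocal curvatures -/

/-- `χ̃_E = χ_{E^c} - χ_E`. -/
def signedIndicator (E : Set (EuclideanSpace ℝ (Fin d))) (y : EuclideanSpace ℝ (Fin d)) : ℝ :=
  Eᶜ.indicator 1 y - E.indicator 1 y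

/-- `∫_{B_r(x)^c} χ̃_E(y) φ(x - y) dy`. -/
def truncatedMean (φ : EuclideanSpace ℝ (Fin d) → ℝ) (x : EuclideanSpace ℝ (Fin d))
    (E : Set (EuclideanSpace ℝ (Fin d))) (r : ℝ) : ℝ :=
  ∫ y in (ball x r)ᶜ, signedIndicator E y * φ (x - y)

/-- The principal value defining the nonlocal mean curvature exists and is finite. -/
def NonlocalMeanExists (φ : EuclideanSpace ℝ (Fin d) → ℝ) (x : EuclideanSpace ℝ (Fin d))
    (E : Set (EuclideanSpace ℝ (Fin d))) : Prop :=
  ∃ l : ℝ, Tendsto (truncatedMean φ x E) (𝓝[>] 0) (𝓝 l)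

/-- The nonlocal mean curvature `H_φ(x,E)`. -/
def nonlocalMean (φ : EuclideanSpace ℝ (Fin d) → ℝ) (x : EuclideanSpace ℝ (Fin d))
    (E : Set (EuclideanSpace ℝ (Fin d))) : ℝ :=
  (sphereArea (d - 2))⁻¹ * limUnder (𝓝[>] 0) (truncatedMean φ x E)

/-- The point `x + ρ e + h ν` of the plane through `x` spanned by `e` and `ν`. -/
def planePoint (x e ν : EuclideanSpace ℝ (Fin d)) (p : ℝ × ℝ) : EuclideanSpace ℝ (Fin d) :=
  x + p.1 • e + p.2 • ν

/-- `∫_{B_r(x)^c ∩ π(x,e)} χ̃_E(y) |Px - Py|^(d-2) φ(x - y) dy`, where `π(x,e)` consists of the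
points `y = x + ρ e + h ν` with `ρ ≠ 0`, `P` is the projection onto the line through `x` in
direction `e` (so `|Px - Py| = |ρ|`), and `dy = dρ dh`; here `e`, `ν` are orthonormal. -/
def truncatedDirectional (φ : EuclideanSpace ℝ (Fin d) → ℝ) (x ν e : EuclideanSpace ℝ (Fin d))
    (E : Set (EuclideanSpace ℝ (Fin d))) (r : ℝ) : ℝ :=
  ∫ p in {p : ℝ × ℝ | p.1 ≠ 0 ∧ planePoint x e ν p ∈ (ball x r)ᶜ},
    signedIndicator E (planePoint x e ν p) * |p.1| ^ (d - 2) * φ (x - planePoint x e ν p)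

/-- The principal value defining the nonlocal directional curvature exists and is finite. -/
def NonlocalDirectionalExists (φ : EuclideanSpace ℝ (Fin d) → ℝ)
    (x ν e : EuclideanSpace ℝ (Fin d)) (E : Set (EuclideanSpace ℝ (Fin d))) : Prop :=
  ∃ l : ℝ, Tendsto (truncatedDirectional φ x ν e E) (𝓝[>] 0) (𝓝 l)

/-- The nonlocal directional curvature `K_{φ,e}(x,E)`, in the plane spanned by `e` and `ν`. -/
def nonlocalDirectional (φ : EuclideanSpace ℝ (Fin d) → ℝ)
    (x ν e : EuclideanSpace ℝ (Fin d)) (E : Set (EuclideanSpace ℝ (Fin d))) : ℝ :=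
  (1 / 2) * limUnder (𝓝[>] 0) (truncatedDirectional φ x ν e E)

/-! ### Kernels -/

/-- `j` is radial and radially non-increasing away from the origin (where `j` may be singular). -/
def RadiallyNonincreasing (j : EuclideanSpace ℝ (Fin d) → ℝ) : Prop :=
  ∀ x y, x ≠ 0 → ‖x‖ ≤ ‖y‖ → j y ≤ j x

/-- `φ(x) = g(x/|x|) j(x)`; only the values of `g` on the unit sphere matter for `x ≠ 0`. -/
def kernel (g j : EuclideanSpace ℝ (Fin d) → ℝ) (x : EuclideanSpace ℝ (Fin d)) : ℝ :=
  g (‖x‖⁻¹ • x) * j x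

/-- `C_φ = ∫ (1 ∧ |x|) φ(x) dx`. -/
def kernelMass (φ : EuclideanSpace ℝ (Fin d) → ℝ) : ℝ :=
  ∫ x, min 1 ‖x‖ * φ x

/-- `λ_φ(dx) = C_φ⁻¹ (1 ∧ |x|) φ(x) dx`. -/
def kernelMeasure (φ : EuclideanSpace ℝ (Fin d) → ℝ) : Measure (EuclideanSpace ℝ (Fin d)) :=
  volume.withDensity fun x => ENNReal.ofReal ((kernelMass φ)⁻¹ * (min 1 ‖x‖ * φ x))

/-- `C_g = ∫_{𝕊^{d-1}} g dℋ^{d-1}`. -/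
def angularMass (g : EuclideanSpace ℝ (Fin d) → ℝ) : ℝ :=
  ∫ θ : sphere (0 : EuclideanSpace ℝ (Fin d)) 1, g θ ∂(surfaceMeasure (EuclideanSpace ℝ (Fin d)))

end NonlocalCurvature

end

open NonlocalCurvature

namespace NonlocalCurvature

/-! ### Calculus -/

section Calculus

variable {V F : Type*} [NormedAddCommGroup V] [NormedSpace ℝ V]
  [NormedAddCommGroup F] [NormedSpace ℝ F]

/-! Everything reduces to one asymptotic formula on small circles. In the plane through `x` spanned
by orthonormal `e` and `w`, polar coordinates turn the truncated directional integral into `∫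
t^(d-1) J(t) A(t) dt` over `t ≥ r`. Here `J` is the radial profile of `j`, and `A = circleExcess`
integrates `χ̃` against `|cos α|^(d-2) g` over the circle of radius `t`.

Near `x` the set is `{p v + q v < 0}` up to an error `δ‖v‖²`, with `p` linear and `q` quadratic
(`SecondOrderContact`). Since `p` is odd and `q` even, antipodal points cancel outside an arc of
angular width `O(t)` around the direction where `p` vanishes. Hence `A(t) = O(min(1,t))`, which is
integrable against the kernel, so the principal values exist. After the angle is rescaled by `t`,
the paired indicator tends to `sgn(k+s) + sgn(k-s)` with `k = q(e)`. This has integral `4k`, so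
`A(t)/t → 4 q(e) g(e)` (`tendsto_circleExcess_div`).

The normalizing mass is `C_φ = C_g ∫ t^(d-1) min(1,t) J(t) dt`. The rescaled curvature is therefore
`1/(2 C_g)` times an average of `A(t)/min(1,t)` against probability measures that concentrate at `0`
(`tendsto_weighted_average`). Its limit is `2 q(e) g(e) / C_g`, and `2 q(e) = K_e`.

For moving sets, `C²` convergence gives contact of `E_n` at `x` with linear parts `p_n → ⟨ν,·⟩` and
the same `q` for all `n` (`exists_secondOrderContact`). The circle asymptotics are taken jointly in
`(n, t)`, which supplies the uniformity in `n` that the averaging needs.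

The mean curvature is the integral of the directional ones over the unit sphere of `ν^⊥`, by
cylindrical coordinates (`truncatedMean_eq_average`). Dominated convergence passes to the limit. -/

theorem norm_sub_le_of_norm_fderiv_le {h : V → F} (hh : ContDiff ℝ 2 h) {x : V} {r δ : ℝ}
    (h1 : ∀ y ∈ closedBall x r, ‖fderiv ℝ h y‖ ≤ δ) {z w : V}
    (hz : z ∈ closedBall x r) (hw : w ∈ closedBall x r) : ‖h w - h z‖ ≤ δ * ‖w - z‖ :=
  (convex_closedBall x r).norm_image_sub_le_of_norm_fderiv_le
    (fun y _ => (hh.differentiable (by norm_num)) y) h1 hz hw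

theorem norm_sub_sub_fderiv_le {h : V → F} (hh : ContDiff ℝ 2 h) {x : V} {r δ : ℝ}
    (h2 : ∀ y ∈ closedBall x r, ‖fderiv ℝ (fderiv ℝ h) y‖ ≤ δ) {z w : V}
    (hz : z ∈ closedBall x r) (hw : w ∈ closedBall x r) :
    ‖h w - h z - fderiv ℝ h z (w - z)‖ ≤ δ * ‖w - z‖ ^ 2 := by
  have hsub : segment ℝ z w ⊆ closedBall x r := (convex_closedBall x r).segment_subset hz hw
  have hδ : 0 ≤ δ := le_trans (norm_nonneg (fderiv ℝ (fderiv ℝ h) z)) (h2 z hz)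
  have hd : Differentiable ℝ (fderiv ℝ h) :=
    (hh.fderiv_right (m := 1) (by norm_num)).differentiable (by norm_num)
  have key := (convex_segment z w).norm_image_sub_le_of_norm_hasFDerivWithin_le' (𝕜 := ℝ)
    (f := h) (f' := fderiv ℝ h) (φ := fderiv ℝ h z) (C := δ * ‖w - z‖)
    (fun y _ => ((hh.differentiable (by norm_num)) y).hasFDerivAt.hasFDerivWithinAt)
    (fun y hy => by
      have h3 := (convex_closedBall x r).norm_image_sub_le_of_norm_fderiv_le (𝕜 := ℝ)
        (fun y _ => hd y) h2 hz (hsub hy)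
      refine h3.trans (mul_le_mul_of_nonneg_left ?_ hδ)
      obtain ⟨t, ht, rfl⟩ := (segment_eq_image' ℝ z w ▸ hy)
      simp only [add_sub_cancel_left, norm_smul, Real.norm_eq_abs, abs_of_nonneg ht.1]
      exact mul_le_of_le_one_left (norm_nonneg _) ht.2)
    (left_mem_segment ℝ z w) (right_mem_segment ℝ z w)
  rw [pow_two, ← mul_assoc]; exact key

/-- Second order Taylor expansion of a `C²` function, with a base point near the origin. -/
theorem eventually_taylor_two {f : V → ℝ} (hf : ContDiffAt ℝ 2 f 0) {δ : ℝ} (hδ : 0 < δ) :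
    ∃ r > 0, ∀ a b : V, ‖a‖ < r → ‖b‖ < r →
      |f b - f a - fderiv ℝ f a (b - a)
        - 1 / 2 * fderiv ℝ (fderiv ℝ f) 0 (b - a) (b - a)| ≤ δ * ‖b - a‖ ^ 2 := by
  have h1 : ContDiffAt ℝ 1 (fderiv ℝ f) 0 := hf.fderiv_right (by norm_num)
  -- Strict differentiability compares `Df` at two arbitrary points near `0`, so the base point `a`
  -- may move while the Hessian stays frozen at the origin.
  have hs := h1.hasStrictFDerivAt (by norm_num)
  have h2 : ∀ᶠ p : V × V in 𝓝 (0, 0), ‖fderiv ℝ f p.1 - fderiv ℝ f p.2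
      - fderiv ℝ (fderiv ℝ f) 0 (p.1 - p.2)‖ ≤ δ * ‖p.1 - p.2‖ := hs.isLittleO.def hδ
  have h3 : ∀ᶠ y in 𝓝 (0 : V), DifferentiableAt ℝ f y := by
    filter_upwards [hf.eventually (by norm_num)] with y hy
    exact hy.differentiableAt (by norm_num)
  obtain ⟨r₁, hr₁, H1⟩ := Metric.eventually_nhds_iff_ball.1 h2
  obtain ⟨r₂, hr₂, H2⟩ := Metric.eventually_nhds_iff_ball.1 h3
  refine ⟨min r₁ r₂, lt_min hr₁ hr₂, fun a b ha hb => ?_⟩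
  set B := fderiv ℝ (fderiv ℝ f) 0
  set u := b - a with hu
  have hseg : ∀ s ∈ Icc (0 : ℝ) 1, ‖a + s • u‖ < min r₁ r₂ := by
    intro s hs
    have : a + s • u ∈ ball (0 : V) (min r₁ r₂) :=
      (convex_ball (0 : V) (min r₁ r₂)).add_smul_sub_mem (by simpa using ha) (by simpa using hb) hs
    simpa using this
  -- The Taylor remainder along the segment from `a` to `b`. Its derivative is at most `δ‖u‖²`, and
  -- the mean value inequality on `[0,1]` concludes.
  have hder : ∀ s ∈ Icc (0 : ℝ) 1, HasDerivWithinAt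
      (fun s : ℝ => f (a + s • u) - s * fderiv ℝ f a u - 1 / 2 * s ^ 2 * B u u)
      (fderiv ℝ f (a + s • u) u - fderiv ℝ f a u - s * B u u) (Icc 0 1) s := by
    intro s hs
    have hd : HasFDerivAt f (fderiv ℝ f (a + s • u)) (a + s • u) :=
      (H2 _ (by simpa using (hseg s hs).trans_le (min_le_right _ _))).hasFDerivAt
    have hl : HasDerivAt (fun s : ℝ => a + s • u) u s := by
      simpa using ((hasDerivAt_id s).smul_const u).const_add a
    have h4 := hd.comp_hasDerivAt s hl
    have h5 : HasDerivAt (fun s : ℝ => s * fderiv ℝ f a u) (fderiv ℝ f a u) s := by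
      simpa using (hasDerivAt_id s).mul_const (fderiv ℝ f a u)
    have h6 : HasDerivAt (fun s : ℝ => 1 / 2 * s ^ 2 * B u u) (s * B u u) s := by
      have := ((hasDerivAt_pow 2 s).const_mul (1 / 2 : ℝ)).mul_const (B u u)
      simpa using this
    exact ((h4.sub h5).sub h6).hasDerivWithinAt
  have hbound : ∀ s ∈ Icc (0 : ℝ) 1,
      ‖fderiv ℝ f (a + s • u) u - fderiv ℝ f a u - s * B u u‖ ≤ δ * ‖u‖ ^ 2 := by
    intro s hs
    have h7 := H1 (a + s • u, a) (by
      rw [mem_ball, dist_eq_norm, ← Prod.zero_eq_mk, sub_zero, Prod.norm_def]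
      exact max_lt ((hseg s hs).trans_le (min_le_left _ _)) (ha.trans_le (min_le_left _ _)))
    simp only [add_sub_cancel_left] at h7
    have h8 := ContinuousLinearMap.le_of_opNorm_le _ h7 u
    simp only [sub_apply, map_smul, smul_apply,
      smul_eq_mul, norm_smul, Real.norm_eq_abs, abs_of_nonneg hs.1] at h8
    rw [Real.norm_eq_abs]
    refine h8.trans ?_
    have : s * ‖u‖ ≤ ‖u‖ := mul_le_of_le_one_left (norm_nonneg _) hs.2
    nlinarith [norm_nonneg u, mul_le_mul_of_nonneg_left this hδ.le]
  have := (convex_Icc (0 : ℝ) 1).norm_image_sub_le_of_norm_hasDerivWithin_le hder hbound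
    (left_mem_Icc.2 zero_le_one) (right_mem_Icc.2 zero_le_one)
  simp only [one_smul, zero_smul, hu, Real.norm_eq_abs] at this
  rw [hu]
  convert this using 1
  · congr 1
    simp
    ring
  · simp

/-- A map which is close to the identity on a ball attains all values near the centre. -/
theorem exists_preimage_of_near_id [CompleteSpace V] {h : V → V} (hh : ContDiff ℝ 2 h) {x y : V}
    {η : ℝ} (hη : 0 ≤ η) (h0 : ∀ z ∈ closedBall x η, ‖h z‖ ≤ η / 2)
    (h1 : ∀ z ∈ closedBall x η, ‖fderiv ℝ h z‖ ≤ 1 / 2) (hy : ‖y - x‖ ≤ η / 2) :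
    ∃ z ∈ closedBall x η, z + h z = y := by
  -- Solutions of `z + h z = y` are the fixed points of `z ↦ y - h z`, a `1/2`-contraction of the
  -- ball.
  have hmaps : MapsTo (fun z => y - h z) (closedBall x η) (closedBall x η) := by
    intro z hz
    rw [mem_closedBall, dist_eq_norm]
    calc ‖y - h z - x‖ = ‖(y - x) - h z‖ := by congr 1; abel
      _ ≤ ‖y - x‖ + ‖h z‖ := norm_sub_le _ _
      _ ≤ η := by linarith [h0 z hz]
  have hc : ContractingWith (1 / 2) (hmaps.restrict) := by
    refine ⟨by norm_num, LipschitzWith.of_dist_le_mul fun a b => ?_⟩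
    have := norm_sub_le_of_norm_fderiv_le hh h1 a.2 b.2
    rw [Subtype.dist_eq, Subtype.dist_eq, dist_eq_norm, dist_eq_norm, norm_sub_rev (a : V)]
    rw [← sub_sub_sub_cancel_left _ _ y] at this
    simpa using this
  obtain ⟨z, hz, hfix, -⟩ := hc.exists_fixedPoint' isClosed_closedBall.isComplete hmaps
    (x := x) (mem_closedBall_self hη) (edist_ne_top _ _)
  refine ⟨z, hz, ?_⟩
  exact (sub_eq_iff_eq_add.1 (show y - h z = z from hfix)).symm

end Calculus

/-! ### Second order contact -/

theorem exists_bound_fderiv_fderiv {V : Type*} [NormedAddCommGroup V] [NormedSpace ℝ V]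
    (f : V → ℝ) : ∃ K ≥ 0, ∀ a b : V, |fderiv ℝ (fderiv ℝ f) 0 a b| ≤ K * ‖a‖ * ‖b‖ :=
  ⟨‖fderiv ℝ (fderiv ℝ f) 0‖, norm_nonneg (fderiv ℝ (fderiv ℝ f) 0), fun a b =>
    (Real.norm_eq_abs _).symm.le.trans ((fderiv ℝ (fderiv ℝ f) 0).le_opNorm₂ a b)⟩

section Contact

variable {d : ℕ}

/-- Near `x`, up to an error `δ‖v‖²`, the point `x + v` lies in `S` when `p v + q v < 0` and outside
`S` when `p v + q v > 0`. -/
def SecondOrderContact (S : Set (EuclideanSpace ℝ (Fin d))) (x : EuclideanSpace ℝ (Fin d))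
    (p : EuclideanSpace ℝ (Fin d) →L[ℝ] ℝ) (q : EuclideanSpace ℝ (Fin d) → ℝ) (δ R : ℝ) : Prop :=
  ∀ v, ‖v‖ ≤ R → (p v + q v + δ * ‖v‖ ^ 2 < 0 → x + v ∈ S) ∧
    (0 < p v + q v - δ * ‖v‖ ^ 2 → x + v ∉ S)

/-- The quadratic form `v ↦ -½ D²f(0)(Pv, Pv)`, where `P` is the projection onto `ν^⊥`. -/
noncomputable def curvatureForm {ν : EuclideanSpace ℝ (Fin d)} (f : (ℝ ∙ ν)ᗮ → ℝ)
    (v : EuclideanSpace ℝ (Fin d)) : ℝ :=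
  -(1 / 2) * fderiv ℝ (fderiv ℝ f) 0 ((ℝ ∙ ν)ᗮ.orthogonalProjectionOnto v)
    ((ℝ ∙ ν)ᗮ.orthogonalProjectionOnto v)

theorem orthogonal_decomposition {ν : EuclideanSpace ℝ (Fin d)} (hν : ‖ν‖ = 1)
    (v : EuclideanSpace ℝ (Fin d)) :
    ((ℝ ∙ ν)ᗮ.orthogonalProjectionOnto v : EuclideanSpace ℝ (Fin d)) + inner ℝ ν v • ν = v := by
  have h1 := Submodule.starProjection_unit_singleton ℝ hν v
  have h2 := Submodule.starProjection_orthogonal_val (K := ℝ ∙ ν) v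
  rw [Submodule.coe_orthogonalProjectionOnto_apply, h2, h1]
  simp

theorem continuous_curvatureForm {ν : EuclideanSpace ℝ (Fin d)} (f : (ℝ ∙ ν)ᗮ → ℝ) :
    Continuous (curvatureForm f) := by
  unfold curvatureForm
  fun_prop

theorem curvatureForm_smul {ν : EuclideanSpace ℝ (Fin d)} (f : (ℝ ∙ ν)ᗮ → ℝ) (t : ℝ)
    (v : EuclideanSpace ℝ (Fin d)) : curvatureForm f (t • v) = t ^ 2 * curvatureForm f v := by
  simp only [curvatureForm, map_smul, smul_apply, smul_eq_mul]
  ring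

theorem norm_projection_le {ν : EuclideanSpace ℝ (Fin d)} (v : EuclideanSpace ℝ (Fin d)) :
    ‖(ℝ ∙ ν)ᗮ.orthogonalProjectionOnto v‖ ≤ ‖v‖ :=
  Submodule.norm_orthogonalProjectionOnto_apply_le _ v

theorem exists_curvatureForm_bound {ν : EuclideanSpace ℝ (Fin d)} (f : (ℝ ∙ ν)ᗮ → ℝ) :
    ∃ K ≥ 0, (∀ v, |curvatureForm f v| ≤ K * ‖v‖ ^ 2) ∧
      ∀ u v, |curvatureForm f u - curvatureForm f v| ≤ K * (‖u‖ + ‖v‖) * ‖u - v‖ := by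
  obtain ⟨K, hK, hB⟩ := exists_bound_fderiv_fderiv f
  have hB' : ∀ u v : EuclideanSpace ℝ (Fin d),
      |fderiv ℝ (fderiv ℝ f) 0 ((ℝ ∙ ν)ᗮ.orthogonalProjectionOnto u)
        ((ℝ ∙ ν)ᗮ.orthogonalProjectionOnto v)| ≤ K * ‖u‖ * ‖v‖ := fun u v => by
    refine (hB _ _).trans ?_
    gcongr
    · exact norm_projection_le u
    · exact norm_projection_le v
  refine ⟨K, hK, fun v => ?_, fun u v => ?_⟩
  · have h := hB' v v
    rw [curvatureForm, abs_mul, abs_neg, abs_of_pos (one_half_pos (α := ℝ))]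
    have : 0 ≤ K * ‖v‖ * ‖v‖ := by positivity
    nlinarith
  · have h1 := hB' u (u - v)
    have h2 := hB' (u - v) v
    have : curvatureForm f u - curvatureForm f v = -(1 / 2) *
        (fderiv ℝ (fderiv ℝ f) 0 ((ℝ ∙ ν)ᗮ.orthogonalProjectionOnto u)
          ((ℝ ∙ ν)ᗮ.orthogonalProjectionOnto (u - v)) +
        fderiv ℝ (fderiv ℝ f) 0 ((ℝ ∙ ν)ᗮ.orthogonalProjectionOnto (u - v))
          ((ℝ ∙ ν)ᗮ.orthogonalProjectionOnto v)) := by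
      simp only [curvatureForm, map_sub, sub_apply]
      ring
    rw [this, abs_mul, abs_neg, abs_of_pos (one_half_pos (α := ℝ))]
    have h3 := abs_add_le (fderiv ℝ (fderiv ℝ f) 0 ((ℝ ∙ ν)ᗮ.orthogonalProjectionOnto u)
          ((ℝ ∙ ν)ᗮ.orthogonalProjectionOnto (u - v)))
        (fderiv ℝ (fderiv ℝ f) 0 ((ℝ ∙ ν)ᗮ.orthogonalProjectionOnto (u - v))
          ((ℝ ∙ ν)ᗮ.orthogonalProjectionOnto v))
    have h4 : 0 ≤ K * (‖u‖ + ‖v‖) * ‖u - v‖ := by positivity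
    nlinarith

theorem two_mul_curvatureForm_eq {E : Set (EuclideanSpace ℝ (Fin d))}
    {x ν : EuclideanSpace ℝ (Fin d)} {f : (ℝ ∙ ν)ᗮ → ℝ} (h : IsLocalSubgraph E x ν f)
    (e : (ℝ ∙ ν)ᗮ) : 2 * curvatureForm f e = directionalCurvature E x ν e := by
  rw [directionalCurvature_eq h, iteratedFDeriv_two_apply, curvatureForm]
  simp

/-- The coordinates of a point with respect to the splitting `ν^⊥ × ℝν` centred at `x`. -/
theorem tendsto_coordinates (x ν : EuclideanSpace ℝ (Fin d)) (y : EuclideanSpace ℝ (Fin d)) :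
    Tendsto (fun y => ((ℝ ∙ ν)ᗮ.orthogonalProjectionOnto (y - x), (inner ℝ ν (y - x) : ℝ))) (𝓝 y)
      (𝓝 ((ℝ ∙ ν)ᗮ.orthogonalProjectionOnto (y - x), inner ℝ ν (y - x))) := by
  have : Continuous (fun y => ((ℝ ∙ ν)ᗮ.orthogonalProjectionOnto (y - x),
      (inner ℝ ν (y - x) : ℝ))) := by fun_prop
  exact this.tendsto y

theorem IsLocalSubgraph.eventually_near {S : Set (EuclideanSpace ℝ (Fin d))}
    {x ν : EuclideanSpace ℝ (Fin d)} {f : (ℝ ∙ ν)ᗮ → ℝ} (h : IsLocalSubgraph S x ν f) :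
    ∀ᶠ y in 𝓝 x,
      (inner ℝ ν (y - x) < f ((ℝ ∙ ν)ᗮ.orthogonalProjectionOnto (y - x)) → y ∈ S) ∧
      (f ((ℝ ∙ ν)ᗮ.orthogonalProjectionOnto (y - x)) < inner ℝ ν (y - x) → y ∉ S) := by
  have h0 := tendsto_coordinates x ν x
  simp only [sub_self, map_zero, inner_zero_right] at h0
  filter_upwards [h0.eventually h.2.2.2.2] with y hy
  have : x + ((ℝ ∙ ν)ᗮ.orthogonalProjectionOnto (y - x) : EuclideanSpace ℝ (Fin d))
      + (inner ℝ ν (y - x) : ℝ) • ν = y := by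
    rw [add_assoc, orthogonal_decomposition h.1]; abel
  simpa only [this] using hy

/-- A strict inequality at `y` persists nearby because `f` is continuous near `0`, which makes `y`
interior to `S` or to its complement. This places the preimages of `x` exactly on the graph. -/
theorem IsLocalSubgraph.frontier_eq {S : Set (EuclideanSpace ℝ (Fin d))}
    {x ν : EuclideanSpace ℝ (Fin d)} {f : (ℝ ∙ ν)ᗮ → ℝ} (h : IsLocalSubgraph S x ν f) :
    ∀ᶠ y in 𝓝 x, y ∈ frontier S →
      inner ℝ ν (y - x) = f ((ℝ ∙ ν)ᗮ.orthogonalProjectionOnto (y - x)) := by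
  have h0 := tendsto_coordinates x ν x
  simp only [sub_self, map_zero, inner_zero_right] at h0
  have hc : ∀ᶠ y in 𝓝 x, ContinuousAt f ((ℝ ∙ ν)ᗮ.orthogonalProjectionOnto (y - x)) := by
    have : ∀ᶠ a in 𝓝 (0 : (ℝ ∙ ν)ᗮ), ContinuousAt f a := by
      filter_upwards [h.2.1.eventually (by norm_num)] with a ha using ha.continuousAt
    exact (h0.fst_nhds).eventually this
  filter_upwards [h.eventually_near.eventually_nhds, hc] with y hy hcy hyf
  have ht := tendsto_coordinates x ν y
  have hf : Tendsto (fun y => f ((ℝ ∙ ν)ᗮ.orthogonalProjectionOnto (y - x))) (𝓝 y)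
      (𝓝 (f ((ℝ ∙ ν)ᗮ.orthogonalProjectionOnto (y - x)))) := hcy.tendsto.comp ht.fst_nhds
  rcases lt_trichotomy (inner ℝ ν (y - x)) (f ((ℝ ∙ ν)ᗮ.orthogonalProjectionOnto (y - x)))
    with hlt | heq | hgt
  · have : S ∈ 𝓝 y := by
      filter_upwards [hy, ht.snd_nhds.eventually_lt hf hlt] with z hz hz' using hz.1 hz'
    exact absurd (mem_interior_iff_mem_nhds.2 this) hyf.2
  · exact heq
  · have : Sᶜ ∈ 𝓝 y := by
      filter_upwards [hy, hf.eventually_lt ht.snd_nhds hgt] with z hz hz' using hz.2 hz'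
    rw [← frontier_compl] at hyf
    exact absurd (mem_interior_iff_mem_nhds.2 this) hyf.2

end Contact

/-! ### Transport of second order contact under `C²` convergence. -/

section Convergence

variable {d : ℕ}

/-- Uniform smallness on a fixed ball of the perturbations in `ConvergesC2`. -/
theorem eventually_small_of_tendsto {V : Type*} [NormedAddCommGroup V] [NormedSpace ℝ V]
    [LocallyCompactSpace V] [ProperSpace V] {h : ℕ → V → V}
    (hconv : ∀ k : ℕ, k ≤ 2 → TendstoLocallyUniformly
      (fun n z => iteratedFDeriv ℝ k (h n) z) (fun _ => 0) atTop) (x : V) {δ : ℝ} (hδ : 0 < δ) :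
    ∀ᶠ n in atTop, ∀ z ∈ closedBall x 1, ‖h n z‖ ≤ δ ∧ ‖fderiv ℝ (h n) z‖ ≤ δ ∧
      ‖fderiv ℝ (fderiv ℝ (h n)) z‖ ≤ δ := by
  have key : ∀ k : ℕ, k ≤ 2 → ∀ᶠ n in atTop, ∀ z ∈ closedBall x 1,
      ‖iteratedFDeriv ℝ k (h n) z‖ ≤ δ := by
    intro k hk
    have h1 := (tendstoLocallyUniformly_iff_forall_isCompact.1 (hconv k hk)) _
      (isCompact_closedBall x 1)
    filter_upwards [Metric.tendstoUniformlyOn_iff.1 h1 δ hδ] with n hn z hz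
    simpa using (hn z hz).le
  filter_upwards [key 0 (by norm_num), key 1 (by norm_num), key 2 le_rfl] with n h0 h1 h2 z hz
  refine ⟨by simpa using h0 z hz, by simpa [norm_iteratedFDeriv_one] using h1 z hz, ?_⟩
  have := h2 z hz
  rwa [← norm_iteratedFDeriv_fderiv, norm_iteratedFDeriv_one] at this

theorem tendsto_clm_comp {ι E F G : Type*} [NormedAddCommGroup E] [NormedSpace ℝ E]
    [NormedAddCommGroup F] [NormedSpace ℝ F] [NormedAddCommGroup G] [NormedSpace ℝ G]
    {l : Filter ι} {a : ι → F →L[ℝ] G} {b : ι → E →L[ℝ] F} {a₀ : F →L[ℝ] G} {b₀ : E →L[ℝ] F}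
    (ha : Tendsto a l (𝓝 a₀)) (hb : Tendsto b l (𝓝 b₀)) :
    Tendsto (fun i => (a i).comp (b i)) l (𝓝 (a₀.comp b₀)) :=
  ((ContinuousLinearMap.compL ℝ E F G).continuous₂.tendsto (a₀, b₀)).comp (ha.prodMk_nhds hb)

/-- Write `x + v = z + h z` and `u = z - z₀`, so that `v = u + (h z - h z₀)` and `‖u‖ ≤ 2‖v‖`. The
function `⟨ν,·⟩ - f ∘ P`, which vanishes at `z₀ - x`, is expanded there. By `hp` its linear term is
`p (u + Dh(z₀) u)`. Replacing that by `p v` costs `8δ'‖v‖²`, replacing `q u` by `q v` costs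
`6Kδ'‖v‖²`, and the Taylor remainder costs `4δ'‖v‖²`. The total is the constant `12 + 6K`. -/
theorem secondOrderContact_of_small {E S : Set (EuclideanSpace ℝ (Fin d))}
    {x ν : EuclideanSpace ℝ (Fin d)} {f : (ℝ ∙ ν)ᗮ → ℝ}
    {h : EuclideanSpace ℝ (Fin d) → EuclideanSpace ℝ (Fin d)} (hh : ContDiff ℝ 2 h)
    {z₀ : EuclideanSpace ℝ (Fin d)} {η δ δ' K : ℝ} (hz₀ : z₀ ∈ closedBall x η)
    (hz₀x : z₀ + h z₀ = x)
    (hz₀E : inner ℝ ν (z₀ - x) = f ((ℝ ∙ ν)ᗮ.orthogonalProjectionOnto (z₀ - x)))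
    (h1 : ∀ y ∈ closedBall x η, ‖fderiv ℝ h y‖ ≤ δ')
    (h2 : ∀ y ∈ closedBall x η, ‖fderiv ℝ (fderiv ℝ h) y‖ ≤ δ') (hδ' : δ' ≤ 1 / 2)
    (hE : ∀ y ∈ closedBall x η,
      (inner ℝ ν (y - x) < f ((ℝ ∙ ν)ᗮ.orthogonalProjectionOnto (y - x)) → y ∈ E) ∧
      (f ((ℝ ∙ ν)ᗮ.orthogonalProjectionOnto (y - x)) < inner ℝ ν (y - x) → y ∉ E))
    (hTaylor : ∀ a b : (ℝ ∙ ν)ᗮ, ‖a‖ ≤ η → ‖b‖ ≤ η → |f b - f a - fderiv ℝ f a (b - a)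
        - 1 / 2 * fderiv ℝ (fderiv ℝ f) 0 (b - a) (b - a)| ≤ δ' * ‖b - a‖ ^ 2)
    (hK : 0 ≤ K) (hK2 : ∀ u v : EuclideanSpace ℝ (Fin d),
      |curvatureForm f u - curvatureForm f v| ≤ K * (‖u‖ + ‖v‖) * ‖u - v‖)
    (hδδ' : δ' ≤ δ / (12 + 6 * K)) {p : EuclideanSpace ℝ (Fin d) →L[ℝ] ℝ} (hp2 : ‖p‖ ≤ 2)
    (hp : ∀ u, p (u + fderiv ℝ h z₀ u) = inner ℝ ν u
      - fderiv ℝ f ((ℝ ∙ ν)ᗮ.orthogonalProjectionOnto (z₀ - x))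
        ((ℝ ∙ ν)ᗮ.orthogonalProjectionOnto u))
    (hS : ∀ v, ‖v‖ ≤ η / 2 → ∃ z ∈ closedBall x η, z + h z = x + v ∧ (x + v ∈ S ↔ z ∈ E)) :
    SecondOrderContact S x p (curvatureForm f) δ (η / 2) := by
  set P := (ℝ ∙ ν)ᗮ.orthogonalProjectionOnto
  have hδ'0 : 0 ≤ δ' := (norm_nonneg _).trans (h1 _ hz₀)
  intro v hv
  obtain ⟨z, hz, hzv, hzS⟩ := hS v hv
  set u := z - z₀ with hu
  have hzu : z = z₀ + u := by rw [hu]; abel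
  have hvu : v = u + (h z - h z₀) := by
    have : x + v - x = z + h z - (z₀ + h z₀) := by rw [hzv, hz₀x]
    rw [add_sub_cancel_left] at this
    rw [this, hu]; abel
  have hlip : ‖h z - h z₀‖ ≤ δ' * ‖u‖ := norm_sub_le_of_norm_fderiv_le hh h1 hz₀ hz
  have hquad : ‖h z - h z₀ - fderiv ℝ h z₀ u‖ ≤ δ' * ‖u‖ ^ 2 := norm_sub_sub_fderiv_le hh h2 hz₀ hz
  have huv : ‖u‖ ≤ 2 * ‖v‖ := by
    have : u = v - (h z - h z₀) := by rw [hvu]; abel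
    have h3 : ‖u‖ ≤ ‖v‖ + ‖h z - h z₀‖ := by
      conv_lhs => rw [this]
      exact norm_sub_le _ _
    nlinarith [norm_nonneg u]
  have hu2 : ‖u‖ ^ 2 ≤ 4 * ‖v‖ ^ 2 := by nlinarith [norm_nonneg u, norm_nonneg v]
  -- the linear part
  have hlin : |p (u + fderiv ℝ h z₀ u) - p v| ≤ 8 * δ' * ‖v‖ ^ 2 := by
    rw [← map_sub]
    have h4 : u + fderiv ℝ h z₀ u - v = -(h z - h z₀ - fderiv ℝ h z₀ u) := by rw [hvu]; abel
    have h5 := p.le_opNorm (u + fderiv ℝ h z₀ u - v)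
    rw [Real.norm_eq_abs] at h5
    refine h5.trans ?_
    rw [h4, norm_neg]
    calc ‖p‖ * ‖h z - h z₀ - fderiv ℝ h z₀ u‖ ≤ 2 * (δ' * ‖u‖ ^ 2) := by gcongr
      _ ≤ 8 * δ' * ‖v‖ ^ 2 := by nlinarith
  -- the quadratic part
  have hq : |curvatureForm f u - curvatureForm f v| ≤ 6 * K * δ' * ‖v‖ ^ 2 := by
    have h6 : ‖u - v‖ ≤ δ' * (2 * ‖v‖) := by
      have : u - v = -(h z - h z₀) := by rw [hvu]; abel
      rw [this, norm_neg]
      exact hlip.trans (by gcongr)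
    calc _ ≤ K * (‖u‖ + ‖v‖) * ‖u - v‖ := hK2 u v
      _ ≤ K * (2 * ‖v‖ + ‖v‖) * (δ' * (2 * ‖v‖)) := by gcongr
      _ = 6 * K * δ' * ‖v‖ ^ 2 := by ring
  -- the expansion of the graph
  have hPu : P (z - x) - P (z₀ - x) = P u := by rw [← map_sub, hu]; congr 1; abel
  have hball : ∀ y ∈ closedBall x η, ‖P (y - x)‖ ≤ η := fun y hy =>
    (norm_projection_le _).trans (by simpa [dist_eq_norm] using hy)
  have ht := hTaylor (P (z₀ - x)) (P (z - x)) (hball _ hz₀) (hball _ hz)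
  rw [hPu] at ht
  have ht' : δ' * ‖P u‖ ^ 2 ≤ 4 * δ' * ‖v‖ ^ 2 := by
    have : ‖P u‖ ^ 2 ≤ ‖u‖ ^ 2 := by gcongr; exact norm_projection_le u
    nlinarith
  have hqu : curvatureForm f u = -(1 / 2) * fderiv ℝ (fderiv ℝ f) 0 (P u) (P u) := rfl
  have hinner : (inner ℝ ν (z - x) : ℝ) = inner ℝ ν (z₀ - x) + inner ℝ ν u := by
    rw [← inner_add_right, hu]; congr 1; abel
  have hδ : (12 + 6 * K) * δ' * ‖v‖ ^ 2 ≤ δ * ‖v‖ ^ 2 := by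
    have : (12 + 6 * K) * δ' ≤ δ := by
      rw [le_div_iff₀ (by positivity)] at hδδ'; linarith
    gcongr
  have hmain : |(inner ℝ ν (z - x) - f (P (z - x))) - (p v + curvatureForm f v)| ≤
      δ * ‖v‖ ^ 2 := by
    refine le_trans ?_ hδ
    have hpu := hp u
    rw [abs_le] at hlin hq ht ⊢
    constructor <;> linarith [ht.1, ht.2]
  rw [abs_le] at hmain
  rw [hzS]
  exact ⟨fun hlt => (hE z hz).1 (by linarith), fun hlt => (hE z hz).2 (by linarith)⟩

/-- The sets `E_n` have second order contact at `x`, with a quadratic form which does not depend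
on `n`. -/
theorem exists_secondOrderContact {E : Set (EuclideanSpace ℝ (Fin d))}
    {En : ℕ → Set (EuclideanSpace ℝ (Fin d))} (hconv : ConvergesC2 En E)
    {x ν : EuclideanSpace ℝ (Fin d)} {f : (ℝ ∙ ν)ᗮ → ℝ} (hf : IsLocalSubgraph E x ν f)
    (hxn : ∀ n, x ∈ frontier (En n)) :
    ∃ p : ℕ → EuclideanSpace ℝ (Fin d) →L[ℝ] ℝ, Tendsto p atTop (𝓝 (innerSL ℝ ν)) ∧
      ∀ δ > 0, ∃ R > 0, ∀ᶠ n in atTop,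
        SecondOrderContact (En n) x (p n) (curvatureForm f) δ R := by
  obtain ⟨Φ, hΦ, hΦs, hlim, hEn⟩ := hconv
  set h : ℕ → EuclideanSpace ℝ (Fin d) → EuclideanSpace ℝ (Fin d) := fun n y => Φ n y - y with hh
  have hhc : ∀ n, ContDiff ℝ 2 (h n) := fun n => (hΦ n).sub contDiff_id
  have hsmall := fun δ hδ => eventually_small_of_tendsto hlim x (δ := δ) hδ
  set P := (ℝ ∙ ν)ᗮ.orthogonalProjectionOnto
  have hΦh : ∀ n z, Φ n z = z + h n z := fun n z => by simp [hh]
  -- preimages of points near `x` are near `x`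
  have hpre : ∀ η > 0, η ≤ 1 → ∀ᶠ n in atTop, ∀ y, ‖y - x‖ ≤ η / 2 →
      (Φ n).symm y ∈ closedBall x η := by
    intro η hη hη1
    filter_upwards [hsmall (η / 2) (by positivity), hsmall (1 / 2) (by norm_num)] with n h1 h2 y hy
    have hsub : closedBall x η ⊆ closedBall x 1 := closedBall_subset_closedBall hη1
    obtain ⟨z, hz, hzy⟩ := exists_preimage_of_near_id (hhc n) hη.le
      (fun z hz => (h1 z (hsub hz)).1) (fun z hz => (h2 z (hsub hz)).2.1) hy
    rw [← hzy, ← hΦh, Equiv.symm_apply_apply]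
    exact hz
  set z : ℕ → EuclideanSpace ℝ (Fin d) := fun n => (Φ n).symm x with hz
  have hzx : Tendsto z atTop (𝓝 x) := by
    rw [Metric.tendsto_nhds]
    intro η hη
    have h1 : 0 < min (η / 2) 1 := by positivity
    filter_upwards [hpre _ h1 (min_le_right _ _)] with n hn
    have := hn x (by rw [sub_self, norm_zero]; positivity)
    exact (mem_closedBall.1 this).trans_lt ((min_le_left _ _).trans_lt (half_lt_self hη))
  have hzE : ∀ n, z n ∈ frontier E := by
    intro n
    let H : EuclideanSpace ℝ (Fin d) ≃ₜ EuclideanSpace ℝ (Fin d) :=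
      { toEquiv := Φ n
        continuous_toFun := (hΦ n).continuous
        continuous_invFun := (hΦs n).continuous }
    have h1 : frontier (En n) = H '' frontier E := by
      rw [H.image_frontier, hEn n]; rfl
    have h2 := hxn n
    rw [h1] at h2
    obtain ⟨y, hy, hyx⟩ := h2
    have : z n = y := by
      simp only [hz]
      rw [Equiv.symm_apply_eq]; exact hyx.symm
    rwa [this]
  have hHlim : Tendsto (fun n => fderiv ℝ (h n) (z n)) atTop (𝓝 0) := by
    rw [tendsto_zero_iff_norm_tendsto_zero, Metric.tendsto_nhds]
    intro η hη
    filter_upwards [hsmall (η / 2) (by positivity), hzx.eventually (closedBall_mem_nhds x one_pos)]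
      with n h1 h2
    simpa using (h1 _ h2).2.1.trans_lt (half_lt_self hη)
  -- `B n` inverts the derivative of `Φ n` at `z n`. `Ring.inverse` is `0` off the units, but the
  -- derivatives tend to `1` and so are eventually units.
  set B : ℕ → (EuclideanSpace ℝ (Fin d) →L[ℝ] EuclideanSpace ℝ (Fin d)) :=
    fun n => Ring.inverse (1 + fderiv ℝ (h n) (z n)) with hB
  have h1H : Tendsto (fun n => 1 + fderiv ℝ (h n) (z n)) atTop (𝓝 1) := by
    simpa using hHlim.const_add 1
  have hBlim : Tendsto B atTop (𝓝 1) := by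
    have := (NormedRing.inverse_continuousAt
      (1 : (EuclideanSpace ℝ (Fin d) →L[ℝ] EuclideanSpace ℝ (Fin d))ˣ)).tendsto
    rw [Units.val_one, Ring.inverse_one] at this
    exact this.comp h1H
  have hunit : ∀ᶠ n in atTop, IsUnit (1 + fderiv ℝ (h n) (z n)) :=
    h1H.eventually (Units.isOpen.mem_nhds isUnit_one)
  -- The derivative of `⟨ν,·⟩ - f ∘ P` at `z n - x`. Composing with `B n` transports it through `Φ
  -- n` to the point `x`.
  set ℓ : ℕ → EuclideanSpace ℝ (Fin d) →L[ℝ] ℝ :=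
    fun n => innerSL ℝ ν - (fderiv ℝ f (P (z n - x))).comp P with hℓ
  have hPz : Tendsto (fun n => P (z n - x)) atTop (𝓝 0) := by
    have : Tendsto (fun n => P (z n - x)) atTop (𝓝 (P (x - x))) :=
      (P.continuous.tendsto _).comp (hzx.sub_const x)
    simpa using this
  have hℓlim : Tendsto ℓ atTop (𝓝 (innerSL ℝ ν)) := by
    have h1 : ContinuousAt (fderiv ℝ f) 0 :=
      (hf.2.1.fderiv_right (m := 1) (by norm_num)).continuousAt
    have h2 : Tendsto (fun n => fderiv ℝ f (P (z n - x))) atTop (𝓝 0) := by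
      have := h1.tendsto.comp hPz
      rwa [hf.2.2.2.1] at this
    have h3 := tendsto_clm_comp h2 (tendsto_const_nhds (x := P))
    rw [ContinuousLinearMap.zero_comp] at h3
    simpa only [sub_zero] using h3.const_sub (innerSL ℝ ν)
  refine ⟨fun n => (ℓ n).comp (B n), ?_, ?_⟩
  · have h3 := tendsto_clm_comp hℓlim hBlim
    rwa [ContinuousLinearMap.one_def, ContinuousLinearMap.comp_id] at h3
  intro δ hδ
  obtain ⟨K, hK, hK1, hK2⟩ := exists_curvatureForm_bound f
  set δ' := min (1 / 2) (δ / (12 + 6 * K)) with hδ'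
  have hδ'0 : 0 < δ' := by positivity
  obtain ⟨r, hr, hTaylor⟩ := eventually_taylor_two hf.2.1 hδ'0
  obtain ⟨r', hr', hnear⟩ := Metric.eventually_nhds_iff_ball.1 (hf.eventually_near.and hf.frontier_eq)
  set η := min 1 (min (r / 2) (r' / 2)) with hη
  have hη0 : 0 < η := by positivity
  have hη1 : η ≤ 1 := min_le_left _ _
  have hηr : η < r := ((min_le_right _ _).trans (min_le_left _ _)).trans_lt (half_lt_self hr)
  have hηr' : η < r' := ((min_le_right _ _).trans (min_le_right _ _)).trans_lt (half_lt_self hr')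
  have hplim : ∀ᶠ n in atTop, ‖(ℓ n).comp (B n)‖ < 2 := by
    have h3 := tendsto_clm_comp hℓlim hBlim
    rw [ContinuousLinearMap.one_def, ContinuousLinearMap.comp_id] at h3
    refine h3.norm.eventually (gt_mem_nhds ?_)
    rw [innerSL_apply_norm, hf.1]; norm_num
  refine ⟨η / 2, by positivity, ?_⟩
  filter_upwards [hsmall δ' hδ'0, hpre η hη0 hη1, hplim, hunit,
    hzx.eventually (closedBall_mem_nhds x hη0)] with n hs hp hpn hu hzn
  have hsub : closedBall x η ⊆ closedBall x 1 := closedBall_subset_closedBall hη1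
  refine secondOrderContact_of_small (hhc n) (E := E) (z₀ := z n) hzn ?_ ?_
    (fun y hy => (hs y (hsub hy)).2.1) (fun y hy => (hs y (hsub hy)).2.2) (min_le_left _ _)
    (fun y hy => (hnear y (closedBall_subset_ball hηr' hy)).1)
    (fun a b ha hb => hTaylor a b (ha.trans_lt hηr) (hb.trans_lt hηr)) hK hK2
    (le_min_iff.1 hδ'.le).2 hpn.le ?_ ?_
  · simp only [← hΦh, hz, Equiv.apply_symm_apply]
  · exact (hnear _ (closedBall_subset_ball hηr' hzn)).2 (hzE n)
  · intro u
    have : B n (u + fderiv ℝ (h n) (z n) u) = u := by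
      have := congrArg (fun T => T u) (Ring.inverse_mul_cancel _ hu)
      simpa using this
    rw [ContinuousLinearMap.comp_apply, this]
    rfl
  · intro v hv
    refine ⟨(Φ n).symm (x + v), hp _ (by simpa using hv), ?_, ?_⟩
    · rw [← hΦh, Equiv.apply_symm_apply]
    · rw [hEn n, Equiv.image_eq_preimage_symm]; rfl

end Convergence

/-! ### Contact for a single set and convergence of outer normals. -/

section Normals

variable {d : ℕ}

/-- Lets the contact of one fixed set be read off from the statement for sequences. -/
theorem convergesC2_const (S : Set (EuclideanSpace ℝ (Fin d))) :
    ConvergesC2 (fun _ => S) S := by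
  refine ⟨fun _ => Equiv.refl _, fun _ => contDiff_id, fun _ => contDiff_id, fun k _ => ?_,
    fun n => by simp⟩
  have h0 : ∀ z : EuclideanSpace ℝ (Fin d), iteratedFDeriv ℝ k
      (fun y : EuclideanSpace ℝ (Fin d) => (Equiv.refl (EuclideanSpace ℝ (Fin d))) y - y) z = 0 := by
    intro z
    have : (fun y : EuclideanSpace ℝ (Fin d) =>
        (Equiv.refl (EuclideanSpace ℝ (Fin d))) y - y) = fun _ => 0 := by
      funext y; simp
    rw [this, iteratedFDeriv_fun_zero]; rfl
  simp only [h0]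
  exact tendstoLocallyUniformly_iff_forall_tendsto.2 fun z => by
    rw [uniformity_eq_comap_nhds_zero]
    simp only [tendsto_comap_iff, Function.comp_def, sub_self]
    exact tendsto_const_nhds

/-- The constant sequence provides linear parts that converge to `⟨ν,·⟩`. A member of any prescribed
neighbourhood is enough for the applications. -/
theorem IsLocalSubgraph.exists_contact {S : Set (EuclideanSpace ℝ (Fin d))}
    {x ν : EuclideanSpace ℝ (Fin d)} {f : (ℝ ∙ ν)ᗮ → ℝ} (hf : IsLocalSubgraph S x ν f)
    (hx : x ∈ frontier S) {U : Set (EuclideanSpace ℝ (Fin d) →L[ℝ] ℝ)} (hU : U ∈ 𝓝 (innerSL ℝ ν)) :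
    ∃ p ∈ U, ∃ R > 0, SecondOrderContact S x p (curvatureForm f) 1 R := by
  obtain ⟨p, hp, hc⟩ := exists_secondOrderContact (convergesC2_const S) hf (fun _ => hx)
  obtain ⟨R, hR, h⟩ := hc 1 one_pos
  obtain ⟨n, hn, hn'⟩ := (h.and (hp.eventually hU)).exists
  exact ⟨p n, hn', R, hR, hn⟩

/-- Along a ray the linear term is of order `t` and everything else of order `t²`, so the sign of `p
v` decides. -/
theorem SecondOrderContact.eventually_mem {S : Set (EuclideanSpace ℝ (Fin d))}
    {x ν : EuclideanSpace ℝ (Fin d)} {f : (ℝ ∙ ν)ᗮ → ℝ} {p : EuclideanSpace ℝ (Fin d) →L[ℝ] ℝ}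
    {δ R : ℝ} (h : SecondOrderContact S x p (curvatureForm f) δ R) (hR : 0 < R)
    (v : EuclideanSpace ℝ (Fin d)) :
    (p v < 0 → ∀ᶠ t : ℝ in 𝓝[>] 0, x + t • v ∈ S) ∧
      (0 < p v → ∀ᶠ t : ℝ in 𝓝[>] 0, x + t • v ∉ S) := by
  have hsmall : ∀ᶠ t : ℝ in 𝓝[>] 0, ‖t • v‖ ≤ R := by
    have : Tendsto (fun t : ℝ => ‖t • v‖) (𝓝[>] 0) (𝓝 0) := by
      have : Tendsto (fun t : ℝ => ‖t • v‖) (𝓝 0) (𝓝 ‖(0 : ℝ) • v‖) :=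
        (by fun_prop : Continuous fun t : ℝ => ‖t • v‖).tendsto 0
      simp only [zero_smul, norm_zero] at this
      exact this.mono_left nhdsWithin_le_nhds
    filter_upwards [this.eventually (gt_mem_nhds hR)] with t ht using ht.le
  have hlim : ∀ c : ℝ, Tendsto (fun t : ℝ => p v + t * c) (𝓝[>] 0) (𝓝 (p v)) := by
    intro c
    have : Tendsto (fun t : ℝ => p v + t * c) (𝓝 0) (𝓝 (p v + 0 * c)) :=
      (by fun_prop : Continuous fun t : ℝ => p v + t * c).tendsto 0
    simp only [zero_mul, add_zero] at this
    exact this.mono_left nhdsWithin_le_nhds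
  constructor <;> intro hv
  · filter_upwards [hsmall, self_mem_nhdsWithin,
      (hlim (curvatureForm f v + δ * ‖v‖ ^ 2)).eventually (gt_mem_nhds hv)] with t h1 h2 h3
    refine (h _ h1).1 ?_
    rw [map_smul, curvatureForm_smul, norm_smul, mul_pow, Real.norm_eq_abs, sq_abs, smul_eq_mul]
    have := mul_neg_of_pos_of_neg (mem_Ioi.1 h2) h3
    linarith
  · filter_upwards [hsmall, self_mem_nhdsWithin,
      (hlim (curvatureForm f v - δ * ‖v‖ ^ 2)).eventually (lt_mem_nhds hv)] with t h1 h2 h3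
    refine (h _ h1).2 ?_
    rw [map_smul, curvatureForm_smul, norm_smul, mul_pow, Real.norm_eq_abs, sq_abs, smul_eq_mul]
    have := mul_pos (mem_Ioi.1 h2) h3
    linarith

/-- With `w` the component of `a` orthogonal to `ν`, the vectors `t ν - w` with `t > 0` lie in the
open half-space. Pairing them with `a` gives `t⟨a,ν⟩ - ‖w‖² ≥ 0`, and letting `t → 0` forces `w =
0`. -/
theorem eq_norm_smul_of_halfspace {H : Type*} [NormedAddCommGroup H] [InnerProductSpace ℝ H]
    {a ν : H} (hν : ‖ν‖ = 1) (h : ∀ v : H, 0 < (inner ℝ ν v : ℝ) → 0 ≤ (inner ℝ a v : ℝ)) :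
    a = ‖a‖ • ν := by
  have hνν : (inner ℝ ν ν : ℝ) = 1 := by rw [real_inner_self_eq_norm_sq, hν]; norm_num
  set c : ℝ := inner ℝ a ν with hc
  have hνa : (inner ℝ ν a : ℝ) = c := real_inner_comm _ _
  have hc0 : 0 ≤ c := h ν (by rw [hνν]; norm_num)
  set w := a - c • ν with hw
  have hνw : (inner ℝ ν w : ℝ) = 0 := by
    rw [hw, inner_sub_right, inner_smul_right, hνν, hνa]; ring
  have haw : (inner ℝ a w : ℝ) = ‖w‖ ^ 2 := by
    have : a = w + c • ν := by rw [hw]; abel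
    rw [this, inner_add_left, inner_smul_left, hνw, real_inner_self_eq_norm_sq]; simp
  have hw0 : ‖w‖ ^ 2 ≤ 0 := by
    refine le_of_forall_pos_le_add fun s hs => ?_
    have h1 : 0 < s / (c + 1) := by positivity
    have h2 := h ((s / (c + 1)) • ν - w) (by
      rw [inner_sub_right, inner_smul_right, hνν, hνw]; simpa using h1)
    rw [inner_sub_right, inner_smul_right, haw, ← hc] at h2
    have h3 : s / (c + 1) * c ≤ s := by
      rw [div_mul_eq_mul_div, div_le_iff₀ (by positivity)]; nlinarith
    linarith
  have hw1 : w = 0 := by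
    rw [← norm_eq_zero]; exact pow_eq_zero_iff (two_ne_zero) |>.1 (le_antisymm hw0 (sq_nonneg _))
  have ha : a = c • ν := by rw [← sub_eq_zero, ← hw, hw1]
  have : ‖a‖ = c := by
    rw [ha, norm_smul, hν, Real.norm_eq_abs, abs_of_nonneg hc0, mul_one]
  rw [this]; exact ha

/-- Outer unit normals at a common boundary point converge. -/
theorem tendsto_outerUnitNormal {En : ℕ → Set (EuclideanSpace ℝ (Fin d))}
    {x ν : EuclideanSpace ℝ (Fin d)} {f : (ℝ ∙ ν)ᗮ → ℝ} (hν : ‖ν‖ = 1)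
    (hxn : ∀ n, x ∈ frontier (En n))
    {p : ℕ → EuclideanSpace ℝ (Fin d) →L[ℝ] ℝ} (hp : Tendsto p atTop (𝓝 (innerSL ℝ ν)))
    {R : ℝ} (hR : 0 < R)
    (hc : ∀ᶠ n in atTop, SecondOrderContact (En n) x (p n) (curvatureForm f) 1 R)
    {νn : ℕ → EuclideanSpace ℝ (Fin d)} (hνn : ∀ n, IsOuterUnitNormal (En n) x (νn n)) :
    Tendsto νn atTop (𝓝 ν) := by
  set a : ℕ → EuclideanSpace ℝ (Fin d) :=
    fun n => (InnerProductSpace.toDual ℝ (EuclideanSpace ℝ (Fin d))).symm (p n) with ha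
  have halim : Tendsto a atTop (𝓝 ν) := by
    have h1 := ((InnerProductSpace.toDual ℝ (EuclideanSpace ℝ (Fin d))).symm.continuous.tendsto
      (innerSL ℝ ν)).comp hp
    have h2 : (InnerProductSpace.toDual ℝ (EuclideanSpace ℝ (Fin d))).symm (innerSL ℝ ν) = ν := by
      rw [LinearIsometryEquiv.symm_apply_eq]; rfl
    rwa [h2] at h1
  have h1 : Tendsto (fun n => ‖a n‖⁻¹ • a n) atTop (𝓝 ν) := by
    have := (halim.norm.inv₀ (by rw [hν]; norm_num)).smul halim
    simpa [hν] using this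
  refine h1.congr' ?_
  filter_upwards [hc, halim.norm.eventually (lt_mem_nhds (by rw [hν]; exact one_pos))] with n hn h0
  obtain ⟨g, hg⟩ := hνn n
  -- If `p n` were negative at some `v` with `⟨νn n, v⟩ > 0`, short multiples of `v` would lead into
  -- `En n` by one contact and out of it by the other.
  have : a n = ‖a n‖ • νn n := by
    refine eq_norm_smul_of_halfspace hg.1 fun v hv => ?_
    have hav : (inner ℝ (a n) v : ℝ) = p n v := by
      simp [ha]
    rw [hav]
    by_contra! hneg
    have hU : {p' : EuclideanSpace ℝ (Fin d) →L[ℝ] ℝ | 0 < p' v} ∈ 𝓝 (innerSL ℝ (νn n)) := by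
      have : Continuous fun p' : EuclideanSpace ℝ (Fin d) →L[ℝ] ℝ => p' v := by fun_prop
      exact (this.tendsto _).eventually (lt_mem_nhds (by simpa using hv))
    obtain ⟨p', hp', R', hR', hcon⟩ := hg.exists_contact (hxn n) hU
    obtain ⟨t, ht1, ht2⟩ :=
      (((hn.eventually_mem hR v).1 hneg).and ((hcon.eventually_mem hR' v).2 hp')).exists
    exact ht2 ht1
  conv_lhs => rw [this]
  rw [norm_smul, hg.1, mul_one, norm_norm, smul_smul, inv_mul_cancel₀ h0.ne', one_smul]

end Normals

/-! ### Weighted excess on circles and antipodal pairing. -/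

section Circle

variable {d : ℕ}

theorem signedIndicator_of_mem {S : Set (EuclideanSpace ℝ (Fin d))} {y : EuclideanSpace ℝ (Fin d)}
    (h : y ∈ S) : signedIndicator S y = -1 := by
  simp [signedIndicator, h]

theorem signedIndicator_of_notMem {S : Set (EuclideanSpace ℝ (Fin d))}
    {y : EuclideanSpace ℝ (Fin d)} (h : y ∉ S) : signedIndicator S y = 1 := by
  simp [signedIndicator, h]

theorem abs_signedIndicator_le (S : Set (EuclideanSpace ℝ (Fin d)))
    (y : EuclideanSpace ℝ (Fin d)) : |signedIndicator S y| ≤ 1 := by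
  by_cases h : y ∈ S
  · simp [signedIndicator_of_mem h]
  · simp [signedIndicator_of_notMem h]

theorem measurable_signedIndicator {S : Set (EuclideanSpace ℝ (Fin d))} (hS : MeasurableSet S) :
    Measurable (signedIndicator S) :=
  (measurable_one.indicator hS.compl).sub (measurable_one.indicator hS)

/-- The point at angle `α` of the unit circle of the plane spanned by `e` and `w`. -/
noncomputable def circlePoint (e w : EuclideanSpace ℝ (Fin d)) (α : ℝ) :
    EuclideanSpace ℝ (Fin d) :=
  Real.cos α • e + Real.sin α • w

@[fun_prop]
theorem continuous_circlePoint (e w : EuclideanSpace ℝ (Fin d)) :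
    Continuous (circlePoint e w) := by
  unfold circlePoint; fun_prop

theorem norm_smul_add_smul {e w : EuclideanSpace ℝ (Fin d)} (he : ‖e‖ = 1) (hw : ‖w‖ = 1)
    (hew : (inner ℝ e w : ℝ) = 0) (a b : ℝ) : ‖a • e + b • w‖ = √(a ^ 2 + b ^ 2) := by
  rw [eq_comm, Real.sqrt_eq_iff_mul_self_eq (by positivity) (norm_nonneg _), ← pow_two,
    norm_add_sq_real, norm_smul, norm_smul, he, hw, inner_smul_left, inner_smul_right, hew]
  simp

theorem norm_circlePoint {e w : EuclideanSpace ℝ (Fin d)} (he : ‖e‖ = 1) (hw : ‖w‖ = 1)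
    (hew : (inner ℝ e w : ℝ) = 0) (α : ℝ) : ‖circlePoint e w α‖ = 1 := by
  rw [circlePoint, norm_smul_add_smul he hw hew, Real.cos_sq_add_sin_sq, Real.sqrt_one]

theorem circlePoint_add_pi (e w : EuclideanSpace ℝ (Fin d)) (α : ℝ) :
    circlePoint e w (α + Real.pi) = -circlePoint e w α := by
  simp only [circlePoint, Real.cos_add_pi, Real.sin_add_pi]; module

/-- The weight on the circle in the plane spanned by `e` and `w`. -/
noncomputable def circleWeight (g : EuclideanSpace ℝ (Fin d) → ℝ)
    (e w : EuclideanSpace ℝ (Fin d)) (α : ℝ) : ℝ :=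
  |Real.cos α| ^ (d - 2) * g (circlePoint e w α)

/-- The weighted excess of the complement of `S` on the circle of radius `t` around `x` in the
plane spanned by `e` and `w`. -/
noncomputable def circleExcess (g : EuclideanSpace ℝ (Fin d) → ℝ)
    (x e w : EuclideanSpace ℝ (Fin d)) (S : Set (EuclideanSpace ℝ (Fin d))) (t : ℝ) : ℝ :=
  ∫ α in Ioo (-Real.pi) Real.pi,
    signedIndicator S (x + t • circlePoint e w α) * circleWeight g e w α

/-- The data on which the weights depend: an even continuous function on the sphere bounded by
`G`, and an orthonormal pair. -/
structure CircleData (g : EuclideanSpace ℝ (Fin d) → ℝ) (G : ℝ)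
    (e w : EuclideanSpace ℝ (Fin d)) : Prop where
  cont : ContinuousOn g (sphere 0 1)
  symm : ∀ θ ∈ sphere (0 : EuclideanSpace ℝ (Fin d)) 1, g (-θ) = g θ
  bound : ∀ θ ∈ sphere (0 : EuclideanSpace ℝ (Fin d)) 1, |g θ| ≤ G
  norm_e : ‖e‖ = 1
  norm_w : ‖w‖ = 1
  inner_eq : (inner ℝ e w : ℝ) = 0

namespace CircleData

variable {g : EuclideanSpace ℝ (Fin d) → ℝ} {G : ℝ} {x e w : EuclideanSpace ℝ (Fin d)}
  {S : Set (EuclideanSpace ℝ (Fin d))}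

theorem mem_sphere (h : CircleData g G e w) (α : ℝ) :
    circlePoint e w α ∈ sphere (0 : EuclideanSpace ℝ (Fin d)) 1 := by
  simpa using norm_circlePoint h.norm_e h.norm_w h.inner_eq α

theorem continuous_weight (h : CircleData g G e w) : Continuous (circleWeight g e w) := by
  unfold circleWeight
  refine Continuous.mul (by fun_prop) ?_
  exact h.cont.comp_continuous (continuous_circlePoint e w) h.mem_sphere

theorem weight_add_pi (h : CircleData g G e w) (α : ℝ) :
    circleWeight g e w (α + Real.pi) = circleWeight g e w α := by
  rw [circleWeight, circlePoint_add_pi, h.symm _ (h.mem_sphere α), Real.cos_add_pi, abs_neg]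
  rfl

theorem abs_weight_le (h : CircleData g G e w) (α : ℝ) : |circleWeight g e w α| ≤ G := by
  rw [circleWeight, abs_mul, abs_pow, abs_abs]
  refine (mul_le_of_le_one_left (abs_nonneg _) ?_).trans (h.bound _ (h.mem_sphere α))
  exact pow_le_one₀ (abs_nonneg _) (Real.abs_cos_le_one α)

theorem bound_nonneg (h : CircleData g G e w) : 0 ≤ G :=
  (abs_nonneg _).trans (h.abs_weight_le 0)

theorem measurable_integrand (h : CircleData g G e w) (hS : MeasurableSet S) :
    Measurable fun p : ℝ × ℝ =>
      signedIndicator S (x + p.1 • circlePoint e w p.2) * circleWeight g e w p.2 :=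
  ((measurable_signedIndicator hS).comp
    (by fun_prop : Measurable fun p : ℝ × ℝ => x + p.1 • circlePoint e w p.2)).mul
    (h.continuous_weight.measurable.comp measurable_snd)

theorem abs_integrand_le (h : CircleData g G e w) (y : EuclideanSpace ℝ (Fin d)) (α : ℝ) :
    |signedIndicator S y * circleWeight g e w α| ≤ G := by
  rw [abs_mul]
  exact (mul_le_of_le_one_left (abs_nonneg _) (abs_signedIndicator_le _ _)).trans
    (h.abs_weight_le α)

theorem intervalIntegrable (h : CircleData g G e w) (hS : MeasurableSet S) (t a b : ℝ) :
    IntervalIntegrable (fun α => signedIndicator S (x + t • circlePoint e w α) *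
      circleWeight g e w α) volume a b := by
  rw [intervalIntegrable_iff]
  refine Measure.integrableOn_of_bounded (M := G) (by simp)
    (((h.measurable_integrand hS).comp (by fun_prop : Measurable fun α : ℝ => (t, α)))).aestronglyMeasurable
    (Eventually.of_forall fun α => ?_)
  exact h.abs_integrand_le _ α

theorem abs_circleExcess_le (h : CircleData g G e w) (t : ℝ) :
    |circleExcess g x e w S t| ≤ 2 * Real.pi * G := by
  have := norm_setIntegral_le_of_norm_le_const (μ := volume) (s := Ioo (-Real.pi) Real.pi) (C := G)
    (f := fun α => signedIndicator S (x + t • circlePoint e w α) * circleWeight g e w α)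
    (by simp) (fun α _ => h.abs_integrand_le (S := S) (x + t • circlePoint e w α) α)
  rw [circleExcess, ← Real.norm_eq_abs]
  refine this.trans (le_of_eq ?_)
  rw [Real.volume_real_Ioo_of_le (by linarith [Real.pi_pos])]
  ring

/-- Opposite points of the circle are paired. -/
theorem circleExcess_eq (h : CircleData g G e w) (hS : MeasurableSet S) (t a : ℝ) :
    circleExcess g x e w S t = ∫ α in (a - Real.pi / 2)..(a + Real.pi / 2),
      (signedIndicator S (x + t • circlePoint e w α) +
        signedIndicator S (x - t • circlePoint e w α)) * circleWeight g e w α := by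
  set F : ℝ → ℝ := fun α => signedIndicator S (x + t • circlePoint e w α) *
      circleWeight g e w α with hF
  have hFpi : ∀ α, F (α + Real.pi) =
      signedIndicator S (x - t • circlePoint e w α) * circleWeight g e w α := by
    intro α
    simp only [hF, h.weight_add_pi, circlePoint_add_pi, smul_neg, sub_eq_add_neg]
  have hper : Function.Periodic F (2 * Real.pi) := by
    intro α
    rw [two_mul, ← add_assoc, hFpi, circlePoint_add_pi, h.weight_add_pi]
    simp [hF]
  have hi : ∀ a b, IntervalIntegrable F volume a b := fun a b => h.intervalIntegrable hS t a b
  have h1 : circleExcess g x e w S t = ∫ α in (-Real.pi)..(-Real.pi + 2 * Real.pi), F α := by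
    rw [intervalIntegral.integral_of_le (by linarith [Real.pi_pos]), circleExcess,
      ← integral_Ioc_eq_integral_Ioo]
    congr 2; congr 1; ring
  -- The period is moved to start at `a - π/2` and cut at `a + π/2`; the second half is then shifted
  -- back by `π`. The centre `a` is free and is later taken to be the tangent angle.
  rw [h1, hper.intervalIntegral_add_eq (-Real.pi) (a - Real.pi / 2),
    ← intervalIntegral.integral_add_adjacent_intervals (hi _ (a + Real.pi / 2)) (hi _ _)]
  have h2 : ∫ α in (a + Real.pi / 2)..(a - Real.pi / 2 + 2 * Real.pi), F α =
      ∫ α in (a - Real.pi / 2)..(a + Real.pi / 2), F (α + Real.pi) := by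
    rw [intervalIntegral.integral_comp_add_right]
    congr 1 <;> ring
  rw [h2, ← intervalIntegral.integral_add (hi _ _) ?_]
  · refine intervalIntegral.integral_congr fun α _ => ?_
    simp only [hFpi]
    simp only [hF]; ring
  · have := (hi (a - Real.pi / 2 + Real.pi) (a + Real.pi / 2 + Real.pi)).comp_add_right Real.pi
    simpa using this

end CircleData

end Circle

/-! ### Bounds and first order asymptotics of the circle excess. -/

section CircleExcess

variable {d : ℕ}

/-- The angle at which the linear functional `p` vanishes on the circle. -/
noncomputable def tangentAngle (p : EuclideanSpace ℝ (Fin d) →L[ℝ] ℝ)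
    (e w : EuclideanSpace ℝ (Fin d)) : ℝ :=
  Real.arctan (-(p e / p w))

/-- The sine subtraction formula, with amplitude and phase read off from `p e` and `p w`. It
exhibits the simple zero of `p` on the half circle around `tangentAngle`. -/
theorem apply_circlePoint {p : EuclideanSpace ℝ (Fin d) →L[ℝ] ℝ}
    {e w : EuclideanSpace ℝ (Fin d)} (hw : p w ≠ 0) (α : ℝ) :
    p (circlePoint e w α) = p w * √(1 + (p e / p w) ^ 2) * Real.sin (α - tangentAngle p e w) := by
  have h0 : √(1 + (p e / p w) ^ 2) ≠ 0 := by positivity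
  rw [Real.sin_sub, tangentAngle, Real.cos_arctan, Real.sin_arctan, circlePoint, map_add, map_smul,
    map_smul, smul_eq_mul, smul_eq_mul, neg_sq]
  field_simp
  ring

variable {g : EuclideanSpace ℝ (Fin d) → ℝ} {G : ℝ} {x e w : EuclideanSpace ℝ (Fin d)}
  {S : Set (EuclideanSpace ℝ (Fin d))} {p : EuclideanSpace ℝ (Fin d) →L[ℝ] ℝ}
  {q : EuclideanSpace ℝ (Fin d) → ℝ}

/-- The value of `χ̃` at small distance in direction `θ`. -/
theorem SecondOrderContact.signedIndicator_eq {δ R t : ℝ}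
    (h : SecondOrderContact S x p q δ R) (hq : ∀ (t : ℝ) v, q (t • v) = t ^ 2 * q v)
    {θ : EuclideanSpace ℝ (Fin d)} (hθ : ‖θ‖ = 1) (ht : 0 < t) (htR : t ≤ R) :
    (p θ + t * q θ + t * δ < 0 → signedIndicator S (x + t • θ) = -1) ∧
    (0 < p θ + t * q θ - t * δ → signedIndicator S (x + t • θ) = 1) := by
  have hn : ‖t • θ‖ = t := by rw [norm_smul, hθ, mul_one, Real.norm_of_nonneg ht.le]
  have := h (t • θ) (hn.trans_le htR)
  rw [hq, map_smul, hn, smul_eq_mul] at this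
  refine ⟨fun h1 => signedIndicator_of_mem (this.1 ?_),
    fun h1 => signedIndicator_of_notMem (this.2 ?_)⟩
  · have := mul_neg_of_pos_of_neg ht h1
    linarith
  · have := mul_pos ht h1
    linarith

/-- When `|p θ|` exceeds `t(K + δ)`, the linear part beats the quadratic part and the error at both
`θ` and `-θ`. As it is odd, the two values of `χ̃` are opposite. -/
theorem SecondOrderContact.pair_eq_zero {δ R t K : ℝ}
    (h : SecondOrderContact S x p q δ R) (hq : ∀ (t : ℝ) v, q (t • v) = t ^ 2 * q v)
    (hK : ∀ v, |q v| ≤ K * ‖v‖ ^ 2) {θ : EuclideanSpace ℝ (Fin d)} (hθ : ‖θ‖ = 1) (ht : 0 < t)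
    (htR : t ≤ R) (hp : t * (K + δ) < |p θ|) :
    signedIndicator S (x + t • θ) + signedIndicator S (x - t • θ) = 0 := by
  have h1 := h.signedIndicator_eq hq hθ ht htR
  have h2 := h.signedIndicator_eq hq (θ := -θ) (by rwa [norm_neg]) ht htR
  have hqn : q (-θ) = q θ := by
    have := hq (-1) θ
    simpa using this
  rw [hqn, map_neg, smul_neg, ← sub_eq_add_neg] at h2
  have hb := hK θ
  rw [hθ, one_pow, mul_one, abs_le] at hb
  have hb1 := mul_le_mul_of_nonneg_left hb.1 ht.le
  have hb2 := mul_le_mul_of_nonneg_left hb.2 ht.le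
  rcases lt_abs.1 hp with hp | hp
  · rw [h1.2 (by linarith), h2.1 (by linarith)]; norm_num
  · rw [h1.1 (by linarith), h2.2 (by linarith)]; norm_num

/-- Jordan's inequality `|sin β| ≥ (2/π)|β|` and `p w ≥ 1/2` give `|p θ| ≥ |α - a|/π`, where `a` is
the tangent angle. -/
theorem SecondOrderContact.pair_eq_zero_of_angle {δ R t K α : ℝ}
    (h : SecondOrderContact S x p q δ R) (hq : ∀ (t : ℝ) v, q (t • v) = t ^ 2 * q v)
    (hK : ∀ v, |q v| ≤ K * ‖v‖ ^ 2) (he : ‖e‖ = 1) (hw : ‖w‖ = 1)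
    (hew : (inner ℝ e w : ℝ) = 0) (hpw : 1 / 2 ≤ p w) (ht : 0 < t) (htR : t ≤ R)
    (hα : |α - tangentAngle p e w| ≤ Real.pi / 2)
    (hα' : Real.pi * (t * (K + δ)) < |α - tangentAngle p e w|) :
    signedIndicator S (x + t • circlePoint e w α) +
      signedIndicator S (x - t • circlePoint e w α) = 0 := by
  refine h.pair_eq_zero hq hK (norm_circlePoint he hw hew α) ht htR ?_
  rw [apply_circlePoint (by linarith), abs_mul, abs_mul, abs_of_pos (by linarith : 0 < p w),
    abs_of_nonneg (Real.sqrt_nonneg _)]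
  have h1 : 1 ≤ √(1 + (p e / p w) ^ 2) := by
    rw [Real.one_le_sqrt]; nlinarith [sq_nonneg (p e / p w)]
  have h2 := Real.mul_abs_le_abs_sin hα
  have h3 : t * (K + δ) < 1 / Real.pi * |α - tangentAngle p e w| := by
    rw [one_div, inv_mul_eq_div, lt_div_iff₀ Real.pi_pos]; linarith
  calc t * (K + δ) < 1 / 2 * 1 * (2 / Real.pi * |α - tangentAngle p e w|) := by
        refine h3.trans_le (le_of_eq ?_); ring
    _ ≤ p w * √(1 + (p e / p w) ^ 2) * |Real.sin (α - tangentAngle p e w)| := by gcongr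

theorem abs_signedIndicator_pair_le (y z : EuclideanSpace ℝ (Fin d)) :
    |signedIndicator S y + signedIndicator S z| ≤ 2 := by
  have h1 := abs_signedIndicator_le S y
  have h2 := abs_signedIndicator_le S z
  exact (abs_add_le _ _).trans (by linarith)

/-- After pairing, the integrand is at most `2G` and lives on an arc of length `2π(K + δ)t`. -/
theorem SecondOrderContact.abs_circleExcess_le {δ R t K : ℝ}
    (h : SecondOrderContact S x p q δ R) (hq : ∀ (t : ℝ) v, q (t • v) = t ^ 2 * q v)
    (hK : ∀ v, |q v| ≤ K * ‖v‖ ^ 2) (hKδ : 0 ≤ K + δ) (hd : CircleData g G e w)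
    (hS : MeasurableSet S) (hpw : 1 / 2 ≤ p w) (ht : 0 < t) (htR : t ≤ R) :
    |circleExcess g x e w S t| ≤ 4 * Real.pi * (K + δ) * G * t := by
  set a := tangentAngle p e w
  set m := Real.pi * (t * (K + δ)) with hm
  have hm0 : 0 ≤ m := by have := Real.pi_pos; positivity
  rw [hd.circleExcess_eq hS t a, intervalIntegral.integral_of_le (by linarith [Real.pi_pos])]
  rw [setIntegral_eq_of_subset_of_forall_sdiff_eq_zero (s := Ioc (a - Real.pi / 2) (a + Real.pi / 2)
    ∩ Icc (a - m) (a + m)) measurableSet_Ioc inter_subset_left]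
  · have h1 := norm_setIntegral_le_of_norm_le_const (μ := volume)
      (s := Ioc (a - Real.pi / 2) (a + Real.pi / 2) ∩ Icc (a - m) (a + m)) (C := 2 * G)
      (f := fun α => (signedIndicator S (x + t • circlePoint e w α) +
        signedIndicator S (x - t • circlePoint e w α)) * circleWeight g e w α)
      ((measure_mono inter_subset_right).trans_lt (by simp)) (fun α _ => by
        rw [Real.norm_eq_abs, abs_mul]
        exact mul_le_mul (abs_signedIndicator_pair_le _ _) (hd.abs_weight_le α) (abs_nonneg _)
          zero_le_two)
    rw [← Real.norm_eq_abs]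
    refine h1.trans ?_
    have h2 : volume.real (Ioc (a - Real.pi / 2) (a + Real.pi / 2) ∩ Icc (a - m) (a + m)) ≤ 2 * m := by
      refine (measureReal_mono inter_subset_right (by simp)).trans ?_
      rw [Real.volume_real_Icc_of_le (by linarith)]; linarith
    have := mul_le_mul_of_nonneg_left h2 (mul_nonneg zero_le_two hd.bound_nonneg)
    refine this.trans (le_of_eq ?_)
    rw [hm]; ring
  · intro α hα
    have hα1 : |α - a| ≤ Real.pi / 2 := by
      rw [abs_le]; constructor <;> linarith [hα.1.1, hα.1.2]
    have hα2 : m < |α - a| := by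
      by_contra! hcon
      rw [abs_le] at hcon
      exact hα.2 ⟨hα.1, by linarith [hcon.1], by linarith [hcon.2]⟩
    rw [h.pair_eq_zero_of_angle hq hK hd.norm_e hd.norm_w hd.inner_eq hpw ht htR hα1 hα2, zero_mul]

/-- `∫ (sgn (k + s) + sgn (k - s)) ds = 4 k`. -/
theorem integral_sign_pair (k : ℝ) :
    ∫ s : ℝ, (SignType.sign (k + s) + SignType.sign (k - s) : ℝ) = 4 * k := by
  have key : ∀ c : ℝ, 0 ≤ c → ∫ s : ℝ, (SignType.sign (c + s) + SignType.sign (c - s) : ℝ) = 4 * c := by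
    intro c hc
    have : (fun s : ℝ => (SignType.sign (c + s) + SignType.sign (c - s) : ℝ)) =ᵐ[volume]
        (Ioo (-c) c).indicator fun _ => 2 := by
      filter_upwards [compl_mem_ae_iff.2 (measure_singleton (μ := volume) c),
        compl_mem_ae_iff.2 (measure_singleton (μ := volume) (-c))] with s h1 h2
      simp only [mem_compl_iff, mem_singleton_iff] at h1 h2
      by_cases hs : s ∈ Ioo (-c) c
      · rw [indicator_of_mem hs, sign_pos (by linarith [hs.1]), sign_pos (by linarith [hs.2])]
        norm_num
      · rw [indicator_of_notMem hs]
        rcases lt_or_gt_of_ne h1 with h1 | h1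
        · have h3 : s < -c := lt_of_le_of_ne (by
            by_contra! h4; exact hs ⟨h4, h1⟩) h2
          rw [sign_neg (by linarith), sign_pos (by linarith)]; norm_num
        · rw [sign_pos (by linarith), sign_neg (by linarith)]; norm_num
    rw [integral_congr_ae this, integral_indicator measurableSet_Ioo, setIntegral_const,
      Real.volume_real_Ioo_of_le (by linarith), smul_eq_mul]
    ring
  rcases le_total 0 k with hk | hk
  · exact key k hk
  · have h1 := key (-k) (by linarith)
    have h2 : (fun s : ℝ => (SignType.sign (-k + s) + SignType.sign (-k - s) : ℝ)) =
        fun s : ℝ => -(SignType.sign (k + s) + SignType.sign (k - s) : ℝ) := by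
      funext s
      have e1 : -k + s = -(k - s) := by ring
      have e2 : -k - s = -(k + s) := by ring
      rw [e1, e2, Left.sign_neg, Left.sign_neg]
      push_cast; ring
    rw [h2, integral_neg] at h1
    linarith

/-- `p θ / t + q θ` tends to `k + s`, so contact with `δ = |k + s|/2` settles the sign. Contact is
needed only within the radius `ti i` at which it is evaluated. -/
theorem eventually_signedIndicator_eq_sign {ι : Type*} {l : Filter ι}
    {Si : ι → Set (EuclideanSpace ℝ (Fin d))} {pi : ι → EuclideanSpace ℝ (Fin d) →L[ℝ] ℝ}
    {ti : ι → ℝ} (hq : ∀ (t : ℝ) v, q (t • v) = t ^ 2 * q v) (ht : ∀ᶠ i in l, 0 < ti i)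
    (hc : ∀ δ > 0, ∀ᶠ i in l, SecondOrderContact (Si i) x (pi i) q δ (ti i))
    {θ : ι → EuclideanSpace ℝ (Fin d)} (hθ : ∀ᶠ i in l, ‖θ i‖ = 1) {s k : ℝ}
    (hpθ : Tendsto (fun i => pi i (θ i) / ti i) l (𝓝 s))
    (hqθ : Tendsto (fun i => q (θ i)) l (𝓝 k)) (hsk : k + s ≠ 0) :
    ∀ᶠ i in l, signedIndicator (Si i) (x + ti i • θ i) = (SignType.sign (k + s) : ℝ) := by
  have hsum := hqθ.add hpθ
  rcases lt_or_gt_of_ne hsk with hneg | hpos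
  · rw [sign_neg hneg]
    have hδ : 0 < -(k + s) / 2 := by linarith
    filter_upwards [ht, hθ, hc _ hδ, hsum.eventually (gt_mem_nhds (by linarith : k + s < (k + s) / 2))]
      with i h1 h2 h3 h4
    rw [(h3.signedIndicator_eq hq h2 h1 le_rfl).1]
    · norm_num
    have h5 := mul_lt_mul_of_pos_left h4 h1
    rw [mul_add, mul_div_cancel₀ _ h1.ne'] at h5
    linarith
  · rw [sign_pos hpos]
    have hδ : 0 < (k + s) / 2 := by linarith
    filter_upwards [ht, hθ, hc _ hδ, hsum.eventually (lt_mem_nhds (by linarith : (k + s) / 2 < k + s))]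
      with i h1 h2 h3 h4
    rw [(h3.signedIndicator_eq hq h2 h1 le_rfl).2]
    · norm_num
    have h5 := mul_lt_mul_of_pos_left h4 h1
    rw [mul_add, mul_div_cancel₀ _ h1.ne'] at h5
    linarith

theorem tendsto_clm_apply {ι E F : Type*} [NormedAddCommGroup E] [NormedSpace ℝ E]
    [NormedAddCommGroup F] [NormedSpace ℝ F] {l : Filter ι} {a : ι → E →L[ℝ] F} {b : ι → E}
    {a₀ : E →L[ℝ] F} {b₀ : E} (ha : Tendsto a l (𝓝 a₀)) (hb : Tendsto b l (𝓝 b₀)) :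
    Tendsto (fun i => a i (b i)) l (𝓝 (a₀ b₀)) :=
  (isBoundedBilinearMap_apply.continuous.tendsto (a₀, b₀)).comp (ha.prodMk_nhds hb)

/-- Substituting `α = a + t s` blows the shrinking arc up to a fixed scale and absorbs the division
by `t`; dominated convergence then applies. The general filter allows sets, planes, weights and
radii to vary at once: it is used on pairs `(n, t)`. -/
theorem tendsto_circleExcess_div {ι : Type*} {l : Filter ι} [l.IsCountablyGenerated]
    {gi : ι → EuclideanSpace ℝ (Fin d) → ℝ} {e₀ w₀ : EuclideanSpace ℝ (Fin d)}
    {ei wi : ι → EuclideanSpace ℝ (Fin d)} {Si : ι → Set (EuclideanSpace ℝ (Fin d))}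
    {pi : ι → EuclideanSpace ℝ (Fin d) →L[ℝ] ℝ} {p₀ : EuclideanSpace ℝ (Fin d) →L[ℝ] ℝ}
    {ti : ι → ℝ} {K γ : ℝ} (hd : ∀ᶠ i in l, CircleData (gi i) G (ei i) (wi i))
    (hS : ∀ i, MeasurableSet (Si i)) (he : Tendsto ei l (𝓝 e₀)) (hw : Tendsto wi l (𝓝 w₀))
    (hp : Tendsto pi l (𝓝 p₀)) (hpe : p₀ e₀ = 0) (hpw : p₀ w₀ = 1)
    (hq : ∀ (t : ℝ) v, q (t • v) = t ^ 2 * q v) (hqc : Continuous q)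
    (hK : ∀ v, |q v| ≤ K * ‖v‖ ^ 2) (ht : Tendsto ti l (𝓝[>] 0))
    (hc : ∀ δ > 0, ∀ᶠ i in l, SecondOrderContact (Si i) x (pi i) q δ (ti i))
    (hg : ∀ θ : ι → EuclideanSpace ℝ (Fin d), (∀ᶠ i in l, ‖θ i‖ = 1) → Tendsto θ l (𝓝 e₀) →
      Tendsto (fun i => gi i (θ i)) l (𝓝 γ)) :
    Tendsto (fun i => circleExcess (gi i) x (ei i) (wi i) (Si i) (ti i) / ti i) l
      (𝓝 (4 * q e₀ * γ)) := by
  have ht0 : ∀ᶠ i in l, 0 < ti i := ht.eventually self_mem_nhdsWithin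
  have ht1 : Tendsto ti l (𝓝 0) := ht.mono_right nhdsWithin_le_nhds
  have htne : Tendsto ti l (𝓝[≠] 0) := ht.mono_right (nhdsWithin_mono _ fun y hy => ne_of_gt hy)
  set a : ι → ℝ := fun i => tangentAngle (pi i) (ei i) (wi i) with ha
  have hpei : Tendsto (fun i => pi i (ei i)) l (𝓝 0) := hpe ▸ tendsto_clm_apply hp he
  have hpwi : Tendsto (fun i => pi i (wi i)) l (𝓝 1) := hpw ▸ tendsto_clm_apply hp hw
  have hquot : Tendsto (fun i => pi i (ei i) / pi i (wi i)) l (𝓝 0) := by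
    simpa [Pi.div_def] using hpei.div hpwi one_ne_zero
  have hpw' : ∀ᶠ i in l, 1 / 2 ≤ pi i (wi i) :=
    (hpwi.eventually (lt_mem_nhds (by norm_num : (1 / 2 : ℝ) < 1))).mono fun i hi => hi.le
  have ha0 : Tendsto a l (𝓝 0) := by
    have := (Real.continuous_arctan.tendsto (-0)).comp hquot.neg
    simpa [ha, tangentAngle, Function.comp_def] using this
  have hα : ∀ s : ℝ, Tendsto (fun i => a i + ti i * s) l (𝓝 0) := fun s => by
    simpa using ha0.add (ht1.mul_const s)
  set F : ι → ℝ → ℝ := fun i α =>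
    (signedIndicator (Si i) (x + ti i • circlePoint (ei i) (wi i) α) +
      signedIndicator (Si i) (x - ti i • circlePoint (ei i) (wi i) α)) *
      circleWeight (gi i) (ei i) (wi i) α with hF
  -- The half circle around the tangent angle, in the rescaled variable `s`.
  set I : ι → Set ℝ := fun i => Ioc (-(Real.pi / 2) / ti i) (Real.pi / 2 / ti i) with hI
  have hmemI : ∀ i, 0 < ti i → ∀ s ∈ I i, |ti i * s| ≤ Real.pi / 2 := by
    intro i hi s hs
    have h1 := (div_lt_iff₀ hi).1 hs.1
    have h2 := (le_div_iff₀ hi).1 hs.2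
    rw [abs_le]; constructor <;> linarith
  have hint : ∀ᶠ i in l, ∫ s, (I i).indicator (fun s => F i (a i + ti i * s)) s =
      circleExcess (gi i) x (ei i) (wi i) (Si i) (ti i) / ti i := by
    filter_upwards [ht0, hd] with i h0 hdi
    have hpi := Real.pi_pos
    rw [integral_indicator measurableSet_Ioc, ← intervalIntegral.integral_of_le
      (by gcongr; linarith), eq_div_iff h0.ne', mul_comm, intervalIntegral.mul_integral_comp_add_mul,
      hdi.circleExcess_eq (hS i) (ti i) (a i), mul_div_cancel₀ _ h0.ne', mul_div_cancel₀ _ h0.ne',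
      sub_eq_add_neg]
  refine Tendsto.congr' hint ?_
  have hlimval : 4 * q e₀ * γ =
      ∫ s : ℝ, (SignType.sign (q e₀ + s) + SignType.sign (q e₀ - s) : ℝ) * γ := by
    rw [integral_mul_const, integral_sign_pair]
  rw [hlimval]
  -- By `pair_eq_zero_of_angle` with `δ = 1`, the rescaled integrand vanishes for `|s| > π(K + 1)`,
  -- hence the integrable majorant `2G` on `[-M, M]`.
  set M := Real.pi * (K + 1) with hM
  refine tendsto_integral_filter_of_dominated_convergence
    ((Icc (-M) M).indicator fun _ => 2 * G) ?_ ?_ ?_ ?_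
  · filter_upwards [hd] with i hdi
    refine (Measurable.indicator ?_ measurableSet_Ioc).aestronglyMeasurable
    have hcp : Measurable (circlePoint (ei i) (wi i)) := (continuous_circlePoint _ _).measurable
    have hFm : Measurable (F i) := by
      refine Measurable.mul (Measurable.add ?_ ?_) hdi.continuous_weight.measurable
      · exact (measurable_signedIndicator (hS i)).comp (by fun_prop)
      · exact (measurable_signedIndicator (hS i)).comp (by fun_prop)
    exact hFm.comp (by fun_prop)
  · filter_upwards [ht0, hd, hpw', hc 1 one_pos] with i h0 hdi hpi hci
    refine Eventually.of_forall fun s => ?_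
    have hFb : ‖F i (a i + ti i * s)‖ ≤ 2 * G := by
      rw [Real.norm_eq_abs, hF, abs_mul]
      exact mul_le_mul (abs_signedIndicator_pair_le _ _) (hdi.abs_weight_le _) (abs_nonneg _)
        zero_le_two
    by_cases hs : s ∈ Icc (-M) M
    · rw [indicator_of_mem hs]
      exact (norm_indicator_le_norm_self _ _).trans hFb
    · rw [indicator_of_notMem hs]
      by_cases hsI : s ∈ I i
      · rw [indicator_of_mem hsI]
        have h2 : M < |s| := by
          by_contra! hcon
          exact hs (abs_le.1 hcon)
        have h3 : F i (a i + ti i * s) = 0 := by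
          simp only [hF]
          rw [hci.pair_eq_zero_of_angle hq hK hdi.norm_e hdi.norm_w hdi.inner_eq hpi h0 le_rfl,
            zero_mul]
          · simpa [ha] using hmemI i h0 s hsI
          · simp only [ha, add_sub_cancel_left, abs_mul, abs_of_pos h0]
            have := mul_lt_mul_of_pos_left h2 h0
            rw [hM] at this
            linarith
        rw [h3, norm_zero]
      · rw [indicator_of_notMem hsI, norm_zero]
  · exact (integrable_indicator_iff measurableSet_Icc).2 (integrableOn_const (by simp))
  -- The two values `s = ± q e₀`, where a limiting sign would be `0`, form a null set.
  · filter_upwards [compl_mem_ae_iff.2 (measure_singleton (μ := volume) (q e₀)),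
        compl_mem_ae_iff.2 (measure_singleton (μ := volume) (-(q e₀)))] with s hs1 hs2
    simp only [mem_compl_iff, mem_singleton_iff] at hs1 hs2
    set θ : ι → EuclideanSpace ℝ (Fin d) := fun i => circlePoint (ei i) (wi i) (a i + ti i * s)
      with hθ
    have hcos : Tendsto (fun i => Real.cos (a i + ti i * s)) l (𝓝 1) := by
      simpa [Function.comp_def] using (Real.continuous_cos.tendsto 0).comp (hα s)
    have hsin : Tendsto (fun i => Real.sin (a i + ti i * s)) l (𝓝 0) := by
      simpa [Function.comp_def] using (Real.continuous_sin.tendsto 0).comp (hα s)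
    have hθlim : Tendsto θ l (𝓝 e₀) := by
      simpa [hθ, circlePoint] using (hcos.smul he).add (hsin.smul hw)
    have hθn : ∀ᶠ i in l, ‖θ i‖ = 1 := by
      filter_upwards [hd] with i hdi using norm_circlePoint hdi.norm_e hdi.norm_w hdi.inner_eq _
    have hqθ : Tendsto (fun i => q (θ i)) l (𝓝 (q e₀)) := (hqc.tendsto e₀).comp hθlim
    have hqθ' : Tendsto (fun i => q (-θ i)) l (𝓝 (q e₀)) := by
      refine hqθ.congr fun i => ?_
      have := hq (-1) (θ i)
      simpa using this.symm
    have hpθ : Tendsto (fun i => pi i (θ i) / ti i) l (𝓝 s) := by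
      have h1 : Tendsto (fun i => Real.sin (ti i * s) / ti i) l (𝓝 s) := by
        have h2 : HasDerivAt (fun t : ℝ => Real.sin (t * s)) s 0 := by
          have := ((hasDerivAt_id (0 : ℝ)).mul_const s).sin
          simpa using this
        have h3 := h2.tendsto_slope_zero.comp htne
        refine h3.congr fun i => ?_
        simp [div_eq_inv_mul]
      have h2 : Tendsto (fun i => pi i (wi i) * √(1 + (pi i (ei i) / pi i (wi i)) ^ 2)) l (𝓝 1) := by
        have h3 : Tendsto (fun i => √(1 + (pi i (ei i) / pi i (wi i)) ^ 2)) l (𝓝 1) := by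
          have := ((hquot.pow 2).const_add 1).sqrt
          simpa using this
        simpa using hpwi.mul h3
      have h4 := h2.mul h1
      rw [one_mul] at h4
      refine h4.congr' ?_
      filter_upwards [hpw'] with i hi
      rw [hθ, apply_circlePoint (by linarith)]
      simp only [ha, add_sub_cancel_left]
      ring
    have hpθ' : Tendsto (fun i => pi i (-θ i) / ti i) l (𝓝 (-s)) := by
      refine hpθ.neg.congr fun i => ?_
      rw [map_neg, neg_div]
    have hw1 : Tendsto (fun i => circleWeight (gi i) (ei i) (wi i) (a i + ti i * s)) l (𝓝 γ) := by
      have h1 := (hcos.abs.pow (d - 2)).mul (hg θ hθn hθlim)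
      simpa [circleWeight, hθ] using h1
    have hIev : ∀ᶠ i in l, s ∈ I i := by
      have h1 : Tendsto (fun i => ti i * s) l (𝓝 0) := by simpa using ht1.mul_const s
      filter_upwards [ht0, h1.eventually (Ioo_mem_nhds (by linarith [Real.pi_pos] :
        -(Real.pi / 2) < 0) (by linarith [Real.pi_pos] : 0 < Real.pi / 2))] with i h0 h2
      exact ⟨(div_lt_iff₀ h0).2 (by linarith [h2.1]), (le_div_iff₀ h0).2 (by linarith [h2.2])⟩
    refine Tendsto.congr' ?_ (hw1.const_mul _)
    filter_upwards [hIev,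
      eventually_signedIndicator_eq_sign hq ht0 hc hθn hpθ hqθ (fun h => hs2 (by linarith)),
      eventually_signedIndicator_eq_sign hq ht0 hc (by simpa using hθn) hpθ' hqθ'
        (fun h => hs1 (by linarith))] with i h1 h2 h3
    rw [indicator_of_mem h1, ← h2, sub_eq_add_neg, ← h3, smul_neg, ← sub_eq_add_neg]

end CircleExcess

/-! ### Radial profiles and the directional integral in polar coordinates. -/

section Radial

variable {d : ℕ}

/-- `J` is the radial profile of the kernel `j`. -/
structure RadialProfile (j : EuclideanSpace ℝ (Fin d) → ℝ) (J : ℝ → ℝ) : Prop where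
  meas : Measurable J
  nonneg : ∀ t, 0 ≤ J t
  eq : ∀ x, x ≠ 0 → j x = J ‖x‖
  integrable : IntegrableOn (fun t => t ^ (d - 1) * (min 1 t * J t)) (Ioi 0)

/-- Parametrizing a ray by `s ↦ exp s` makes the profile monotone on all of `ℝ`, so Borel
measurability comes for free. Monotonicity in both directions between points of equal norm gives
radiality. -/
theorem exists_radialProfile [NeZero d] {j : EuclideanSpace ℝ (Fin d) → ℝ}
    (hj : ∀ x, 0 ≤ j x) (hmono : RadiallyNonincreasing j)
    (hint : Integrable (fun x => min 1 ‖x‖ * j x)) : ∃ J, RadialProfile j J := by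
  set e₀ : EuclideanSpace ℝ (Fin d) := EuclideanSpace.single 0 1 with he₀
  have hn : ‖e₀‖ = 1 := by simp [he₀]
  have hnt : ∀ t : ℝ, 0 < t → ‖t • e₀‖ = t := fun t ht => by
    rw [norm_smul, hn, mul_one, Real.norm_of_nonneg ht.le]
  have hne : ∀ t : ℝ, 0 < t → t • e₀ ≠ 0 := fun t ht => by
    rw [← norm_ne_zero_iff, hnt t ht]; exact ht.ne'
  have hanti : Antitone fun s : ℝ => j (Real.exp s • e₀) := fun s s' hss =>
    hmono _ _ (hne _ (Real.exp_pos s)) (by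
      rw [hnt _ (Real.exp_pos s), hnt _ (Real.exp_pos s')]; exact Real.exp_le_exp.2 hss)
  have heq : ∀ x, x ≠ 0 → j x = j (Real.exp (Real.log ‖x‖) • e₀) := by
    intro x hx
    rw [Real.exp_log (norm_pos_iff.2 hx)]
    have h1 := hnt _ (norm_pos_iff.2 hx)
    exact le_antisymm (hmono _ _ (hne _ (norm_pos_iff.2 hx)) h1.le) (hmono _ _ hx h1.ge)
  -- At `t ≤ 0` this takes harmless values: `Real.log 0 = 0`, and the logarithm of a negative number
  -- is that of its absolute value. Only `t > 0` matters.
  refine ⟨fun t => j (Real.exp (Real.log t) • e₀), hanti.measurable.comp Real.measurable_log,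
    fun t => hj _, heq, ?_⟩
  have h2 : (fun x : EuclideanSpace ℝ (Fin d) => min 1 ‖x‖ * j x) =
      fun x => (fun t => min 1 t * j (Real.exp (Real.log t) • e₀)) ‖x‖ := by
    funext x
    by_cases hx : x = 0
    · simp [hx]
    · simp only [← heq x hx]
  have : Nontrivial (EuclideanSpace ℝ (Fin d)) := ⟨⟨e₀, 0, by rw [← norm_ne_zero_iff, hn]; simp⟩⟩
  rw [h2] at hint
  have h3 := (integrable_fun_norm_addHaar volume
    (f := fun t => min 1 t * j (Real.exp (Real.log t) • e₀))).1 hint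
  rwa [finrank_euclideanSpace_fin] at h3

theorem tendsto_integral_Ici {F : ℝ → ℝ} (hF : IntegrableOn F (Ioi 0)) :
    Tendsto (fun r => ∫ t in Ici r, F t) (𝓝[>] 0) (𝓝 (∫ t in Ioi 0, F t)) := by
  have h1 : ∀ᶠ r : ℝ in 𝓝[>] 0, ∫ t in Ioi 0, (Ici r).indicator F t = ∫ t in Ici r, F t := by
    filter_upwards [self_mem_nhdsWithin] with r hr
    rw [setIntegral_indicator measurableSet_Ici, inter_eq_right.2]
    exact Ici_subset_Ioi.2 hr
  refine Tendsto.congr' h1 ?_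
  refine tendsto_integral_filter_of_dominated_convergence (fun t => ‖F t‖)
    (Eventually.of_forall fun r => hF.aestronglyMeasurable.indicator measurableSet_Ici)
    (Eventually.of_forall fun r => Eventually.of_forall fun t => norm_indicator_le_norm_self _ _)
    hF.norm ?_
  filter_upwards [ae_restrict_mem measurableSet_Ioi] with t ht
  refine tendsto_const_nhds.congr' ?_
  filter_upwards [nhdsWithin_le_nhds (gt_mem_nhds (mem_Ioi.1 ht))] with r hr
  rw [indicator_of_mem (mem_Ici.2 (le_of_lt hr))]

namespace RadialProfile

variable {j : EuclideanSpace ℝ (Fin d) → ℝ} {J : ℝ → ℝ}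

theorem integrableOn_Ici (h : RadialProfile j J) {r : ℝ} (hr : 0 < r) :
    IntegrableOn (fun t => t ^ (d - 1) * J t) (Ici r) := by
  have h1 : IntegrableOn (fun t => (min 1 r)⁻¹ * (t ^ (d - 1) * (min 1 t * J t))) (Ici r) :=
    (h.integrable.mono_set (Ici_subset_Ioi.2 hr)).const_mul _
  refine Integrable.mono' h1 ?_ ?_
  · exact ((measurable_id.pow_const _).mul h.meas).aestronglyMeasurable
  · filter_upwards [ae_restrict_mem measurableSet_Ici] with t ht
    have ht0 : 0 < t := hr.trans_le ht
    have hJ := h.nonneg t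
    have hm : 0 < min 1 r := lt_min one_pos hr
    have h2 : 1 ≤ (min 1 r)⁻¹ * min 1 t := by
      rw [inv_mul_eq_div, le_div_iff₀ hm, one_mul]
      exact min_le_min_left _ ht
    rw [Real.norm_of_nonneg (by positivity)]
    calc t ^ (d - 1) * J t = 1 * (t ^ (d - 1) * J t) := (one_mul _).symm
      _ ≤ ((min 1 r)⁻¹ * min 1 t) * (t ^ (d - 1) * J t) := by gcongr
      _ = _ := by ring

/-- The factor `min 1 t` in the bound on `A` is what the kernel can integrate. The estimate is the
same for every `s`, so it controls all truncations at once. -/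
theorem integrable_mul_of_le (h : RadialProfile j J) {A : ℝ → ℝ} (hA : Measurable A) {M : ℝ}
    (hM : ∀ t > 0, |A t| ≤ M * min 1 t) :
    IntegrableOn (fun t => t ^ (d - 1) * J t * A t) (Ioi 0) ∧
      ∀ s ⊆ Ioi (0 : ℝ), MeasurableSet s → |∫ t in s, t ^ (d - 1) * J t * A t| ≤
        M * ∫ t in Ioi 0, t ^ (d - 1) * (min 1 t * J t) := by
  have hM0 : 0 ≤ M := by
    have := (abs_nonneg _).trans (hM 1 one_pos)
    simpa using this
  have hb : ∀ t ∈ Ioi (0 : ℝ), ‖t ^ (d - 1) * J t * A t‖ ≤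
      M * (t ^ (d - 1) * (min 1 t * J t)) := by
    intro t ht
    have ht0 : 0 < t := ht
    have hJ := h.nonneg t
    rw [Real.norm_eq_abs, abs_mul, abs_of_nonneg (by positivity)]
    calc _ ≤ t ^ (d - 1) * J t * (M * min 1 t) := by gcongr; exact hM t ht
      _ = _ := by ring
  have hint : IntegrableOn (fun t => t ^ (d - 1) * J t * A t) (Ioi 0) := by
    refine Integrable.mono' (h.integrable.const_mul M) ?_ ?_
    · exact (((measurable_id.pow_const _).mul h.meas).mul hA).aestronglyMeasurable
    · filter_upwards [ae_restrict_mem measurableSet_Ioi] with t ht using hb t ht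
  refine ⟨hint, fun s hs hsm => ?_⟩
  rw [← integral_const_mul, ← Real.norm_eq_abs]
  refine (norm_integral_le_integral_norm _).trans ?_
  refine (setIntegral_mono_on (hint.norm.mono_measure (Measure.restrict_mono hs le_rfl))
    ((h.integrable.const_mul M).mono_measure (Measure.restrict_mono hs le_rfl)) hsm
    fun t ht => hb t (hs ht)).trans ?_
  refine setIntegral_mono_set (h.integrable.const_mul M) ?_ hs.eventuallyLE
  filter_upwards [ae_restrict_mem measurableSet_Ioi] with t ht
  have ht0 : 0 < t := ht
  have hJ := h.nonneg t
  simp only [Pi.zero_apply]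
  positivity

end RadialProfile

theorem CircleData.measurable_circleExcess {g : EuclideanSpace ℝ (Fin d) → ℝ} {G : ℝ}
    {x e w : EuclideanSpace ℝ (Fin d)} {S : Set (EuclideanSpace ℝ (Fin d))}
    (h : CircleData g G e w) (hS : MeasurableSet S) : Measurable (circleExcess g x e w S) :=
  (StronglyMeasurable.integral_prod_right (f := fun (t α : ℝ) =>
    signedIndicator S (x + t • circlePoint e w α) * circleWeight g e w α)
    (h.measurable_integrand hS).stronglyMeasurable).measurable

/-- The constant in the bound `|circleExcess t| ≤ C min(1, t)`. -/
noncomputable def excessBound (K G R : ℝ) : ℝ :=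
  4 * Real.pi * (K + 1) * G + 2 * Real.pi * G / min 1 R

/-- Up to radius `min 1 R` the linear bound holds; beyond it, the trivial bound `2πG` is at most
`2πG / min 1 R` times `min 1 t`. -/
theorem SecondOrderContact.abs_circleExcess_le_min {g : EuclideanSpace ℝ (Fin d) → ℝ} {G : ℝ}
    {x e w : EuclideanSpace ℝ (Fin d)} {S : Set (EuclideanSpace ℝ (Fin d))}
    {p : EuclideanSpace ℝ (Fin d) →L[ℝ] ℝ} {q : EuclideanSpace ℝ (Fin d) → ℝ} {R K : ℝ}
    (h : SecondOrderContact S x p q 1 R) (hR : 0 < R) (hq : ∀ (t : ℝ) v, q (t • v) = t ^ 2 * q v)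
    (hK0 : 0 ≤ K) (hK : ∀ v, |q v| ≤ K * ‖v‖ ^ 2) (hd : CircleData g G e w)
    (hS : MeasurableSet S) (hpw : 1 / 2 ≤ p w) {t : ℝ} (ht : 0 < t) :
    |circleExcess g x e w S t| ≤ excessBound K G R * min 1 t := by
  have hpi := Real.pi_pos
  have hG := hd.bound_nonneg
  have hm : 0 < min 1 R := lt_min one_pos hR
  rcases le_or_gt t (min 1 R) with htR | htR
  · have h1 := h.abs_circleExcess_le hq hK (by linarith) hd hS hpw ht (htR.trans (min_le_right _ _))
    refine h1.trans ?_
    rw [min_eq_right (htR.trans (min_le_left _ _)), excessBound, add_mul]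
    have : 0 ≤ 2 * Real.pi * G / min 1 R * t := by positivity
    linarith
  · refine (hd.abs_circleExcess_le t).trans ?_
    have h2 : min 1 R ≤ min 1 t := le_min (min_le_left _ _) htR.le
    have h3 : 2 * Real.pi * G ≤ 2 * Real.pi * G / min 1 R * min 1 t := by
      calc 2 * Real.pi * G = 2 * Real.pi * G / min 1 R * min 1 R := by field_simp
        _ ≤ _ := by gcongr
    rw [excessBound, add_mul]
    have : 0 ≤ 4 * Real.pi * (K + 1) * G * min 1 t := by positivity
    linarith

/-- The truncated directional integral in polar coordinates. -/
theorem truncatedDirectional_eq (hd2 : 2 ≤ d) {j g : EuclideanSpace ℝ (Fin d) → ℝ} {J : ℝ → ℝ}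
    {G : ℝ} {x e w : EuclideanSpace ℝ (Fin d)} {S : Set (EuclideanSpace ℝ (Fin d))}
    (hj : RadialProfile j J) (h : CircleData g G e w) (hS : MeasurableSet S) {r : ℝ} (hr : 0 < r) :
    truncatedDirectional (kernel g j) x w e S r =
      ∫ t in Ici r, t ^ (d - 1) * J t * circleExcess g x e w S t := by
  set A : Set (ℝ × ℝ) := {p | planePoint x e w p ∈ (ball x r)ᶜ} with hA
  have hcont : Continuous (planePoint x e w) := by unfold planePoint; fun_prop
  have hAm : MeasurableSet A := hcont.measurable measurableSet_ball.compl
  have hnull : {p : ℝ × ℝ | p.1 ≠ 0 ∧ planePoint x e w p ∈ (ball x r)ᶜ} =ᵐ[volume] A := by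
    have h0 : ∀ᵐ p : ℝ × ℝ, p.1 ≠ 0 := by
      rw [ae_iff]
      have : {p : ℝ × ℝ | ¬ p.1 ≠ 0} = {0} ×ˢ univ := by ext p; simp
      rw [this, Measure.volume_eq_prod, Measure.prod_prod, measure_singleton, zero_mul]
    filter_upwards [h0] with p hp
    exact propext ⟨fun h => h.2, fun h => ⟨hp, h⟩⟩
  rw [truncatedDirectional, setIntegral_congr_set hnull, ← integral_indicator hAm,
    ← integral_comp_polarCoord_symm]
  set k : ℝ → ℝ := (Ici r).indicator fun t => t ^ (d - 1) * J t with hk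
  have hpt : ∀ p ∈ polarCoord.target, p.1 • A.indicator (fun p : ℝ × ℝ =>
      signedIndicator S (planePoint x e w p) * |p.1| ^ (d - 2) *
        kernel g j (x - planePoint x e w p)) (polarCoord.symm p) =
      k p.1 * (signedIndicator S (x + p.1 • circlePoint e w p.2) * circleWeight g e w p.2) := by
    rintro ⟨t, α⟩ ⟨ht, -⟩
    simp only [mem_Ioi] at ht
    have hpp : planePoint x e w (polarCoord.symm (t, α)) = x + t • circlePoint e w α := by
      simp only [planePoint, polarCoord_symm_apply, circlePoint]; module
    have hn : ‖t • circlePoint e w α‖ = t := by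
      rw [norm_smul, norm_circlePoint h.norm_e h.norm_w h.inner_eq, mul_one,
        Real.norm_of_nonneg ht.le]
    have hmem : polarCoord.symm (t, α) ∈ A ↔ t ∈ Ici r := by
      rw [hA, mem_ofPred_eq, hpp, mem_compl_iff, mem_ball, dist_eq_norm, add_sub_cancel_left, hn,
        not_lt, mem_Ici]
    by_cases htr : t ∈ Ici r
    · rw [indicator_of_mem (hmem.2 htr), hpp, hk, indicator_of_mem htr]
      have h1 : x - (x + t • circlePoint e w α) = -(t • circlePoint e w α) := by abel
      rw [h1, kernel, norm_neg, hn, hj.eq _ (by rw [neg_ne_zero, ← norm_ne_zero_iff, hn]; exact ht.ne'),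
        norm_neg, hn, smul_neg, smul_smul, inv_mul_cancel₀ ht.ne', one_smul,
        h.symm _ (h.mem_sphere α), circleWeight]
      simp only [polarCoord_symm_apply, abs_mul, abs_of_pos ht, mul_pow, smul_eq_mul]
      -- The polar Jacobian `t` joins the `t^(d-2)` coming from `|ρ|^(d-2) = |t cos α|^(d-2)`.
      have h2 : t ^ (d - 1) = t * t ^ (d - 2) := by
        rw [← pow_succ', show d - 2 + 1 = d - 1 by omega]
      rw [h2]; ring
    · rw [indicator_of_notMem (fun hc => htr (hmem.1 hc)), hk, indicator_of_notMem htr]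
      simp
  rw [setIntegral_congr_fun polarCoord.open_target.measurableSet hpt, polarCoord_target,
    Measure.volume_eq_prod, setIntegral_prod]
  · simp only [integral_const_mul]
    have : ∀ t, k t * ∫ α in Ioo (-Real.pi) Real.pi,
        signedIndicator S (x + t • circlePoint e w α) * circleWeight g e w α =
        (Ici r).indicator (fun t => t ^ (d - 1) * J t * circleExcess g x e w S t) t := by
      intro t
      by_cases ht : t ∈ Ici r
      · rw [hk, indicator_of_mem ht, indicator_of_mem ht]; rfl
      · rw [hk, indicator_of_notMem ht, indicator_of_notMem ht, zero_mul]
    simp only [this]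
    rw [setIntegral_indicator measurableSet_Ici, inter_eq_right.2 (Ici_subset_Ioi.2 hr)]
  · rw [IntegrableOn, ← Measure.prod_restrict]
    have hki : IntegrableOn k (Ioi 0) :=
      (((hj.integrableOn_Ici hr).integrable_indicator measurableSet_Ici)).integrableOn
    have h3 : Integrable (fun p : ℝ × ℝ => k p.1)
        ((volume.restrict (Ioi 0)).prod (volume.restrict (Ioo (-Real.pi) Real.pi))) :=
      Integrable.comp_fst hki _
    refine h3.mul_bdd (c := G) (h.measurable_integrand hS).aestronglyMeasurable
      (Eventually.of_forall fun p => ?_)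
    exact h.abs_integrand_le _ _

end Radial

/-! ### Polar coordinates on finite-dimensional spaces. -/

section Polar

variable {E : Type*} [NormedAddCommGroup E] [NormedSpace ℝ E] [FiniteDimensional ℝ E]
  [MeasurableSpace E] [BorelSpace E]

theorem integral_polar [Nontrivial E] (μ : Measure E) [μ.IsAddHaarMeasure] (f : E → ℝ) :
    ∫ x, f x ∂μ = ∫ p : sphere (0 : E) 1 × Ioi (0 : ℝ), f ((p.2 : ℝ) • (p.1 : E))
      ∂(μ.toSphere.prod (Measure.volumeIoiPow (Module.finrank ℝ E - 1))) := by
  calc ∫ x, f x ∂μ = ∫ x : ({(0)}ᶜ : Set E), f x.1 ∂(μ.comap (↑)) := by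
        rw [integral_subtype_comap (measurableSet_singleton _).compl f,
          restrict_compl_singleton]
    _ = _ := by
        rw [← μ.measurePreserving_homeomorphUnitSphereProd.integral_comp
          (Homeomorph.measurableEmbedding _)
          (fun p : sphere (0 : E) 1 × Ioi (0 : ℝ) => f ((p.2 : ℝ) • (p.1 : E)))]
        refine integral_congr_ae (Eventually.of_forall fun x => ?_)
        have hx : ‖(x : E)‖ ≠ 0 := norm_ne_zero_iff.2 x.2
        simp [smul_smul, hx]

theorem integrable_polar (μ : Measure E) [μ.IsAddHaarMeasure] {f : E → ℝ} (hf : Integrable f μ) :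
    Integrable (fun p : sphere (0 : E) 1 × Ioi (0 : ℝ) => f ((p.2 : ℝ) • (p.1 : E)))
      (μ.toSphere.prod (Measure.volumeIoiPow (Module.finrank ℝ E - 1))) := by
  rw [← μ.measurePreserving_homeomorphUnitSphereProd.integrable_comp_emb
    (Homeomorph.measurableEmbedding _)]
  have h1 : IntegrableOn f ({(0)}ᶜ : Set E) μ := hf.integrableOn
  rw [integrableOn_iff_comap_subtypeVal (measurableSet_singleton _).compl] at h1
  refine h1.congr (Eventually.of_forall fun x => ?_)
  have hx : ‖(x : E)‖ ≠ 0 := norm_ne_zero_iff.2 x.2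
  simp [smul_smul, hx]

theorem integral_volumeIoiPow (n : ℕ) (k : ℝ → ℝ) :
    ∫ t : Ioi (0 : ℝ), k t ∂(Measure.volumeIoiPow n) = ∫ t in Ioi (0 : ℝ), t ^ n * k t := by
  simp only [Measure.volumeIoiPow, ENNReal.ofReal]
  rw [integral_withDensity_eq_integral_smul,
    integral_subtype_comap measurableSet_Ioi fun a ↦ Real.toNNReal (a ^ n) • k a,
    setIntegral_congr_fun measurableSet_Ioi fun x hx ↦ ?_]
  · rw [NNReal.smul_def, Real.coe_toNNReal _ (pow_nonneg hx.out.le _), smul_eq_mul]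
  · exact (measurable_subtype_coe.pow_const _).real_toNNReal

/-- No integrability is required, since `integral_prod_mul` for products of one-variable functions
requires none. -/
theorem integral_angular_mul_radial [Nontrivial E] (μ : Measure E) [μ.IsAddHaarMeasure] (g : E → ℝ) (k : ℝ → ℝ) :
    ∫ x, g (‖x‖⁻¹ • x) * k ‖x‖ ∂μ = (∫ θ : sphere (0 : E) 1, g θ ∂μ.toSphere) *
      ∫ t in Ioi (0 : ℝ), t ^ (Module.finrank ℝ E - 1) * k t := by
  rw [integral_polar, ← integral_volumeIoiPow, ← integral_prod_mul]
  refine integral_congr_ae (Eventually.of_forall fun p => ?_)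
  have hp : (0 : ℝ) < p.2 := p.2.2
  have hn : ‖(p.2 : ℝ) • (p.1 : E)‖ = p.2 := by
    rw [norm_smul, norm_eq_of_mem_sphere, mul_one, Real.norm_of_nonneg hp.le]
  simp only [hn, smul_smul, inv_mul_cancel₀ hp.ne', one_smul]

end Polar

/-! ### Mass of the kernels, and averages against concentrating weights. -/

section Mass

variable {d : ℕ} {j g : EuclideanSpace ℝ (Fin d) → ℝ} {J : ℝ → ℝ}

/-- The radial part of the mass of the kernel. -/
noncomputable def radialMass (d : ℕ) (J : ℝ → ℝ) (s : Set ℝ) : ℝ :=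
  ∫ t in s, t ^ (d - 1) * (min 1 t * J t)

theorem RadialProfile.min_mul_eq (hj : RadialProfile j J) (x : EuclideanSpace ℝ (Fin d)) :
    min 1 ‖x‖ * kernel g j x = g (‖x‖⁻¹ • x) * (min 1 ‖x‖ * J ‖x‖) := by
  by_cases hx : x = 0
  · simp [hx]
  · rw [kernel, hj.eq x hx]; ring

theorem RadialProfile.setIntegral_kernel_eq [NeZero d] (hj : RadialProfile j J) {R : ℝ} :
    ∫ x in (ball 0 R)ᶜ, min 1 ‖x‖ * kernel g j x =
      angularMass g * radialMass d J (Ioi 0 ∩ Ici R) := by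
  have : Nontrivial (EuclideanSpace ℝ (Fin d)) :=
    ⟨⟨EuclideanSpace.single 0 1, 0, by rw [← norm_ne_zero_iff]; simp⟩⟩
  rw [← integral_indicator measurableSet_ball.compl]
  have h1 : ∀ x : EuclideanSpace ℝ (Fin d), (ball 0 R)ᶜ.indicator
      (fun x => min 1 ‖x‖ * kernel g j x) x =
      g (‖x‖⁻¹ • x) * (Ici R).indicator (fun t => min 1 t * J t) ‖x‖ := by
    intro x
    by_cases hx : R ≤ ‖x‖
    · rw [indicator_of_mem (by simpa using hx), indicator_of_mem (mem_Ici.2 hx), hj.min_mul_eq]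
    · rw [indicator_of_notMem (by simpa using hx), indicator_of_notMem (fun h => hx (mem_Ici.1 h)), mul_zero]
  simp only [h1]
  rw [integral_angular_mul_radial, finrank_euclideanSpace_fin, angularMass, surfaceMeasure,
    radialMass]
  congr 1
  rw [← setIntegral_indicator measurableSet_Ici]
  refine integral_congr_ae (Eventually.of_forall fun t => ?_)
  by_cases ht : t ∈ Ici R
  · simp only [indicator_of_mem ht]
  · simp only [indicator_of_notMem ht, mul_zero]

theorem RadialProfile.kernelMass_eq [NeZero d] (hj : RadialProfile j J) :
    kernelMass (kernel g j) = angularMass g * radialMass d J (Ioi 0) := by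
  have h1 := hj.setIntegral_kernel_eq (g := g) (R := 0)
  rw [ball_zero, compl_empty, setIntegral_univ, inter_eq_left.2 Ioi_subset_Ici_self] at h1
  exact h1

theorem aestronglyMeasurable_angular {g : EuclideanSpace ℝ (Fin d) → ℝ}
    (hg : ContinuousOn g (sphere 0 1)) [NeZero d] :
    AEStronglyMeasurable (fun x : EuclideanSpace ℝ (Fin d) => g (‖x‖⁻¹ • x)) := by
  have : Nontrivial (EuclideanSpace ℝ (Fin d)) :=
    ⟨⟨EuclideanSpace.single 0 1, 0, by rw [← norm_ne_zero_iff]; simp⟩⟩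
  have h1 : ContinuousOn (fun x : EuclideanSpace ℝ (Fin d) => g (‖x‖⁻¹ • x)) {0}ᶜ := by
    refine hg.comp ?_ fun x hx => ?_
    · refine ContinuousOn.smul (ContinuousOn.inv₀ continuous_norm.continuousOn fun x hx => ?_)
        continuousOn_id
      exact norm_ne_zero_iff.2 hx
    · have : ‖x‖ ≠ 0 := norm_ne_zero_iff.2 hx
      simp [norm_smul, this]
  have h2 := h1.aestronglyMeasurable (μ := volume) (measurableSet_singleton _).compl
  rwa [restrict_compl_singleton] at h2

theorem abs_angular_le {g : EuclideanSpace ℝ (Fin d) → ℝ} {G : ℝ}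
    (hG : ∀ θ ∈ sphere (0 : EuclideanSpace ℝ (Fin d)) 1, |g θ| ≤ G)
    {x : EuclideanSpace ℝ (Fin d)} (hx : x ≠ 0) : |g (‖x‖⁻¹ • x)| ≤ G := by
  have : ‖x‖ ≠ 0 := norm_ne_zero_iff.2 hx
  exact hG _ (by simp [norm_smul, this])

theorem ae_ne_zero [NeZero d] : ∀ᵐ x : EuclideanSpace ℝ (Fin d), x ≠ 0 := by
  have : Nontrivial (EuclideanSpace ℝ (Fin d)) :=
    ⟨⟨EuclideanSpace.single 0 1, 0, by rw [← norm_ne_zero_iff]; simp⟩⟩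
  exact compl_mem_ae_iff.2 (measure_singleton 0)

theorem integrable_min_mul_kernel [NeZero d] (hg : ContinuousOn g (sphere 0 1)) {G : ℝ}
    (hG : ∀ θ ∈ sphere (0 : EuclideanSpace ℝ (Fin d)) 1, |g θ| ≤ G)
    (hint : Integrable (fun x => min 1 ‖x‖ * j x)) :
    Integrable (fun x => min 1 ‖x‖ * kernel g j x) := by
  refine (hint.bdd_mul (c := G) (aestronglyMeasurable_angular hg) ?_).congr
    (Eventually.of_forall fun x => ?_)
  · filter_upwards [ae_ne_zero] with x hx using abs_angular_le hG hx
  · simp only [kernel]; ring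

/-- The angular mass cancels, so concentration of `λ_φ` is a condition on the radial profile alone.
-/
theorem RadialProfile.kernelMeasure_compl_ball [NeZero d] (hj : RadialProfile j J)
    (hg : ContinuousOn g (sphere 0 1)) {G : ℝ}
    (hG : ∀ θ ∈ sphere (0 : EuclideanSpace ℝ (Fin d)) 1, |g θ| ≤ G)
    (hg0 : ∀ θ ∈ sphere (0 : EuclideanSpace ℝ (Fin d)) 1, 0 ≤ g θ) (hj0 : ∀ x, 0 ≤ j x)
    (hint : Integrable (fun x => min 1 ‖x‖ * j x)) (hCg : 0 < angularMass g)
    (hI : 0 < radialMass d J (Ioi 0)) {R : ℝ} (hR : 0 < R) :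
    kernelMeasure (kernel g j) (ball 0 R)ᶜ =
      ENNReal.ofReal (radialMass d J (Ici R) / radialMass d J (Ioi 0)) := by
  rw [kernelMeasure, withDensity_apply _ measurableSet_ball.compl,
    ← ofReal_integral_eq_lintegral_ofReal
      ((integrable_min_mul_kernel hg hG hint).integrableOn.const_mul _), integral_const_mul,
    hj.setIntegral_kernel_eq, hj.kernelMass_eq, inter_eq_right.2 (Ici_subset_Ioi.2 hR)]
  · congr 1
    field_simp
  · have h0 : 0 ≤ (kernelMass (kernel g j))⁻¹ := by
      rw [hj.kernelMass_eq]; positivity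
    refine ae_restrict_of_ae ?_
    filter_upwards [ae_ne_zero] with x hx
    have h1 : 0 ≤ kernel g j x := by
      have : ‖x‖ ≠ 0 := norm_ne_zero_iff.2 hx
      exact mul_nonneg (hg0 _ (by simp [norm_smul, this])) (hj0 x)
    simp only [Pi.zero_apply]
    positivity

/-- Monotonicity spreads positivity at one point `x₀` to all radii in `(0, ‖x₀‖]`. -/
theorem RadialProfile.radialMass_pos (hj : RadialProfile j J)
    (hmono : RadiallyNonincreasing j) (hpos : ∃ x, x ≠ 0 ∧ 0 < j x) :
    0 < radialMass d J (Ioi 0) := by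
  obtain ⟨x₀, hx₀, hjx₀⟩ := hpos
  have hn := norm_pos_iff.2 hx₀
  have hJ : ∀ t ∈ Ioc 0 ‖x₀‖, 0 < J t := by
    intro t ht
    have h1 : ‖(t / ‖x₀‖) • x₀‖ = t := by
      rw [norm_smul, Real.norm_of_nonneg (by have := ht.1; positivity), div_mul_cancel₀ _ hn.ne']
    have h2 : (t / ‖x₀‖) • x₀ ≠ 0 := by
      rw [← norm_ne_zero_iff, h1]; exact ht.1.ne'
    have h3 := hmono _ x₀ h2 (by rw [h1]; exact ht.2)
    rw [hj.eq _ h2, h1] at h3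
    linarith
  have h0 : 0 ≤ᵐ[volume.restrict (Ioi 0)] fun t => t ^ (d - 1) * (min 1 t * J t) := by
    filter_upwards [ae_restrict_mem measurableSet_Ioi] with t ht
    have ht0 : 0 < t := ht
    have := hj.nonneg t
    simp only [Pi.zero_apply]
    positivity
  rw [radialMass, setIntegral_pos_iff_support_of_nonneg_ae h0 hj.integrable]
  refine lt_of_lt_of_le ?_ (measure_mono (s := Ioc 0 ‖x₀‖) fun t ht => ⟨?_, ht.1⟩)
  · rw [Real.volume_Ioc]; simpa using hx₀
  · have h1 := hJ t ht
    have h2 : 0 < t := ht.1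
    rw [Function.mem_support]
    positivity

/-- Below `R` the integrand is within `η/2` of `L`, uniformly in large `n`; above `R` the deviation
`M + |L|` is multiplied by a vanishing fraction of the mass. -/
theorem tendsto_weighted_average {m h : ℕ → ℝ → ℝ} {L M : ℝ}
    (hm : ∀ n, IntegrableOn (m n) (Ioi 0)) (hm0 : ∀ n, ∀ t > 0, 0 ≤ m n t)
    (hI : ∀ n, 0 < ∫ t in Ioi 0, m n t)
    (hconc : ∀ R > 0, Tendsto (fun n => (∫ t in Ici R, m n t) / ∫ t in Ioi 0, m n t) atTop (𝓝 0))
    (hh : ∀ᶠ n in atTop, Measurable (h n)) (hb : ∀ᶠ n in atTop, ∀ t > 0, |h n t| ≤ M)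
    (hlim : ∀ η > 0, ∃ R > 0, ∀ᶠ n in atTop, ∀ t > 0, t < R → |h n t - L| ≤ η) :
    Tendsto (fun n => (∫ t in Ioi 0, m n t * h n t) / ∫ t in Ioi 0, m n t) atTop (𝓝 L) := by
  rw [Metric.tendsto_nhds]
  intro η hη
  obtain ⟨R, hR, hRn⟩ := hlim (η / 2) (by positivity)
  have hM0 : 0 ≤ M := by
    obtain ⟨n, hn⟩ := hb.exists
    exact (abs_nonneg _).trans (hn 1 one_pos)
  have hc : Tendsto (fun n => (M + |L|) * ((∫ t in Ici R, m n t) / ∫ t in Ioi 0, m n t)) atTop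
      (𝓝 0) := by simpa using (hconc R hR).const_mul (M + |L|)
  filter_upwards [hh, hb, hRn, hc.eventually (gt_mem_nhds (by positivity : 0 < η / 2))]
    with n h1 h2 h3 h4
  have hsub : Ici R ⊆ Ioi (0 : ℝ) := Ici_subset_Ioi.2 hR
  have hmh : IntegrableOn (fun t => m n t * h n t) (Ioi 0) := by
    refine (hm n).mul_bdd (c := M) h1.aestronglyMeasurable ?_
    filter_upwards [ae_restrict_mem measurableSet_Ioi] with t ht using h2 t ht
  have hmR : IntegrableOn ((Ici R).indicator (m n)) (Ioi 0) :=
    (hm n).indicator measurableSet_Ici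
  have key : |(∫ t in Ioi 0, m n t * h n t) - (∫ t in Ioi 0, m n t) * L| ≤
      η / 2 * (∫ t in Ioi 0, m n t) + (M + |L|) * ∫ t in Ici R, m n t := by
    rw [← integral_mul_const, ← integral_sub hmh ((hm n).mul_const L), ← integral_const_mul,
      ← integral_const_mul, ← inter_eq_right.2 hsub, ← setIntegral_indicator measurableSet_Ici,
      ← integral_add ((hm n).const_mul _) (by
        refine ((hm n).const_mul (M + |L|)).indicator measurableSet_Ici)]
    rw [← Real.norm_eq_abs]
    refine norm_integral_le_of_norm_le (((hm n).const_mul _).add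
      (((hm n).const_mul (M + |L|)).indicator measurableSet_Ici)) ?_
    filter_upwards [ae_restrict_mem measurableSet_Ioi] with t ht
    have hmt := hm0 n t ht
    rw [← mul_sub, Real.norm_eq_abs, abs_mul, abs_of_nonneg hmt]
    by_cases htR : t ∈ Ici R
    · rw [indicator_of_mem htR]
      have : |h n t - L| ≤ M + |L| := (abs_sub _ _).trans (by linarith [h2 t ht])
      nlinarith [mul_le_mul_of_nonneg_left this hmt]
    · rw [indicator_of_notMem htR]
      have := h3 t ht (not_le.1 htR)
      nlinarith [mul_le_mul_of_nonneg_left this hmt]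
  have hIn := hI n
  rw [Real.dist_eq]
  have h5 : (∫ t in Ioi 0, m n t * h n t) / (∫ t in Ioi 0, m n t) - L =
      ((∫ t in Ioi 0, m n t * h n t) - (∫ t in Ioi 0, m n t) * L) / ∫ t in Ioi 0, m n t := by
    field_simp
  rw [h5, abs_div, abs_of_pos hIn, div_lt_iff₀ hIn]
  refine key.trans_lt ?_
  rw [← mul_div_assoc, div_lt_iff₀ hIn] at h4
  linarith

end Mass

/-! ### Cylindrical coordinates around the normal axis. -/

section Cylinder

variable {d : ℕ}

theorem measurePreserving_prod_isometry {U W : Type*} [NormedAddCommGroup U]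
    [InnerProductSpace ℝ U] [FiniteDimensional ℝ U] [MeasurableSpace U] [BorelSpace U]
    [NormedAddCommGroup W] [InnerProductSpace ℝ W] [FiniteDimensional ℝ W] [MeasurableSpace W]
    [BorelSpace W] (φ : ℝ ≃ₗᵢ[ℝ] U) :
    MeasurePreserving (fun p : W × ℝ => (φ p.2, p.1)) (volume.prod volume) (volume.prod volume) := by
  have h1 : MeasurePreserving (Prod.swap : W × ℝ → ℝ × W)
      (volume.prod volume) (volume.prod volume) := Measure.measurePreserving_swap
  have h2 : MeasurePreserving (Prod.map φ (id : W → W)) (volume.prod volume)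
      (volume.prod volume) := φ.measurePreserving.prod (MeasurePreserving.id _)
  exact h2.comp h1

theorem measurePreserving_add_orthogonal {V : Type*} [NormedAddCommGroup V]
    [InnerProductSpace ℝ V] [FiniteDimensional ℝ V] [MeasurableSpace V] [BorelSpace V]
    (K : Submodule ℝ V) :
    MeasurePreserving (fun p : K × Kᗮ => (p.1 : V) + p.2) (volume.prod volume) volume := by
  have h := K.orthogonalDecomposition.symm.measurePreserving.comp (WithLp.volume_preserving_toLp K Kᗮ)
  have heq : (fun p : K × Kᗮ => (p.1 : V) + p.2) =
      K.orthogonalDecomposition.symm ∘ WithLp.toLp 2 := by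
    funext p
    simp
  rw [heq]
  exact h

theorem measurePreserving_cylinder {ν : EuclideanSpace ℝ (Fin d)} (hν : ‖ν‖ = 1) :
    MeasurePreserving (fun p : (ℝ ∙ ν)ᗮ × ℝ => (p.1 : EuclideanSpace ℝ (Fin d)) + p.2 • ν)
      (volume.prod volume) volume := by
  have h := (measurePreserving_add_orthogonal (ℝ ∙ ν)).comp
    (measurePreserving_prod_isometry (W := (ℝ ∙ ν)ᗮ)
      (LinearIsometryEquiv.toSpanUnitSingleton ν hν))
  convert h using 1
  funext p
  rw [Function.comp_apply, LinearIsometryEquiv.toSpanUnitSingleton_apply, add_comm]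

theorem finrank_orthogonal_unit {ν : EuclideanSpace ℝ (Fin d)} (hν : ‖ν‖ = 1) :
    Module.finrank ℝ (ℝ ∙ ν)ᗮ = d - 1 := by
  have h1 := (ℝ ∙ ν).finrank_add_finrank_orthogonal
  have h2 : Module.finrank ℝ (ℝ ∙ ν) = 1 :=
    finrank_span_singleton (by rw [← norm_ne_zero_iff, hν]; norm_num)
  rw [h2, finrank_euclideanSpace_fin] at h1
  omega

theorem nontrivial_orthogonal_unit (hd : 2 ≤ d) {ν : EuclideanSpace ℝ (Fin d)} (hν : ‖ν‖ = 1) :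
    Nontrivial (ℝ ∙ ν)ᗮ :=
  Module.nontrivial_of_finrank_pos (R := ℝ) (by rw [finrank_orthogonal_unit hν]; omega)

/-- Integration in cylindrical coordinates around the axis `ν`, symmetrized in `ν^⊥`. -/
theorem integral_cylinder (hd : 2 ≤ d) {ν : EuclideanSpace ℝ (Fin d)} (hν : ‖ν‖ = 1)
    {F : EuclideanSpace ℝ (Fin d) → ℝ} (hF : Integrable F) :
    Integrable (fun θ : sphere (0 : (ℝ ∙ ν)ᗮ) 1 => ∫ ρ in Ioi (0 : ℝ), ρ ^ (d - 2) *
      ((∫ h : ℝ, F (ρ • ((θ : (ℝ ∙ ν)ᗮ) : EuclideanSpace ℝ (Fin d)) + h • ν)) +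
        ∫ h : ℝ, F ((-ρ) • ((θ : (ℝ ∙ ν)ᗮ) : EuclideanSpace ℝ (Fin d)) + h • ν)))
      (surfaceMeasure (ℝ ∙ ν)ᗮ) ∧
    ∫ y, F y = 1 / 2 * ∫ θ : sphere (0 : (ℝ ∙ ν)ᗮ) 1, (∫ ρ in Ioi (0 : ℝ), ρ ^ (d - 2) *
      ((∫ h : ℝ, F (ρ • ((θ : (ℝ ∙ ν)ᗮ) : EuclideanSpace ℝ (Fin d)) + h • ν)) +
        ∫ h : ℝ, F ((-ρ) • ((θ : (ℝ ∙ ν)ᗮ) : EuclideanSpace ℝ (Fin d)) + h • ν)))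
      ∂(surfaceMeasure (ℝ ∙ ν)ᗮ) := by
  have := nontrivial_orthogonal_unit hd hν
  have hmp := measurePreserving_cylinder hν
  have hFL := (hmp.integrable_comp hF.aestronglyMeasurable).2 hF
  set q : (ℝ ∙ ν)ᗮ → ℝ := fun a => ∫ h : ℝ, F ((a : EuclideanSpace ℝ (Fin d)) + h • ν) with hq
  have hqi : Integrable q := hFL.integral_prod_left
  -- A direction `θ` sees only a half-plane. Adding the value at `-a` completes it to the whole
  -- plane of `θ` and `ν`, and since `θ` and `-θ` share that plane a factor `1/2` appears.
  set Q : (ℝ ∙ ν)ᗮ → ℝ := fun a => q a + q (-a) with hQ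
  have hQi : Integrable Q := hqi.add hqi.comp_neg
  have hFq : ∫ y, F y = ∫ a, q a := by
    have h1 : ∫ y, F y = ∫ p : (ℝ ∙ ν)ᗮ × ℝ, F ((p.1 : EuclideanSpace ℝ (Fin d)) + p.2 • ν)
        ∂(volume.prod volume) := by
      conv_lhs => rw [← hmp.map_eq]
      rw [integral_map hmp.measurable.aemeasurable (by rw [hmp.map_eq]; exact hF.aestronglyMeasurable)]
    rw [h1]; exact integral_prod _ hFL
  have hFQ : ∫ y, F y = 1 / 2 * ∫ a, Q a := by
    rw [hQ, integral_add hqi hqi.comp_neg, integral_neg_eq_self, ← hFq]; ring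
  have hpol := integrable_polar volume hQi
  have hrad : ∀ θ : sphere (0 : (ℝ ∙ ν)ᗮ) 1,
      ∫ ρ : Ioi (0 : ℝ), Q ((ρ : ℝ) • (θ : (ℝ ∙ ν)ᗮ))
        ∂(Measure.volumeIoiPow (Module.finrank ℝ (ℝ ∙ ν)ᗮ - 1)) =
      ∫ ρ in Ioi (0 : ℝ), ρ ^ (d - 2) *
      ((∫ h : ℝ, F (ρ • ((θ : (ℝ ∙ ν)ᗮ) : EuclideanSpace ℝ (Fin d)) + h • ν)) +
        ∫ h : ℝ, F ((-ρ) • ((θ : (ℝ ∙ ν)ᗮ) : EuclideanSpace ℝ (Fin d)) + h • ν)) := by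
    intro θ
    rw [integral_volumeIoiPow _ (fun ρ => Q (ρ • (θ : (ℝ ∙ ν)ᗮ))), finrank_orthogonal_unit hν,
      show d - 1 - 1 = d - 2 by omega]
    simp only [hQ, hq, Submodule.coe_neg, Submodule.coe_smul, neg_smul]
  refine ⟨(hpol.integral_prod_left).congr (Eventually.of_forall hrad), ?_⟩
  rw [hFQ, integral_polar, integral_prod _ hpol]
  simp only [hrad]
  rfl

end Cylinder

/-! ### Mean curvature as an average of directional curvatures. -/

section Mean

variable {d : ℕ} {j g : EuclideanSpace ℝ (Fin d) → ℝ} {J : ℝ → ℝ} {G : ℝ}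
  {x : EuclideanSpace ℝ (Fin d)} {S : Set (EuclideanSpace ℝ (Fin d))}

/-- The integrand of the truncated nonlocal mean curvature, centred at the origin. -/
noncomputable def meanIntegrand (g j : EuclideanSpace ℝ (Fin d) → ℝ)
    (x : EuclideanSpace ℝ (Fin d)) (S : Set (EuclideanSpace ℝ (Fin d))) (r : ℝ) :
    EuclideanSpace ℝ (Fin d) → ℝ :=
  (ball 0 r)ᶜ.indicator fun y => signedIndicator S (x + y) * kernel g j (-y)

theorem truncatedMean_eq_integral (r : ℝ) :
    truncatedMean (kernel g j) x S r = ∫ y, meanIntegrand g j x S r y := by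
  rw [truncatedMean, ← integral_indicator measurableSet_ball.compl,
    ← integral_add_left_eq_self _ x]
  refine integral_congr_ae (Eventually.of_forall fun y => ?_)
  simp only [meanIntegrand, indicator, mem_compl_iff, mem_ball, dist_self_add_left, dist_zero_right,
    sub_add_cancel_left]

/-- As `g` is controlled only on the sphere, it is cut off there: this form is Borel measurable
everywhere, hence on each single plane, where almost-everywhere information on `ℝ^d` would be
useless. -/
theorem meanIntegrand_eq (hj : RadialProfile j J)
    (hgs : ∀ θ ∈ sphere (0 : EuclideanSpace ℝ (Fin d)) 1, g (-θ) = g θ) {r : ℝ} (hr : 0 < r)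
    (y : EuclideanSpace ℝ (Fin d)) :
    meanIntegrand g j x S r y = (sphere (0 : EuclideanSpace ℝ (Fin d)) 1).indicator g (‖y‖⁻¹ • y) *
      (signedIndicator S (x + y) * (Ici r).indicator J ‖y‖) := by
  by_cases hy : r ≤ ‖y‖
  · have hn : 0 < ‖y‖ := hr.trans_le hy
    have hmem : ‖y‖⁻¹ • y ∈ sphere (0 : EuclideanSpace ℝ (Fin d)) 1 := by
      simp [norm_smul, hn.ne']
    rw [meanIntegrand, indicator_of_mem (by simpa using hy), indicator_of_mem hmem,
      indicator_of_mem (mem_Ici.2 hy), kernel, norm_neg, smul_neg, hgs _ hmem,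
      hj.eq _ (neg_ne_zero.2 (norm_pos_iff.1 hn)), norm_neg]
    ring
  · rw [meanIntegrand, indicator_of_notMem (by simpa using hy),
      indicator_of_notMem (fun h => hy (mem_Ici.1 h)), mul_zero, mul_zero]

theorem measurable_meanIntegrand (hj : RadialProfile j J) (hg : ContinuousOn g (sphere 0 1))
    (hgs : ∀ θ ∈ sphere (0 : EuclideanSpace ℝ (Fin d)) 1, g (-θ) = g θ) (hS : MeasurableSet S)
    {r : ℝ} (hr : 0 < r) : Measurable (meanIntegrand g j x S r) := by
  have hgm : Measurable ((sphere (0 : EuclideanSpace ℝ (Fin d)) 1).indicator g) := by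
    classical
    rw [← piecewise_eq_indicator]
    exact hg.measurable_piecewise continuousOn_const isClosed_sphere.measurableSet
  rw [funext (meanIntegrand_eq hj hgs hr)]
  refine Measurable.mul (hgm.comp (by fun_prop)) (Measurable.mul ?_ ?_)
  · exact (measurable_signedIndicator hS).comp (by fun_prop)
  · exact (hj.meas.indicator measurableSet_Ici).comp measurable_norm

theorem abs_meanIntegrand_le (hj : RadialProfile j J)
    (hgs : ∀ θ ∈ sphere (0 : EuclideanSpace ℝ (Fin d)) 1, g (-θ) = g θ)
    (hG : ∀ θ ∈ sphere (0 : EuclideanSpace ℝ (Fin d)) 1, |g θ| ≤ G) (hG0 : 0 ≤ G) {r : ℝ}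
    (hr : 0 < r) (y : EuclideanSpace ℝ (Fin d)) :
    |meanIntegrand g j x S r y| ≤ G * (Ici r).indicator J ‖y‖ := by
  have hJ : 0 ≤ (Ici r).indicator J ‖y‖ := indicator_nonneg (fun t _ => hj.nonneg t) _
  rw [meanIntegrand_eq hj hgs hr, abs_mul, abs_mul, abs_of_nonneg hJ]
  have h1 : |(sphere (0 : EuclideanSpace ℝ (Fin d)) 1).indicator g (‖y‖⁻¹ • y)| ≤ G := by
    by_cases hy : ‖y‖⁻¹ • y ∈ sphere (0 : EuclideanSpace ℝ (Fin d)) 1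
    · rw [indicator_of_mem hy]; exact hG _ hy
    · rw [indicator_of_notMem hy, abs_zero]; exact hG0
  exact mul_le_mul h1 (mul_le_of_le_one_left hJ (abs_signedIndicator_le _ _)) (by positivity) hG0

theorem integrable_meanIntegrand [NeZero d] (hj : RadialProfile j J)
    (hg : ContinuousOn g (sphere 0 1))
    (hgs : ∀ θ ∈ sphere (0 : EuclideanSpace ℝ (Fin d)) 1, g (-θ) = g θ)
    (hG : ∀ θ ∈ sphere (0 : EuclideanSpace ℝ (Fin d)) 1, |g θ| ≤ G) (hG0 : 0 ≤ G)
    (hS : MeasurableSet S) {r : ℝ} (hr : 0 < r) : Integrable (meanIntegrand g j x S r) := by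
  have : Nontrivial (EuclideanSpace ℝ (Fin d)) :=
    ⟨⟨EuclideanSpace.single 0 1, 0, by rw [← norm_ne_zero_iff]; simp⟩⟩
  have h1 : Integrable fun y : EuclideanSpace ℝ (Fin d) => (Ici r).indicator J ‖y‖ := by
    rw [integrable_fun_norm_addHaar, finrank_euclideanSpace_fin]
    have h2 := ((hj.integrableOn_Ici hr).integrable_indicator measurableSet_Ici).integrableOn
      (s := Ioi 0)
    refine h2.congr (Eventually.of_forall fun t => ?_)
    by_cases ht : t ∈ Ici r
    · simp only [indicator_of_mem ht, smul_eq_mul]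
    · simp only [indicator_of_notMem ht, smul_zero]
  exact (h1.const_mul G).mono' (measurable_meanIntegrand hj hg hgs hS hr).aestronglyMeasurable
    (Eventually.of_forall fun y => abs_meanIntegrand_le hj hgs hG hG0 hr y)

/-- In polar coordinates the integrand is dominated by `G t^(d-1) J(t)` on `t ≥ r`. This justifies
Fubini in the coordinates `(ρ, h)` for every direction, not merely almost every one. -/
theorem integrable_plane_meanIntegrand (hd : 2 ≤ d) (hj : RadialProfile j J)
    {e w : EuclideanSpace ℝ (Fin d)} (h : CircleData g G e w) (hS : MeasurableSet S) {r : ℝ}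
    (hr : 0 < r) :
    Integrable fun p : ℝ × ℝ => |p.1| ^ (d - 2) * meanIntegrand g j x S r (p.1 • e + p.2 • w) := by
  have hm : Measurable fun p : ℝ × ℝ =>
      |p.1| ^ (d - 2) * meanIntegrand g j x S r (p.1 • e + p.2 • w) :=
    Measurable.mul (by fun_prop) ((measurable_meanIntegrand hj h.cont h.symm hS hr).comp
      (by fun_prop))
  refine ⟨hm.aestronglyMeasurable, ?_⟩
  rw [hasFiniteIntegral_iff_enorm, ← lintegral_comp_polarCoord_symm, polarCoord_target,
    Measure.volume_eq_prod, ← Measure.prod_restrict]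
  set k : ℝ → ℝ := (Ici r).indicator fun t => t ^ (d - 1) * J t with hk
  have hki : IntegrableOn k (Ioi 0) :=
    (((hj.integrableOn_Ici hr).integrable_indicator measurableSet_Ici)).integrableOn
  have h3 : Integrable (fun p : ℝ × ℝ => G * k p.1)
      ((volume.restrict (Ioi 0)).prod (volume.restrict (Ioo (-Real.pi) Real.pi))) :=
    (Integrable.comp_fst hki _).const_mul G
  refine lt_of_le_of_lt (lintegral_mono_ae ?_) h3.hasFiniteIntegral
  rw [Measure.prod_restrict]
  filter_upwards [ae_restrict_mem (measurableSet_Ioi.prod measurableSet_Ioo)] with p hp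
  have ht : 0 < p.1 := hp.1
  rw [smul_eq_mul, ← Real.enorm_of_nonneg ht.le, ← enorm_mul, enorm_le_iff_norm_le]
  rw [polarCoord_symm_apply, Real.norm_eq_abs, Real.norm_eq_abs, abs_mul, abs_mul, abs_of_pos ht]
  have hn : ‖(p.1 * Real.cos p.2) • e + (p.1 * Real.sin p.2) • w‖ = p.1 := by
    rw [norm_smul_add_smul h.norm_e h.norm_w h.inner_eq]
    have : (p.1 * Real.cos p.2) ^ 2 + (p.1 * Real.sin p.2) ^ 2 = p.1 ^ 2 := by
      have := Real.cos_sq_add_sin_sq p.2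
      calc _ = p.1 ^ 2 * (Real.cos p.2 ^ 2 + Real.sin p.2 ^ 2) := by ring
        _ = _ := by rw [this, mul_one]
    rw [this, Real.sqrt_sq ht.le]
  have h4 := abs_meanIntegrand_le (x := x) (S := S) hj h.symm h.bound h.bound_nonneg hr
    ((p.1 * Real.cos p.2) • e + (p.1 * Real.sin p.2) • w)
  rw [hn] at h4
  have h5 : |(|p.1 * Real.cos p.2| ^ (d - 2))| ≤ p.1 ^ (d - 2) := by
    rw [abs_of_nonneg (by positivity), abs_mul, abs_of_pos ht]
    gcongr
    exact mul_le_of_le_one_right ht.le (Real.abs_cos_le_one _)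
  have hJ : 0 ≤ (Ici r).indicator J p.1 := indicator_nonneg (fun t _ => hj.nonneg t) _
  have hkp : k p.1 = p.1 * (p.1 ^ (d - 2) * (Ici r).indicator J p.1) := by
    have h2 : p.1 ^ (d - 1) = p.1 * p.1 ^ (d - 2) := by
      rw [← pow_succ', show d - 2 + 1 = d - 1 by omega]
    by_cases htr : p.1 ∈ Ici r
    · rw [hk, indicator_of_mem htr, indicator_of_mem htr, h2]; ring
    · rw [hk, indicator_of_notMem htr, indicator_of_notMem htr]; ring
  have hG := h.bound_nonneg
  calc _ ≤ p.1 * (p.1 ^ (d - 2) * (G * (Ici r).indicator J p.1)) := by gcongr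
    _ = G * k p.1 := by rw [hkp]; ring
    _ ≤ |G * k p.1| := le_abs_self _

/-- The same integral in the iterated form that `integral_cylinder` yields, with `ρ` and `-ρ`
grouped. -/
theorem truncatedDirectional_eq_half_planes (hd : 2 ≤ d) (hj : RadialProfile j J)
    {e w : EuclideanSpace ℝ (Fin d)} (h : CircleData g G e w) (hS : MeasurableSet S) {r : ℝ}
    (hr : 0 < r) :
    truncatedDirectional (kernel g j) x w e S r = ∫ ρ in Ioi (0 : ℝ), ρ ^ (d - 2) *
      ((∫ h : ℝ, meanIntegrand g j x S r (ρ • e + h • w)) +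
        ∫ h : ℝ, meanIntegrand g j x S r ((-ρ) • e + h • w)) := by
  have hint := integrable_plane_meanIntegrand (x := x) hd hj h hS hr
  have h1 : truncatedDirectional (kernel g j) x w e S r = ∫ p : ℝ × ℝ,
      |p.1| ^ (d - 2) * meanIntegrand g j x S r (p.1 • e + p.2 • w) := by
    have hcont : Continuous (planePoint x e w) := by unfold planePoint; fun_prop
    have hA : MeasurableSet {p : ℝ × ℝ | p.1 ≠ 0 ∧ planePoint x e w p ∈ (ball x r)ᶜ} :=
      ((measurableSet_singleton (0 : ℝ)).compl.preimage measurable_fst).inter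
        (hcont.measurable measurableSet_ball.compl)
    rw [truncatedDirectional, ← integral_indicator hA]
    have h0 : ∀ᵐ p : ℝ × ℝ, p.1 ≠ 0 := by
      rw [ae_iff]
      have : {p : ℝ × ℝ | ¬ p.1 ≠ 0} = {0} ×ˢ univ := by ext p; simp
      rw [this, Measure.volume_eq_prod, Measure.prod_prod, measure_singleton, zero_mul]
    refine integral_congr_ae ?_
    filter_upwards [h0] with p hp
    have hpp : planePoint x e w p = x + (p.1 • e + p.2 • w) := by rw [planePoint, add_assoc]
    by_cases hmem : planePoint x e w p ∈ (ball x r)ᶜ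
    · have hm' : p.1 • e + p.2 • w ∈ (ball (0 : EuclideanSpace ℝ (Fin d)) r)ᶜ := by
        rw [hpp] at hmem; simpa using hmem
      rw [indicator_of_mem (show p ∈ {p : ℝ × ℝ | p.1 ≠ 0 ∧ planePoint x e w p ∈ (ball x r)ᶜ} from
        ⟨hp, hmem⟩), meanIntegrand, indicator_of_mem hm', hpp, sub_add_cancel_left]
      ring
    · have hm' : p.1 • e + p.2 • w ∉ (ball (0 : EuclideanSpace ℝ (Fin d)) r)ᶜ := by
        rw [hpp] at hmem; simpa using hmem
      rw [indicator_of_notMem (fun hc => hmem hc.2), meanIntegrand, indicator_of_notMem hm', mul_zero]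
  rw [h1, Measure.volume_eq_prod, integral_prod _ hint]
  simp only [integral_const_mul]
  have hI : Integrable fun ρ : ℝ => |ρ| ^ (d - 2) * ∫ h : ℝ,
      meanIntegrand g j x S r (ρ • e + h • w) := by
    have := hint.integral_prod_left
    simpa only [integral_const_mul] using this
  rw [← intervalIntegral.integral_Iic_add_Ioi (b := 0) hI.integrableOn hI.integrableOn]
  have h2 := integral_comp_neg_Ioi (0 : ℝ) fun ρ : ℝ => |ρ| ^ (d - 2) * ∫ h : ℝ,
      meanIntegrand g j x S r (ρ • e + h • w)
  rw [neg_zero] at h2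
  rw [← h2, ← integral_add hI.comp_neg.integrableOn hI.integrableOn]
  refine setIntegral_congr_fun measurableSet_Ioi fun ρ hρ => ?_
  simp only [abs_neg, abs_of_pos (mem_Ioi.1 hρ)]
  ring

/-- The nonlocal mean curvature is an average of directional curvatures. -/
theorem truncatedMean_eq_average (hd : 2 ≤ d) (hj : RadialProfile j J)
    (hg : ContinuousOn g (sphere 0 1))
    (hgs : ∀ θ ∈ sphere (0 : EuclideanSpace ℝ (Fin d)) 1, g (-θ) = g θ)
    (hG : ∀ θ ∈ sphere (0 : EuclideanSpace ℝ (Fin d)) 1, |g θ| ≤ G) (hG0 : 0 ≤ G)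
    (hS : MeasurableSet S) {ν : EuclideanSpace ℝ (Fin d)} (hν : ‖ν‖ = 1) {r : ℝ} (hr : 0 < r) :
    Integrable (fun θ : sphere (0 : (ℝ ∙ ν)ᗮ) 1 =>
      truncatedDirectional (kernel g j) x ν (θ : (ℝ ∙ ν)ᗮ) S r) (surfaceMeasure (ℝ ∙ ν)ᗮ) ∧
    truncatedMean (kernel g j) x S r = 1 / 2 * ∫ θ : sphere (0 : (ℝ ∙ ν)ᗮ) 1,
      truncatedDirectional (kernel g j) x ν (θ : (ℝ ∙ ν)ᗮ) S r ∂(surfaceMeasure (ℝ ∙ ν)ᗮ) := by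
  have : NeZero d := ⟨by omega⟩
  have h1 := integral_cylinder hd hν (integrable_meanIntegrand (x := x) hj hg hgs hG hG0 hS hr)
  have h2 : ∀ θ : sphere (0 : (ℝ ∙ ν)ᗮ) 1, CircleData g G ((θ : (ℝ ∙ ν)ᗮ) :
      EuclideanSpace ℝ (Fin d)) ν := fun θ =>
    ⟨hg, hgs, hG, (norm_eq_of_mem_sphere θ : ‖(θ : (ℝ ∙ ν)ᗮ)‖ = 1), hν,
      (Submodule.mem_orthogonal_singleton_iff_inner_left.1 (θ : (ℝ ∙ ν)ᗮ).2)⟩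
  simp only [fun θ => truncatedDirectional_eq_half_planes (x := x) hd hj (h2 θ) hS hr]
  rw [truncatedMean_eq_integral]
  exact h1

end Mean

/-! ### Existence of the principal values. -/

section Limits

variable {d : ℕ} {j g : EuclideanSpace ℝ (Fin d) → ℝ} {J : ℝ → ℝ} {G : ℝ}
  {x : EuclideanSpace ℝ (Fin d)} {S : Set (EuclideanSpace ℝ (Fin d))}
  {p : EuclideanSpace ℝ (Fin d) →L[ℝ] ℝ} {q : EuclideanSpace ℝ (Fin d) → ℝ} {R K : ℝ}

theorem SecondOrderContact.mono {δ R' : ℝ} (h : SecondOrderContact S x p q δ R) (hR : R' ≤ R) :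
    SecondOrderContact S x p q δ R' := fun v hv => h v (hv.trans hR)

/-- The condition forcing a point outside `S` is open, so no point of `S` can approach it. Halving
the radius keeps the approximating points within `R`. -/
theorem SecondOrderContact.closure {δ : ℝ} (h : SecondOrderContact S x p q δ R) (hR : 0 < R)
    (hq : Continuous q) : SecondOrderContact (closure S) x p q δ (R / 2) := by
  intro v hv
  refine ⟨fun h1 => subset_closure ((h v (by linarith)).1 h1), fun h1 hmem => ?_⟩
  have hc : Continuous fun y => p (y - x) + q (y - x) - δ * ‖y - x‖ ^ 2 := by fun_prop
  have hc' : Continuous fun y => ‖y - x‖ := by fun_prop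
  have h2 : ∀ᶠ y in 𝓝 (x + v), 0 < p (y - x) + q (y - x) - δ * ‖y - x‖ ^ 2 :=
    (hc.tendsto _).eventually (lt_mem_nhds (by simpa using h1))
  have h3 : ∀ᶠ y in 𝓝 (x + v), ‖y - x‖ < R :=
    (hc'.tendsto _).eventually (gt_mem_nhds (by rw [add_sub_cancel_left]; linarith))
  obtain ⟨y, hy, hyS⟩ := (mem_closure_iff_frequently.1 hmem).and_eventually (h2.and h3) |>.exists
  have := (h (y - x) hyS.2.le).2 hyS.1
  rw [add_sub_cancel] at this
  exact this hy

/-- The limit of the truncated directional integrals. -/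
noncomputable def directionalIntegral (g : EuclideanSpace ℝ (Fin d) → ℝ) (J : ℝ → ℝ)
    (x e w : EuclideanSpace ℝ (Fin d)) (S : Set (EuclideanSpace ℝ (Fin d))) : ℝ :=
  ∫ t in Ioi 0, t ^ (d - 1) * J t * circleExcess g x e w S t

/-- The second bound is independent of `r` and of the direction, which is what dominated convergence
over the sphere requires. -/
theorem tendsto_truncatedDirectional (hd : 2 ≤ d) (hj : RadialProfile j J)
    {e w : EuclideanSpace ℝ (Fin d)} (h : CircleData g G e w) (hS : MeasurableSet S)
    (hc : SecondOrderContact S x p q 1 R) (hR : 0 < R) (hq : ∀ (t : ℝ) v, q (t • v) = t ^ 2 * q v)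
    (hK0 : 0 ≤ K) (hK : ∀ v, |q v| ≤ K * ‖v‖ ^ 2) (hpw : 1 / 2 ≤ p w) :
    Tendsto (truncatedDirectional (kernel g j) x w e S) (𝓝[>] 0)
      (𝓝 (directionalIntegral g J x e w S)) ∧
    (∀ r > 0, |truncatedDirectional (kernel g j) x w e S r| ≤
      excessBound K G R * radialMass d J (Ioi 0)) ∧
    |directionalIntegral g J x e w S| ≤ excessBound K G R * radialMass d J (Ioi 0) := by
  have hi := hj.integrable_mul_of_le (h.measurable_circleExcess (x := x) hS)
    (fun t ht => hc.abs_circleExcess_le_min hR hq hK0 hK h hS hpw ht)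
  refine ⟨?_, fun r hr => ?_, hi.2 _ subset_rfl measurableSet_Ioi⟩
  · refine (tendsto_integral_Ici hi.1).congr' ?_
    filter_upwards [self_mem_nhdsWithin] with r hr
    exact (truncatedDirectional_eq hd hj h hS hr).symm
  · rw [truncatedDirectional_eq hd hj h hS hr]
    exact hi.2 _ (Ici_subset_Ioi.2 hr) measurableSet_Ici

theorem circleData_of_orthogonal (hg : ContinuousOn g (sphere 0 1))
    (hgs : ∀ θ ∈ sphere (0 : EuclideanSpace ℝ (Fin d)) 1, g (-θ) = g θ)
    (hG : ∀ θ ∈ sphere (0 : EuclideanSpace ℝ (Fin d)) 1, |g θ| ≤ G)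
    {ν : EuclideanSpace ℝ (Fin d)} (hν : ‖ν‖ = 1) (θ : sphere (0 : (ℝ ∙ ν)ᗮ) 1) :
    CircleData g G ((θ : (ℝ ∙ ν)ᗮ) : EuclideanSpace ℝ (Fin d)) ν :=
  ⟨hg, hgs, hG, (norm_eq_of_mem_sphere θ : ‖(θ : (ℝ ∙ ν)ᗮ)‖ = 1), hν,
    Submodule.mem_orthogonal_singleton_iff_inner_left.1 (θ : (ℝ ∙ ν)ᗮ).2⟩

instance {ν : EuclideanSpace ℝ (Fin d)} : IsFiniteMeasure (surfaceMeasure (ℝ ∙ ν)ᗮ) := by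
  unfold surfaceMeasure; infer_instance

instance : IsFiniteMeasure (surfaceMeasure (EuclideanSpace ℝ (Fin d))) := by
  unfold surfaceMeasure; infer_instance

/-- Dominated convergence as `r → 0` in the average over directions. Measurability in `θ` of the
limit, itself needed later, is inherited from the truncations. -/
theorem tendsto_truncatedMean (hd : 2 ≤ d) (hj : RadialProfile j J)
    (hg : ContinuousOn g (sphere 0 1))
    (hgs : ∀ θ ∈ sphere (0 : EuclideanSpace ℝ (Fin d)) 1, g (-θ) = g θ)
    (hG : ∀ θ ∈ sphere (0 : EuclideanSpace ℝ (Fin d)) 1, |g θ| ≤ G) (hG0 : 0 ≤ G)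
    (hS : MeasurableSet S) {ν : EuclideanSpace ℝ (Fin d)} (hν : ‖ν‖ = 1)
    (hc : SecondOrderContact S x p q 1 R) (hR : 0 < R) (hq : ∀ (t : ℝ) v, q (t • v) = t ^ 2 * q v)
    (hK0 : 0 ≤ K) (hK : ∀ v, |q v| ≤ K * ‖v‖ ^ 2) (hpν : 1 / 2 ≤ p ν) :
    AEStronglyMeasurable (fun θ : sphere (0 : (ℝ ∙ ν)ᗮ) 1 =>
      directionalIntegral g J x (θ : (ℝ ∙ ν)ᗮ) ν S) (surfaceMeasure (ℝ ∙ ν)ᗮ) ∧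
    Tendsto (truncatedMean (kernel g j) x S) (𝓝[>] 0)
      (𝓝 (1 / 2 * ∫ θ : sphere (0 : (ℝ ∙ ν)ᗮ) 1,
        directionalIntegral g J x (θ : (ℝ ∙ ν)ᗮ) ν S ∂(surfaceMeasure (ℝ ∙ ν)ᗮ))) := by
  have hT := fun θ : sphere (0 : (ℝ ∙ ν)ᗮ) 1 => tendsto_truncatedDirectional hd hj
    (circleData_of_orthogonal hg hgs hG hν θ) hS hc hR hq hK0 hK hpν
  have hA := fun r (hr : (0 : ℝ) < r) =>
    truncatedMean_eq_average (x := x) hd hj hg hgs hG hG0 hS hν hr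
  have hlim : Tendsto (fun r => ∫ θ : sphere (0 : (ℝ ∙ ν)ᗮ) 1,
      truncatedDirectional (kernel g j) x ν (θ : (ℝ ∙ ν)ᗮ) S r ∂(surfaceMeasure (ℝ ∙ ν)ᗮ)) (𝓝[>] 0)
      (𝓝 (∫ θ : sphere (0 : (ℝ ∙ ν)ᗮ) 1,
        directionalIntegral g J x (θ : (ℝ ∙ ν)ᗮ) ν S ∂(surfaceMeasure (ℝ ∙ ν)ᗮ))) := by
    refine tendsto_integral_filter_of_dominated_convergence
      (fun _ => excessBound K G R * radialMass d J (Ioi 0)) ?_ ?_ (integrable_const _)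
      (Eventually.of_forall fun θ => (hT θ).1)
    · filter_upwards [self_mem_nhdsWithin] with r hr using (hA r hr).1.aestronglyMeasurable
    · filter_upwards [self_mem_nhdsWithin] with r hr
      exact Eventually.of_forall fun θ => (hT θ).2.1 r hr
  constructor
  · have hu : Tendsto (fun n : ℕ => 1 / ((n : ℝ) + 1)) atTop (𝓝[>] 0) :=
      tendsto_nhdsWithin_iff.2 ⟨tendsto_one_div_add_atTop_nhds_zero_nat,
        Eventually.of_forall fun n => by rw [mem_Ioi]; positivity⟩
    exact aestronglyMeasurable_of_tendsto_ae atTop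
      (fun n : ℕ => (hA (1 / ((n : ℝ) + 1)) (by positivity)).1.aestronglyMeasurable)
      (Eventually.of_forall fun θ => (hT θ).1.comp hu)
  · refine (hlim.const_mul (1 / 2)).congr' ?_
    filter_upwards [self_mem_nhdsWithin] with r hr using ((hA r hr).2).symm

end Limits

/-! ### Limits of the rescaled curvatures along a sequence of kernels. -/

section Sequences

variable {d : ℕ}

/-- The assumptions on a sequence of kernels `g_n(x/|x|) j_n(x)` which concentrate at the origin,
with radial profiles `J_n`. -/
structure ConcentratingKernels (gn : ℕ → EuclideanSpace ℝ (Fin d) → ℝ)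
    (jn : ℕ → EuclideanSpace ℝ (Fin d) → ℝ) (Jn : ℕ → ℝ → ℝ) (g₀ : EuclideanSpace ℝ (Fin d) → ℝ)
    (G : ℝ) : Prop where
  profile : ∀ n, RadialProfile (jn n) (Jn n)
  cont : ∀ n, ContinuousOn (gn n) (sphere 0 1)
  symm : ∀ n, ∀ θ ∈ sphere (0 : EuclideanSpace ℝ (Fin d)) 1, gn n (-θ) = gn n θ
  bound : ∀ᶠ n in atTop, ∀ θ ∈ sphere (0 : EuclideanSpace ℝ (Fin d)) 1, |gn n θ| ≤ G
  bound_nonneg : 0 ≤ G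
  unif : TendstoUniformlyOn gn g₀ atTop (sphere 0 1)
  cont_lim : ContinuousOn g₀ (sphere 0 1)
  angular : Tendsto (fun n => angularMass (gn n)) atTop (𝓝 (angularMass g₀))
  angular_pos : 0 < angularMass g₀
  radial_pos : ∀ n, 0 < radialMass d (Jn n) (Ioi 0)
  conc : ∀ R > 0, Tendsto (fun n => radialMass d (Jn n) (Ici R) / radialMass d (Jn n) (Ioi 0))
    atTop (𝓝 0)

namespace ConcentratingKernels

variable {gn jn : ℕ → EuclideanSpace ℝ (Fin d) → ℝ} {Jn : ℕ → ℝ → ℝ}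
  {g₀ : EuclideanSpace ℝ (Fin d) → ℝ} {G : ℝ} {x ν : EuclideanSpace ℝ (Fin d)}
  {Sn : ℕ → Set (EuclideanSpace ℝ (Fin d))} {pn : ℕ → EuclideanSpace ℝ (Fin d) →L[ℝ] ℝ}
  {q : EuclideanSpace ℝ (Fin d) → ℝ} {K : ℝ}

/-- Uniform convergence together with continuity of the limit allows the argument to move with the
index. The map `N` serves index pairs `(n, t)`. -/
theorem tendsto_moving (hk : ConcentratingKernels gn jn Jn g₀ G) {ι : Type*} {l : Filter ι}
    {N : ι → ℕ} (hN : Tendsto N l atTop) {θ : ι → EuclideanSpace ℝ (Fin d)}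
    (hθ : ∀ᶠ i in l, ‖θ i‖ = 1) {e₀ : EuclideanSpace ℝ (Fin d)} (he₀ : ‖e₀‖ = 1)
    (hlim : Tendsto θ l (𝓝 e₀)) : Tendsto (fun i => gn (N i) (θ i)) l (𝓝 (g₀ e₀)) := by
  have hmem : ∀ᶠ i in l, θ i ∈ sphere (0 : EuclideanSpace ℝ (Fin d)) 1 := by
    filter_upwards [hθ] with i hi; simpa using hi
  have h1 : Tendsto (fun i => g₀ (θ i)) l (𝓝 (g₀ e₀)) :=
    (hk.cont_lim e₀ (by simpa using he₀)).tendsto.comp (tendsto_nhdsWithin_iff.2 ⟨hlim, hmem⟩)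
  have h2 : Tendsto (fun i => gn (N i) (θ i) - g₀ (θ i)) l (𝓝 0) := by
    rw [Metric.tendsto_nhds]
    intro η hη
    filter_upwards [hN.eventually (Metric.tendstoUniformlyOn_iff.1 hk.unif η hη), hmem] with i hi hi'
    have := hi _ hi'
    rw [dist_comm, Real.dist_eq] at this
    rwa [Real.dist_eq, sub_zero]
  simpa using h2.add h1

/-- Convergence of the rescaled nonlocal directional curvatures. -/
theorem tendsto_directional [NeZero d] (hk : ConcentratingKernels gn jn Jn g₀ G)
    (hS : ∀ n, MeasurableSet (Sn n)) (hν : ‖ν‖ = 1)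
    (hp : Tendsto pn atTop (𝓝 (innerSL ℝ ν))) (hq : ∀ (t : ℝ) v, q (t • v) = t ^ 2 * q v)
    (hqc : Continuous q) (hK0 : 0 ≤ K) (hK : ∀ v, |q v| ≤ K * ‖v‖ ^ 2)
    (hc : ∀ δ > 0, ∃ R > 0, ∀ᶠ n in atTop, SecondOrderContact (Sn n) x (pn n) q δ R)
    {en wn : ℕ → EuclideanSpace ℝ (Fin d)} {e₀ : EuclideanSpace ℝ (Fin d)} (he₀ : ‖e₀‖ = 1)
    (hνe : (inner ℝ ν e₀ : ℝ) = 0) (hen : ∀ n, ‖en n‖ = 1) (hwn : ∀ n, ‖wn n‖ = 1)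
    (hew : ∀ n, (inner ℝ (en n) (wn n) : ℝ) = 0) (he : Tendsto en atTop (𝓝 e₀))
    (hw : Tendsto wn atTop (𝓝 ν)) :
    Tendsto (fun n => (kernelMass (kernel (gn n) (jn n)))⁻¹ *
        (1 / 2 * directionalIntegral (gn n) (Jn n) x (en n) (wn n) (Sn n))) atTop
      (𝓝 ((angularMass g₀)⁻¹ * g₀ e₀ * (2 * q e₀))) := by
  have hdata : ∀ᶠ n in atTop, CircleData (gn n) G (en n) (wn n) := by
    filter_upwards [hk.bound] with n hn
    exact ⟨hk.cont n, hk.symm n, hn, hen n, hwn n, hew n⟩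
  have hpw : ∀ᶠ n in atTop, 1 / 2 ≤ pn n (wn n) := by
    have h1 := tendsto_clm_apply hp hw
    have h2 : innerSL ℝ ν ν = 1 := by simp [hν]
    rw [h2] at h1
    exact (h1.eventually (lt_mem_nhds (by norm_num : (1 / 2 : ℝ) < 1))).mono fun i hi => hi.le
  obtain ⟨R₁, hR₁, hc₁⟩ := hc 1 one_pos
  have hfst : Tendsto (Prod.fst : ℕ × ℝ → ℕ) (atTop ×ˢ 𝓝[>] 0) atTop := tendsto_fst
  -- Along the product filter the limit says that `A(t)/t` is close to its limit for all large `n`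
  -- and all small `t` independently, the hypothesis of the averaging lemma.
  have hlim := tendsto_circleExcess_div (ι := ℕ × ℝ) (l := atTop ×ˢ 𝓝[>] (0 : ℝ)) (x := x)
    (G := G) (gi := fun i => gn i.1) (ei := fun i => en i.1) (wi := fun i => wn i.1)
    (Si := fun i => Sn i.1) (pi := fun i => pn i.1) (ti := Prod.snd) (γ := g₀ e₀)
    (hfst.eventually hdata) (fun i => hS i.1) (he.comp hfst) (hw.comp hfst) (hp.comp hfst)
    (by simpa using hνe) (by simp [hν]) hq hqc hK tendsto_snd
    (fun δ hδ => by
      obtain ⟨R, hR, h⟩ := hc δ hδ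
      have h1 : ∀ᶠ t in 𝓝[>] (0 : ℝ), t ≤ R :=
        nhdsWithin_le_nhds ((gt_mem_nhds hR).mono fun t ht => le_of_lt ht)
      filter_upwards [hfst.eventually h, tendsto_snd.eventually h1] with i hi hi' using hi.mono hi')
    (fun θ hθ hθlim => hk.tendsto_moving hfst hθ he₀ hθlim)
  have havg := tendsto_weighted_average (L := 4 * q e₀ * g₀ e₀)
    (m := fun n t => t ^ (d - 1) * (min 1 t * Jn n t))
    -- For `t < 1` the denominator is `t`, so the circle asymptotics apply; dividing by `min 1 t`
    -- makes `h` bounded for all `t`.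
    (h := fun n t => circleExcess (gn n) x (en n) (wn n) (Sn n) t / min 1 t)
    (M := excessBound K G R₁)
    (fun n => (hk.profile n).integrable)
    (fun n t ht => by have := (hk.profile n).nonneg t; positivity)
    hk.radial_pos hk.conc
    (by
      filter_upwards [hdata] with n hn
      exact (hn.measurable_circleExcess (hS n)).div (by fun_prop))
    (by
      filter_upwards [hdata, hpw, hc₁] with n hn hpn hcn t ht
      have hm : 0 < min 1 t := lt_min one_pos ht
      rw [abs_div, abs_of_pos hm, div_le_iff₀ hm]
      exact hcn.abs_circleExcess_le_min hR₁ hq hK0 hK hn (hS n) hpn ht)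
    (by
      intro η hη
      have h1 := Metric.tendsto_nhds.1 hlim η hη
      obtain ⟨P, hP, Q, hQ, hPQ⟩ := eventually_prod_iff.1 h1
      obtain ⟨r, hr, hrQ⟩ := (nhdsGT_basis (0 : ℝ)).eventually_iff.1 hQ
      refine ⟨min r 1, lt_min hr one_pos, ?_⟩
      filter_upwards [hP] with n hn t ht htr
      have h2 := hPQ hn (hrQ ⟨ht, htr.trans_le (min_le_left _ _)⟩)
      rw [Real.dist_eq] at h2
      rw [min_eq_right (htr.le.trans (min_le_right _ _))]
      exact h2.le)
  have hfin := ((hk.angular.inv₀ hk.angular_pos.ne').mul havg).const_mul (1 / 2)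
  have hval : (angularMass g₀)⁻¹ * g₀ e₀ * (2 * q e₀) =
      1 / 2 * ((angularMass g₀)⁻¹ * (4 * q e₀ * g₀ e₀)) := by ring
  rw [hval]
  refine hfin.congr fun n => ?_
  rw [(hk.profile n).kernelMass_eq, directionalIntegral, mul_inv]
  have h3 : ∫ t in Ioi 0, t ^ (d - 1) * (min 1 t * Jn n t) *
      (circleExcess (gn n) x (en n) (wn n) (Sn n) t / min 1 t) =
      ∫ t in Ioi 0, t ^ (d - 1) * Jn n t * circleExcess (gn n) x (en n) (wn n) (Sn n) t := by
    refine setIntegral_congr_fun measurableSet_Ioi fun t ht => ?_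
    have hm : min 1 t ≠ 0 := (lt_min one_pos (mem_Ioi.1 ht)).ne'
    field_simp
  rw [h3, radialMass]
  ring

/-- Convergence of the rescaled nonlocal mean curvatures. -/
theorem tendsto_mean (hd : 2 ≤ d) (hk : ConcentratingKernels gn jn Jn g₀ G)
    (hS : ∀ n, MeasurableSet (Sn n)) (hν : ‖ν‖ = 1)
    (hp : Tendsto pn atTop (𝓝 (innerSL ℝ ν))) (hq : ∀ (t : ℝ) v, q (t • v) = t ^ 2 * q v)
    (hqc : Continuous q) (hK0 : 0 ≤ K) (hK : ∀ v, |q v| ≤ K * ‖v‖ ^ 2)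
    (hc : ∀ δ > 0, ∃ R > 0, ∀ᶠ n in atTop, SecondOrderContact (Sn n) x (pn n) q δ R) :
    Tendsto (fun n => (kernelMass (kernel (gn n) (jn n)))⁻¹ *
        nonlocalMean (kernel (gn n) (jn n)) x (Sn n)) atTop
      (𝓝 ((sphereArea (d - 2))⁻¹ * ∫ θ : sphere (0 : (ℝ ∙ ν)ᗮ) 1, (angularMass g₀)⁻¹ *
        g₀ (θ : (ℝ ∙ ν)ᗮ) * (2 * q (θ : (ℝ ∙ ν)ᗮ)) ∂(surfaceMeasure (ℝ ∙ ν)ᗮ))) := by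
  have : NeZero d := ⟨by omega⟩
  obtain ⟨R₁, hR₁, hc₁⟩ := hc 1 one_pos
  have hpν : ∀ᶠ n in atTop, 1 / 2 ≤ pn n ν := by
    have h1 := tendsto_clm_apply hp (tendsto_const_nhds (x := ν))
    have h2 : innerSL ℝ ν ν = 1 := by simp [hν]
    rw [h2] at h1
    exact (h1.eventually (lt_mem_nhds (by norm_num : (1 / 2 : ℝ) < 1))).mono fun i hi => hi.le
  have hCg : ∀ᶠ n in atTop, angularMass g₀ / 2 < angularMass (gn n) :=
    hk.angular.eventually (lt_mem_nhds (half_lt_self hk.angular_pos))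
  have hM0 : 0 ≤ excessBound K G R₁ := by
    have := hk.bound_nonneg
    have := Real.pi_pos
    rw [excessBound]
    positivity
  have hlim : Tendsto (fun n => ∫ θ : sphere (0 : (ℝ ∙ ν)ᗮ) 1,
      (kernelMass (kernel (gn n) (jn n)))⁻¹ *
        (1 / 2 * directionalIntegral (gn n) (Jn n) x (θ : (ℝ ∙ ν)ᗮ) ν (Sn n))
        ∂(surfaceMeasure (ℝ ∙ ν)ᗮ)) atTop
      (𝓝 (∫ θ : sphere (0 : (ℝ ∙ ν)ᗮ) 1, (angularMass g₀)⁻¹ *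
        g₀ (θ : (ℝ ∙ ν)ᗮ) * (2 * q (θ : (ℝ ∙ ν)ᗮ)) ∂(surfaceMeasure (ℝ ∙ ν)ᗮ))) := by
    refine tendsto_integral_filter_of_dominated_convergence
      (fun _ => (angularMass g₀)⁻¹ * excessBound K G R₁) ?_ ?_ (integrable_const _)
      (Eventually.of_forall fun θ => ?_)
    · filter_upwards [hk.bound, hc₁, hpν] with n h1 h2 h3
      exact ((tendsto_truncatedMean hd (hk.profile n) (hk.cont n) (hk.symm n) h1 hk.bound_nonneg
        (hS n) hν h2 hR₁ hq hK0 hK h3).1.const_mul _).const_mul _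
    · filter_upwards [hk.bound, hc₁, hpν, hCg] with n h1 h2 h3 h4
      refine Eventually.of_forall fun θ => ?_
      have h5 := (tendsto_truncatedDirectional hd (hk.profile n)
        (circleData_of_orthogonal (hk.cont n) (hk.symm n) h1 hν θ) (hS n) h2 hR₁ hq hK0 hK h3).2.2
      have hI := hk.radial_pos n
      have hC := hk.angular_pos
      have hCn : 0 < angularMass (gn n) := by linarith
      rw [(hk.profile n).kernelMass_eq, Real.norm_eq_abs, abs_mul, abs_mul,
        abs_of_pos (by positivity : 0 < (angularMass (gn n) * radialMass d (Jn n) (Ioi 0))⁻¹),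
        abs_of_pos (one_half_pos (α := ℝ))]
      calc (angularMass (gn n) * radialMass d (Jn n) (Ioi 0))⁻¹ *
            (1 / 2 * |directionalIntegral (gn n) (Jn n) x (θ : (ℝ ∙ ν)ᗮ) ν (Sn n)|)
          ≤ (angularMass (gn n) * radialMass d (Jn n) (Ioi 0))⁻¹ *
            (1 / 2 * (excessBound K G R₁ * radialMass d (Jn n) (Ioi 0))) := by gcongr
        _ = (2 * angularMass (gn n))⁻¹ * excessBound K G R₁ := by field_simp
        -- Uses `C_g ≤ 2 C_{g_n}`, valid for large `n` by `hCg`.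
        _ ≤ (angularMass g₀)⁻¹ * excessBound K G R₁ := by
            gcongr
            linarith
    · have hθ : ‖((θ : (ℝ ∙ ν)ᗮ) : EuclideanSpace ℝ (Fin d))‖ = 1 :=
        (norm_eq_of_mem_sphere θ : ‖(θ : (ℝ ∙ ν)ᗮ)‖ = 1)
      exact hk.tendsto_directional hS hν hp hq hqc hK0 hK hc hθ
        (Submodule.mem_orthogonal_singleton_iff_inner_right.1 (θ : (ℝ ∙ ν)ᗮ).2)
        (fun _ => hθ) (fun _ => hν)
        (fun _ => Submodule.mem_orthogonal_singleton_iff_inner_left.1 (θ : (ℝ ∙ ν)ᗮ).2)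
        tendsto_const_nhds tendsto_const_nhds
  refine (hlim.const_mul _).congr' ?_
  filter_upwards [hk.bound, hc₁, hpν] with n h1 h2 h3
  have h4 := (tendsto_truncatedMean hd (hk.profile n) (hk.cont n) (hk.symm n) h1 hk.bound_nonneg
        (hS n) hν h2 hR₁ hq hK0 hK h3).2
  rw [nonlocalMean, h4.limUnder_eq, integral_const_mul, integral_const_mul]
  ring

end ConcentratingKernels

end Sequences

/-! ### From the stated assumptions to concentrating kernels and contact. -/

section Main

variable {d : ℕ}

theorem exists_sphere_bound {g : EuclideanSpace ℝ (Fin d) → ℝ} (hg : ContinuousOn g (sphere 0 1)) :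
    ∃ G ≥ 0, ∀ θ ∈ sphere (0 : EuclideanSpace ℝ (Fin d)) 1, |g θ| ≤ G := by
  obtain ⟨G, hG⟩ := (isCompact_sphere (0 : EuclideanSpace ℝ (Fin d)) 1).exists_bound_of_continuousOn hg
  exact ⟨max G 0, le_max_right _ _, fun θ hθ => (hG θ hθ).trans (le_max_left _ _)⟩

theorem concentratingKernels_of_assumptions (hd : 2 ≤ d)
    {gn jn : ℕ → EuclideanSpace ℝ (Fin d) → ℝ} {g₀ : EuclideanSpace ℝ (Fin d) → ℝ}
    (hj_nonneg : ∀ n, ∀ x, 0 ≤ jn n x) (hj_pos : ∀ n, ∃ x, x ≠ 0 ∧ 0 < jn n x)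
    (hj_mono : ∀ n, RadiallyNonincreasing (jn n))
    (hj_int : ∀ n, Integrable (fun x => min 1 ‖x‖ * jn n x))
    (hg_cont : ∀ n, ContinuousOn (gn n) (sphere 0 1))
    (hg_nonneg : ∀ n, ∀ θ ∈ sphere (0 : EuclideanSpace ℝ (Fin d)) 1, 0 ≤ gn n θ)
    (hg_symm : ∀ n, ∀ θ ∈ sphere (0 : EuclideanSpace ℝ (Fin d)) 1, gn n (-θ) = gn n θ)
    (hg_lim : TendstoUniformlyOn gn g₀ atTop (sphere 0 1)) (hg₀ : angularMass g₀ ≠ 0)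
    (h_conc : ∀ R > 0, Tendsto (fun n => kernelMeasure (kernel (gn n) (jn n)) (ball 0 R)ᶜ)
      atTop (𝓝 0)) :
    ∃ Jn G, ConcentratingKernels gn jn Jn g₀ G := by
  have : NeZero d := ⟨by omega⟩
  choose Jn hJ using fun n => exists_radialProfile (hj_nonneg n) (hj_mono n) (hj_int n)
  have hg₀c : ContinuousOn g₀ (sphere 0 1) :=
    hg_lim.continuousOn (Eventually.of_forall hg_cont).frequently
  obtain ⟨G₀, hG₀, hb⟩ := exists_sphere_bound hg₀c
  have hbound : ∀ᶠ n in atTop, ∀ θ ∈ sphere (0 : EuclideanSpace ℝ (Fin d)) 1,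
      |gn n θ| ≤ G₀ + 1 := by
    filter_upwards [Metric.tendstoUniformlyOn_iff.1 hg_lim 1 one_pos] with n hn θ hθ
    have h1 := hn θ hθ
    rw [dist_comm, Real.dist_eq] at h1
    have h2 := abs_sub_abs_le_abs_sub (gn n θ) (g₀ θ)
    linarith [hb θ hθ]
  have hang : Tendsto (fun n => angularMass (gn n)) atTop (𝓝 (angularMass g₀)) := by
    refine tendsto_integral_filter_of_dominated_convergence (fun _ => G₀ + 1) ?_ ?_
      (integrable_const _) (Eventually.of_forall fun θ => hg_lim.tendsto_at θ.2)
    · exact Eventually.of_forall fun n =>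
        (continuousOn_iff_continuous_domRestrict.1 (hg_cont n)).aestronglyMeasurable
    · filter_upwards [hbound] with n hn using Eventually.of_forall fun θ => hn θ θ.2
  have hang0 : 0 < angularMass g₀ := by
    -- The limit of nonnegative angular masses is nonnegative, and it is nonzero by assumption.
    refine lt_of_le_of_ne (ge_of_tendsto' hang fun n => integral_nonneg fun θ => ?_) hg₀.symm
    exact hg_nonneg n θ θ.2
  have hrad : ∀ n, 0 < radialMass d (Jn n) (Ioi 0) := fun n =>
    (hJ n).radialMass_pos (hj_mono n) (hj_pos n)
  refine ⟨Jn, G₀ + 1, hJ, hg_cont, hg_symm, hbound, by positivity, hg_lim, hg₀c, hang, hang0, hrad,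
    fun R hR => ?_⟩
  have h1 : Tendsto (fun n => ENNReal.ofReal
      (radialMass d (Jn n) (Ici R) / radialMass d (Jn n) (Ioi 0))) atTop (𝓝 0) := by
    refine (h_conc R hR).congr' ?_
    filter_upwards [hbound, hang.eventually (lt_mem_nhds hang0)] with n hn hn'
    exact (hJ n).kernelMeasure_compl_ball (hg_cont n) hn (hg_nonneg n) (hj_nonneg n) (hj_int n) hn'
      (hrad n) hR
  have h2 := (ENNReal.tendsto_toReal ENNReal.zero_ne_top).comp h1
  refine h2.congr fun n => ?_
  rw [Function.comp_apply, ENNReal.toReal_ofReal]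
  refine div_nonneg (setIntegral_nonneg measurableSet_Ici fun t ht => ?_) (hrad n).le
  have := (hJ n).nonneg t
  have ht0 : 0 < t := hR.trans_le ht
  positivity

theorem IsC2Set.measurableSet {E : Set (EuclideanSpace ℝ (Fin d))} (hE : IsC2Set E) :
    MeasurableSet E := by
  obtain ⟨U, -, -, -, rfl⟩ := hE
  exact isClosed_closure.measurableSet

/-- A neighbourhood of the functional `⟨ν, ·⟩`. -/
theorem half_lt_apply_mem_nhds {ν : EuclideanSpace ℝ (Fin d)} (hν : ‖ν‖ = 1) :
    {p : EuclideanSpace ℝ (Fin d) →L[ℝ] ℝ | 1 / 2 < p ν} ∈ 𝓝 (innerSL ℝ ν) := by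
  have : Continuous fun p : EuclideanSpace ℝ (Fin d) →L[ℝ] ℝ => p ν := by fun_prop
  exact (this.tendsto _).eventually (lt_mem_nhds (by simp [hν]; norm_num))

/-- The regularity is that of the boundary of an open set `U` with `E = closure U`. A frontier point
of `E` is one of `U`, and contact passes from `U` to its closure. -/
theorem IsC2Set.exists_contact {E : Set (EuclideanSpace ℝ (Fin d))} (hE : IsC2Set E)
    {x : EuclideanSpace ℝ (Fin d)} (hx : x ∈ frontier E) :
    ∃ (ν : EuclideanSpace ℝ (Fin d)) (f : (ℝ ∙ ν)ᗮ → ℝ), ‖ν‖ = 1 ∧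
      ∃ p : EuclideanSpace ℝ (Fin d) →L[ℝ] ℝ, 1 / 2 < p ν ∧
        ∃ R > 0, SecondOrderContact E x p (curvatureForm f) 1 R := by
  obtain ⟨U, -, -, hU, rfl⟩ := hE
  have hxU : x ∈ frontier U := frontier_closure_subset hx
  obtain ⟨ν, f, hf⟩ := hU x hxU
  obtain ⟨p, hp, R, hR, h⟩ := hf.exists_contact hxU (half_lt_apply_mem_nhds hf.1)
  exact ⟨ν, f, hf.1, p, hp, R / 2, by positivity, h.closure hR (continuous_curvatureForm f)⟩

end Main

end NonlocalCurvature

theorem theorem4p1 (d : ℕ) (hd : 2 ≤ d)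
    (j : ℝ → EuclideanSpace ℝ (Fin d) → ℝ)
    (hj_nonneg : ∀ ε > 0, ∀ x, 0 ≤ j ε x)
    (hj_pos : ∀ ε > 0, ∃ x, x ≠ 0 ∧ 0 < j ε x)
    (hj_mono : ∀ ε > 0, RadiallyNonincreasing (j ε))
    (hj_int : ∀ ε > 0, Integrable (fun x => min 1 ‖x‖ * j ε x))
    (g : ℝ → EuclideanSpace ℝ (Fin d) → ℝ) (g₀ : EuclideanSpace ℝ (Fin d) → ℝ)
    (hg_cont : ∀ ε > 0, ContinuousOn (g ε) (sphere 0 1))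
    (hg_nonneg : ∀ ε > 0, ∀ θ ∈ sphere (0 : EuclideanSpace ℝ (Fin d)) 1, 0 ≤ g ε θ)
    (hg_symm : ∀ ε > 0, ∀ θ ∈ sphere (0 : EuclideanSpace ℝ (Fin d)) 1, g ε (-θ) = g ε θ)
    (hg_lim : TendstoUniformlyOn g g₀ (𝓝[>] 0) (sphere 0 1))
    (hg₀ : angularMass g₀ ≠ 0)
    (h_conc : ∀ R > 0, Tendsto (fun ε => kernelMeasure (kernel (g ε) (j ε)) (ball 0 R)ᶜ)
      (𝓝[>] 0) (𝓝 0))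
    (ε : ℕ → ℝ) (hε_pos : ∀ n, 0 < ε n) (hε_lim : Tendsto ε atTop (𝓝 0))
    (E : Set (EuclideanSpace ℝ (Fin d))) (En : ℕ → Set (EuclideanSpace ℝ (Fin d)))
    (hE : IsC2Set E) (hEn : ∀ n, IsC2Set (En n)) (hconv : ConvergesC2 En E)
    (x : EuclideanSpace ℝ (Fin d)) (hx : x ∈ frontier E) (hxn : ∀ n, x ∈ frontier (En n))
    (ν : EuclideanSpace ℝ (Fin d)) (hν : IsOuterUnitNormal E x ν) :
    -- directional curvatures, in the plane spanned by `e` and the normal `ν` of `E`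
    (∀ e : sphere (0 : (ℝ ∙ ν)ᗮ) 1,
      (∀ᶠ n in atTop,
        NonlocalDirectionalExists (kernel (g (ε n)) (j (ε n))) x ν (e : (ℝ ∙ ν)ᗮ) (En n)) ∧
      Tendsto (fun n => (kernelMass (kernel (g (ε n)) (j (ε n))))⁻¹ *
          nonlocalDirectional (kernel (g (ε n)) (j (ε n))) x ν (e : (ℝ ∙ ν)ᗮ) (En n)) atTop
        (𝓝 ((angularMass g₀)⁻¹ * g₀ (e : (ℝ ∙ ν)ᗮ) * directionalCurvature E x ν e))) ∧
    -- directional curvatures, in planes spanned by the normal and a tangent vector of `En n`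
    (∀ (νn en : ℕ → EuclideanSpace ℝ (Fin d)) (e : sphere (0 : (ℝ ∙ ν)ᗮ) 1),
      (∀ n, IsOuterUnitNormal (En n) x (νn n)) → (∀ n, ‖en n‖ = 1) →
      (∀ n, inner ℝ (en n) (νn n) = 0) →
      Tendsto en atTop (𝓝 ((e : (ℝ ∙ ν)ᗮ) : EuclideanSpace ℝ (Fin d))) →
      (∀ n, NonlocalDirectionalExists (kernel (g (ε n)) (j (ε n))) x (νn n) (en n) (En n)) ∧
      Tendsto (fun n => (kernelMass (kernel (g (ε n)) (j (ε n))))⁻¹ *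
          nonlocalDirectional (kernel (g (ε n)) (j (ε n))) x (νn n) (en n) (En n)) atTop
        (𝓝 ((angularMass g₀)⁻¹ * g₀ (e : (ℝ ∙ ν)ᗮ) * directionalCurvature E x ν e))) ∧
    -- mean curvatures
    (∀ n, NonlocalMeanExists (kernel (g (ε n)) (j (ε n))) x (En n)) ∧
    Tendsto (fun n => (kernelMass (kernel (g (ε n)) (j (ε n))))⁻¹ *
        nonlocalMean (kernel (g (ε n)) (j (ε n))) x (En n)) atTop
      (𝓝 (1 / (angularMass g₀ * sphereArea (d - 2)) *
        ∫ e : sphere (0 : (ℝ ∙ ν)ᗮ) 1, g₀ (e : (ℝ ∙ ν)ᗮ) * directionalCurvature E x ν e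
          ∂(surfaceMeasure (ℝ ∙ ν)ᗮ))) := by
  have : NeZero d := ⟨by omega⟩
  have hε : Tendsto ε atTop (𝓝[>] 0) :=
    tendsto_nhdsWithin_iff.2 ⟨hε_lim, Eventually.of_forall hε_pos⟩
  have hgn : TendstoUniformlyOn (fun n => g (ε n)) g₀ atTop (sphere 0 1) :=
    fun u hu => hε.eventually (hg_lim u hu)
  obtain ⟨Jn, G, hk⟩ := concentratingKernels_of_assumptions hd (gn := fun n => g (ε n))
    (jn := fun n => j (ε n)) (fun n => hj_nonneg _ (hε_pos n)) (fun n => hj_pos _ (hε_pos n))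
    (fun n => hj_mono _ (hε_pos n)) (fun n => hj_int _ (hε_pos n)) (fun n => hg_cont _ (hε_pos n))
    (fun n => hg_nonneg _ (hε_pos n)) (fun n => hg_symm _ (hε_pos n)) hgn hg₀
    (fun R hR => (h_conc R hR).comp hε)
  obtain ⟨f, hf⟩ := hν
  have hν1 := hf.1
  have hS : ∀ n, MeasurableSet (En n) := fun n => (hEn n).measurableSet
  obtain ⟨p, hp, hc⟩ := exists_secondOrderContact hconv hf hxn
  obtain ⟨K, hK0, hK, -⟩ := exists_curvatureForm_bound f
  have hq := fun (t : ℝ) v => curvatureForm_smul f t v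
  have hqc := continuous_curvatureForm f
  obtain ⟨R₁, hR₁, hc₁⟩ := hc 1 one_pos
  refine ⟨fun e => ?_, fun νn en e hνn hen hin helim => ?_, fun n => ?_, ?_⟩
  · have he : ‖((e : (ℝ ∙ ν)ᗮ) : EuclideanSpace ℝ (Fin d))‖ = 1 :=
      (norm_eq_of_mem_sphere e : ‖(e : (ℝ ∙ ν)ᗮ)‖ = 1)
    have heν := Submodule.mem_orthogonal_singleton_iff_inner_left.1 (e : (ℝ ∙ ν)ᗮ).2
    have hνe := Submodule.mem_orthogonal_singleton_iff_inner_right.1 (e : (ℝ ∙ ν)ᗮ).2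
    have hex : ∀ᶠ n in atTop, Tendsto
        (truncatedDirectional (kernel (g (ε n)) (j (ε n))) x ν (e : (ℝ ∙ ν)ᗮ) (En n)) (𝓝[>] 0)
        (𝓝 (directionalIntegral (g (ε n)) (Jn n) x (e : (ℝ ∙ ν)ᗮ) ν (En n))) := by
      -- Here `ν` need not be normal to `En n`. Existence rests on `p n ν ≥ 1/2`, which holds only
      -- for large `n`.
      filter_upwards [hk.bound, hc₁, hp.eventually (half_lt_apply_mem_nhds hν1)] with n h1 h2 h3
      exact (tendsto_truncatedDirectional hd (hk.profile n)
        (circleData_of_orthogonal (hk.cont n) (hk.symm n) h1 hν1 e) (hS n) h2 hR₁ hq hK0 hK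
        (le_of_lt h3)).1
    refine ⟨hex.mono fun n hn => ⟨_, hn⟩, ?_⟩
    rw [← two_mul_curvatureForm_eq hf]
    refine (hk.tendsto_directional (x := x) hS hν1 hp hq hqc hK0 hK hc he hνe (fun _ => he)
      (fun _ => hν1) (fun _ => heν) tendsto_const_nhds tendsto_const_nhds).congr' ?_
    filter_upwards [hex] with n hn
    rw [nonlocalDirectional, hn.limUnder_eq]
  · have he : ‖((e : (ℝ ∙ ν)ᗮ) : EuclideanSpace ℝ (Fin d))‖ = 1 :=
      (norm_eq_of_mem_sphere e : ‖(e : (ℝ ∙ ν)ᗮ)‖ = 1)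
    have hνe := Submodule.mem_orthogonal_singleton_iff_inner_right.1 (e : (ℝ ∙ ν)ᗮ).2
    have hex : ∀ n, Tendsto
        (truncatedDirectional (kernel (g (ε n)) (j (ε n))) x (νn n) (en n) (En n)) (𝓝[>] 0)
        (𝓝 (directionalIntegral (g (ε n)) (Jn n) x (en n) (νn n) (En n))) := by
      intro n
      obtain ⟨fn, hfn⟩ := hνn n
      -- For a fixed `n` the contact comes from the normal of `En n` itself, with constants
      -- depending on `n`; this gives existence for every `n`.
      obtain ⟨p', hp', R', hR', h⟩ := hfn.exists_contact (hxn n) (half_lt_apply_mem_nhds hfn.1)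
      obtain ⟨K', hK0', hK', -⟩ := exists_curvatureForm_bound fn
      obtain ⟨G', -, hG'⟩ := exists_sphere_bound (hk.cont n)
      exact (tendsto_truncatedDirectional hd (hk.profile n)
        ⟨hk.cont n, hk.symm n, hG', hen n, hfn.1, hin n⟩ (hS n) h hR' (curvatureForm_smul fn) hK0'
        hK' (le_of_lt hp')).1
    refine ⟨fun n => ⟨_, hex n⟩, ?_⟩
    have hνlim := tendsto_outerUnitNormal hν1 hxn hp hR₁ hc₁ hνn
    rw [← two_mul_curvatureForm_eq hf]
    refine (hk.tendsto_directional (x := x) hS hν1 hp hq hqc hK0 hK hc he hνe hen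
      (fun n => (hνn n).choose_spec.1) hin helim hνlim).congr fun n => ?_
    rw [nonlocalDirectional, (hex n).limUnder_eq]
  -- The truncated mean does not involve a normal, so any axis `ν'` adapted to `En n` may be used
  -- for existence.
  · obtain ⟨ν', f', hν', p', hp', R', hR', h⟩ := (hEn n).exists_contact (hxn n)
    obtain ⟨K', hK0', hK', -⟩ := exists_curvatureForm_bound f'
    obtain ⟨G', hG0', hG'⟩ := exists_sphere_bound (hk.cont n)
    exact ⟨_, (tendsto_truncatedMean hd (hk.profile n) (hk.cont n) (hk.symm n) hG' hG0' (hS n) hν' h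
      hR' (curvatureForm_smul f') hK0' hK' (le_of_lt hp')).2⟩
  · have hlim := hk.tendsto_mean (x := x) hd hS hν1 hp hq hqc hK0 hK hc
    simp only [two_mul_curvatureForm_eq hf, mul_assoc, integral_const_mul] at hlim
    rw [one_div, mul_inv_rev, mul_assoc]
    exact hlim
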